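/- Let $G=(V,E,w)$ be a finite simple connected undirected graph with at least one edge and with edge weights $w:E\to\mathbb{R}_{>0}$; put $w_{\max}=\max_{e\in E}w(e)$ and $w_{\min}=\min_{e\in E}w(e)$. For a non-empty $S\subseteq V$ let $E(S)$ be the set of edges with both endpoints in $S$, $w(S)=\sum_{e\in E(S)}w(e)$, $d(S)=w(S)/|S|$, and let $\deg_S(v)$ be the weighted degree of $v\in S$ in $G[S]$. The vertex connectivity $\kappa(H)$ of a graph $H$ is its number of vertices minus one if $H$ is a clique, and otherwise the smallest cardinality of a vertex set whose removal disconnects $H$; $H$ is $c$-vertex-connected, for real $c$, if $\kappa(H)\ge c$. The densest $k$-vertex-connected subgraph problem asks, given $G$ and an integer $k\ge 1$, for $S\subseteq V$ maximizing $d(S)$ subject to $G[S]$ being $k$-vertex-connected. Consider the following algorithm with parameter $\gamma\in[1,2]$ and input $(G,k)$. 1. Find all maximal $k$-vertex-connected subgraphs $G[S_1],\dots,G[S_p]$ (maximal with respect to inclusion of vertex sets). If there is none, return INFEASIBLE. 2. For each $i$, find a densest subgraph $D_i$ of $G[S_i]$, i.e. a non-empty $D_i\subseteq S_i$ of maximum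 density. If $k\le\gamma\left(\left\lfloor\lceil d(D_i)/w_{\max}\rceil/2\right\rfloor+1\right)$, let $S_i^*$ be the vertex set returned by $\texttt{Mader\_subgraph}(G[D_i])$; otherwise let $S_i^*=S_i$. 3. Return a set of maximum density among $S_1^*,\dots,S_p^*$. Here $\texttt{Mader\_subgraph}(G[U])$ is the following procedure. Let $d=d(U)$ and $\tau=\left\lfloor\lceil d/w_{\max}(U)\rceil/2\right\rfloor+1$, where $w_{\max}(U)$ is the maximum edge weight of $G[U]$. The procedure $\texttt{Peel}$ applied to an induced subgraph repeatedly deletes a vertex of minimum weighted degree in the remaining graph as long as this degree is at most $d$. Let $\mathcal H$ be the family of connected components of $\texttt{Peel}(G[U])$ with at least $\tau+1$ vertices; if some member of $\mathcal H$ is a clique, return such a member. Otherwise repeat: take any $H\in\mathcal H$ and a minimum vertex separator $C$ of $H$. If $|C|\ge\tau$, return $H$. Otherwise let $\mathcal H'$ be the family of those graphs $\texttt{Peel}(G[S\cup C])$, with $S$ ranging over the vertex sets of the connected components of $H-C$, that have at least $\tau+1$ vertices; if some member of $\mathcal H'$ is a clique, return such a member; otherwise replace $\mathcal H$ by $(\mathcal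 H\setminus\{H\})\cup\mathcal H'$. Then for every $\gamma\in[1,2]$ this algorithm is a polynomial-time $\left(\frac{\gamma}{4}\cdot\frac{w_{\min}}{w_{\max}},\frac1\gamma\right)$-bicriteria approximation algorithm for the densest $k$-vertex-connected subgraph problem. That is: (a) The algorithm can be implemented by one program which, for all $\gamma\in[1,2]$, $G$ and $k$, halts with a possible output of the algorithm after a number of steps bounded by a fixed polynomial in $|V|$. (A step is an elementary operation of a random access machine that adds, subtracts and compares natural numbers and real numbers, and multiplies or divides real numbers by natural numbers.) (b) For all choices left open in the algorithm: INFEASIBLE is returned only if $G$ has no $k$-vertex-connected subgraph; and if $S\subseteq V$ is returned, then $S\ne\emptyset$, $G[S]$ is $(k/\gamma)$-vertex-connected, and $d(S)\ge\frac{\gamma}{4}\cdot\frac{w_{\min}}{w_{\max}}\cdot d(T)$ for every $T\subseteq V$ such that $G[T]$ is $k$-vertex-connected. In particular, for $\gamma=1$ the algorithm is an ordinary $\frac14\cdot\frac{w_{\min}}{w_{\max}}$-approximation algorithm: a returned $S$ induces a $k$-vertex-connected subgraph and $d(S)\ge\frac14\cdot\frac{w_{\min}}{w_{\max}}\cdot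 d(T)$ for every such $T$. -/

import Mathlib

namespace DenseSub

/-! ### Edge-weighted graphs, density and vertex connectivity -/

/-- A simple undirected graph on `V` with positive edge weights. The values of `weight` at pairs
that are not edges are irrelevant: nothing below reads them. -/
structure WeightedGraph (V : Type*) where
  graph : SimpleGraph V
  weight : Sym2 V → ℝ
  weight_pos : ∀ e ∈ graph.edgeSet, 0 < weight e

section Graph

variable {V : Type*} (G : WeightedGraph V)

open Classical in
/-- `E(S)`: the edges of `G` with both endpoints in `S`. -/
noncomputable def WeightedGraph.edgesIn (S : Finset V) : Finset (Sym2 V) :=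
  S.sym2.filter (fun e => e ∈ G.graph.edgeSet)

/-- `w(S)`: the total weight of the edges of `G[S]`. -/
noncomputable def WeightedGraph.weightIn (S : Finset V) : ℝ :=
  ∑ e ∈ G.edgesIn S, G.weight e

/-- The density `d(S) = w(S) / |S|` (used for non-empty `S`). -/
noncomputable def WeightedGraph.density (S : Finset V) : ℝ :=
  G.weightIn S / (S.card : ℝ)

open Classical in
/-- `deg_S(v)`: the weighted degree of `v` in `G[S]`. -/
noncomputable def WeightedGraph.degIn (S : Finset V) (v : V) : ℝ :=
  ∑ u ∈ S.filter (fun u => G.graph.Adj v u), G.weight s(v, u)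

/-- The maximum edge weight of `G[S]` (used when `G[S]` has an edge). -/
noncomputable def WeightedGraph.wmaxIn (S : Finset V) : ℝ :=
  sSup (G.weight '' (G.edgesIn S : Set (Sym2 V)))

/-- The maximum edge weight of `G`. -/
noncomputable def WeightedGraph.wmax : ℝ := sSup (G.weight '' G.graph.edgeSet)

/-- The minimum edge weight of `G`. -/
noncomputable def WeightedGraph.wmin : ℝ := sInf (G.weight '' G.graph.edgeSet)

variable [DecidableEq V]

/-- `C ⊆ S` is a vertex separator of `G[S]`: removing `C` splits the rest of `G[S]` into at least
two non-empty parts without edges between them (a graph without vertices is preconnected). -/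
def WeightedGraph.IsSeparator (S C : Finset V) : Prop :=
  C ⊆ S ∧ ¬ (G.graph.induce ((S \ C : Finset V) : Set V)).Preconnected

/-- `C` is a minimum vertex separator of `G[S]`. -/
def WeightedGraph.IsMinSeparator (S C : Finset V) : Prop :=
  G.IsSeparator S C ∧ ∀ C' : Finset V, G.IsSeparator S C' → C.card ≤ C'.card

open Classical in
/-- The vertex connectivity `κ(G[S])`: `|S| - 1` if `G[S]` is a clique, and otherwise the smallest
cardinality of a vertex separator of `G[S]`. -/
noncomputable def WeightedGraph.kappa (S : Finset V) : ℕ :=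
  if G.graph.IsClique (S : Set V) then S.card - 1
  else sInf {m : ℕ | ∃ C : Finset V, G.IsSeparator S C ∧ C.card = m}

/-- `G[S]` is `c`-vertex-connected, for a real number `c`. -/
def WeightedGraph.IsConn (c : ℝ) (S : Finset V) : Prop := c ≤ (G.kappa S : ℝ)

/-- `G[S]` is a maximal `k`-vertex-connected subgraph of `G`. -/
def WeightedGraph.IsMaxConn (k : ℕ) (S : Finset V) : Prop :=
  G.IsConn k S ∧ ∀ T : Finset V, S ⊆ T → G.IsConn k T → T = S

/-- `D` is (the vertex set of) a densest subgraph of `G[S]`, without any further constraint. -/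
def WeightedGraph.IsDensestIn (S D : Finset V) : Prop :=
  D ⊆ S ∧ D.Nonempty ∧ ∀ T : Finset V, T ⊆ S → T.Nonempty → G.density T ≤ G.density D

/-- `S` is the vertex set of a connected component of `G[U]`. -/
def WeightedGraph.IsComponent (U S : Finset V) : Prop :=
  S ⊆ U ∧ (G.graph.induce (S : Set V)).Connected ∧
    ∀ T : Finset V, T ⊆ U → S ⊆ T → (G.graph.induce (T : Set V)).Connected → T = S

/-! ### The algorithms

Each procedure is given by the relation between its input and its possible outputs; ties and
"arbitrary" choices are left open. Subgraphs are induced and represented by their vertex sets. -/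

/-- `Peel(G[S], d)` may return `G[R]`: while some vertex has weighted degree at most `d`, a vertex
of minimum weighted degree is removed. The result `Null` is represented by `R = ∅`. -/
inductive Peel (d : ℝ) : Finset V → Finset V → Prop
  | done (S : Finset V) (h : ∀ v ∈ S, d < G.degIn S v) : Peel d S S
  | remove (S R : Finset V) (v : V) (hv : v ∈ S) (hmin : ∀ u ∈ S, G.degIn S v ≤ G.degIn S u)
      (hd : G.degIn S v ≤ d) (hR : Peel d (S.erase v) R) : Peel d S R

/-- `𝓗'` is the family that one iteration of the loop of `Mader_subgraph` builds from the current
subgraph `G[H]` and its separator `C`: the graphs `Peel(G[S ∪ C], d)` with at least `τ + 1`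
vertices, where `S` runs over the components of `G[H \ C]`. -/
def IsSplit (d : ℝ) (τ : ℕ) (H C : Finset V) (𝓗' : Finset (Finset V)) : Prop :=
  ∀ R : Finset V, R ∈ 𝓗' ↔
    τ + 1 ≤ R.card ∧ ∃ S : Finset V, G.IsComponent (H \ C) S ∧ Peel G d (S ∪ C) R

/-- The while-loop of `Mader_subgraph`, started with the family `𝓗`, may return `G[R]`. -/
inductive MaderLoop (d : ℝ) (τ : ℕ) : Finset (Finset V) → Finset V → Prop
  | found (𝓗 : Finset (Finset V)) (H C : Finset V) (hH : H ∈ 𝓗) (hC : G.IsMinSeparator H C)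
      (hτ : τ ≤ C.card) : MaderLoop d τ 𝓗 H
  | clique (𝓗 𝓗' : Finset (Finset V)) (H C K : Finset V) (hH : H ∈ 𝓗)
      (hC : G.IsMinSeparator H C) (hτ : C.card < τ) (hsplit : IsSplit G d τ H C 𝓗')
      (hK : K ∈ 𝓗') (hclique : G.graph.IsClique (K : Set V)) : MaderLoop d τ 𝓗 K
  | next (𝓗 𝓗' : Finset (Finset V)) (H C R : Finset V) (hH : H ∈ 𝓗)
      (hC : G.IsMinSeparator H C) (hτ : C.card < τ) (hsplit : IsSplit G d τ H C 𝓗')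
      (hnone : ∀ K ∈ 𝓗', ¬ G.graph.IsClique (K : Set V))
      (hR : MaderLoop d τ (𝓗.erase H ∪ 𝓗') R) : MaderLoop d τ 𝓗 R

/-- The number `⌊⌈d / w⌉ / 2⌋ + 1` (for `d, w ≥ 0`). -/
noncomputable def connBound (d w : ℝ) : ℕ := ⌈d / w⌉₊ / 2 + 1

/-- `Mader_subgraph(G[U])` may return `G[R]`. -/
def MaderSubgraph (U R : Finset V) : Prop :=
  ∃ (H : Finset V) (𝓗 : Finset (Finset V)),
    Peel G (G.density U) U H ∧
    (∀ S : Finset V, S ∈ 𝓗 ↔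
      G.IsComponent H S ∧ connBound (G.density U) (G.wmaxIn U) + 1 ≤ S.card) ∧
    ((R ∈ 𝓗 ∧ G.graph.IsClique (R : Set V)) ∨
      ((∀ K ∈ 𝓗, ¬ G.graph.IsClique (K : Set V)) ∧
        MaderLoop G (G.density U) (connBound (G.density U) (G.wmaxIn U)) 𝓗 R))

/-- One pass of the for-loop of the bicriteria algorithm, for the maximal `k`-vertex-connected
subgraph `G[S]`, may produce the set `R` (the set `S*` of that pass). -/
def BicriteriaPass (γ : ℝ) (k : ℕ) (S R : Finset V) : Prop :=
  ∃ D : Finset V, G.IsDensestIn S D ∧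
    (((k : ℝ) ≤ γ * (connBound (G.density D) G.wmax : ℝ) ∧ MaderSubgraph G D R) ∨
      (¬ (k : ℝ) ≤ γ * (connBound (G.density D) G.wmax : ℝ) ∧ R = S))

/-- The bicriteria algorithm with parameter `γ` may return the given output on input `(G, k)`;
`none` stands for `INFEASIBLE`. -/
def BicriteriaAlgorithm (γ : ℝ) (k : ℕ) : Option (Finset V) → Prop
  | none => ∀ S : Finset V, ¬ G.IsMaxConn k S
  | some R => ∃ star : Finset V → Finset V,
      (∀ S : Finset V, G.IsMaxConn k S → BicriteriaPass G γ k S (star S)) ∧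
      (∃ S : Finset V, G.IsMaxConn k S ∧ R = star S) ∧
      ∀ S : Finset V, G.IsMaxConn k S → G.density (star S) ≤ G.density R

/-- The output meets the requirements of an `(α, β)`-bicriteria approximation for the densest
`k`-vertex-connected subgraph problem on `G`: `INFEASIBLE` is returned only if there is no
`k`-vertex-connected subgraph, and a returned set induces a `(β k)`-vertex-connected subgraph whose
density is at least `α` times the density of every `k`-vertex-connected subgraph. -/
def IsBicriteriaOutput (α β : ℝ) (k : ℕ) : Option (Finset V) → Prop
  | none => ∀ T : Finset V, ¬ G.IsConn k T
  | some S => S.Nonempty ∧ G.IsConn (β * k) S ∧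
      ∀ T : Finset V, G.IsConn k T → α * G.density T ≤ G.density S

/-- The output meets the requirements of an (ordinary) `α`-approximation for the densest
`k`-vertex-connected subgraph problem on `G`. -/
def IsApproxOutput (α : ℝ) (k : ℕ) : Option (Finset V) → Prop
  | none => ∀ T : Finset V, ¬ G.IsConn k T
  | some S => S.Nonempty ∧ G.IsConn k S ∧
      ∀ T : Finset V, G.IsConn k T → α * G.density T ≤ G.density S

end Graph

/-! ### A random access machine over the reals, with a step count

Programs of a while-language over natural-number and real variables and two-dimensional arrays.
Naturals can be added, subtracted (truncated at 0) and compared. Reals can be added, subtracted,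
compared, and multiplied or divided by naturals. There is no product of naturals, no product of
reals and no rounding. Hence on rational inputs all numbers keep a bit length polynomial in the
number of steps and the bit length of the input, so that polynomially many steps mean polynomial
time in the usual sense too. -/

/-- Natural-number expressions; `read a i j` is the entry `(i, j)` of the array number `a`. -/
inductive NExp
  | const (c : ℕ)
  | var (x : ℕ)
  | read (a : ℕ) (i j : NExp)
  | add (e f : NExp)
  | sub (e f : NExp)

/-- Real expressions. -/
inductive RExp
  | var (x : ℕ)
  | read (a : ℕ) (i j : NExp)
  | ofNat (e : NExp)
  | add (r s : RExp)
  | sub (r s : RExp)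
  | mulNat (r : RExp) (e : NExp)
  | divNat (r : RExp) (e : NExp)

/-- Tests. -/
inductive BExp
  | natLe (e f : NExp)
  | realLe (r s : RExp)
  | not (b : BExp)
  | and (b c : BExp)

/-- Programs. -/
inductive Prog
  | skip
  | setNat (x : ℕ) (e : NExp)
  | setReal (x : ℕ) (r : RExp)
  | writeNat (a : ℕ) (i j e : NExp)
  | writeReal (a : ℕ) (i j : NExp) (r : RExp)
  | seq (p q : Prog)
  | cond (b : BExp) (p q : Prog)
  | loop (b : BExp) (p : Prog)

/-- A memory state: the values of the variables and of the arrays of both kinds. -/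
structure Store where
  natVar : ℕ → ℕ
  realVar : ℕ → ℝ
  natArr : ℕ → ℕ → ℕ → ℕ
  realArr : ℕ → ℕ → ℕ → ℝ

def NExp.eval (σ : Store) : NExp → ℕ
  | .const c => c
  | .var x => σ.natVar x
  | .read a i j => σ.natArr a (i.eval σ) (j.eval σ)
  | .add e f => e.eval σ + f.eval σ
  | .sub e f => e.eval σ - f.eval σ

/-- The number of operations in an expression. -/
def NExp.cost : NExp → ℕ
  | .const _ => 1
  | .var _ => 1
  | .read _ i j => i.cost + j.cost + 1
  | .add e f => e.cost + f.cost + 1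
  | .sub e f => e.cost + f.cost + 1

noncomputable def RExp.eval (σ : Store) : RExp → ℝ
  | .var x => σ.realVar x
  | .read a i j => σ.realArr a (i.eval σ) (j.eval σ)
  | .ofNat e => (e.eval σ : ℝ)
  | .add r s => r.eval σ + s.eval σ
  | .sub r s => r.eval σ - s.eval σ
  | .mulNat r e => r.eval σ * (e.eval σ : ℝ)
  | .divNat r e => r.eval σ / (e.eval σ : ℝ)

def RExp.cost : RExp → ℕ
  | .var _ => 1
  | .read _ i j => i.cost + j.cost + 1
  | .ofNat e => e.cost + 1
  | .add r s => r.cost + s.cost + 1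
  | .sub r s => r.cost + s.cost + 1
  | .mulNat r e => r.cost + e.cost + 1
  | .divNat r e => r.cost + e.cost + 1

def BExp.holds (σ : Store) : BExp → Prop
  | .natLe e f => e.eval σ ≤ f.eval σ
  | .realLe r s => r.eval σ ≤ s.eval σ
  | .not b => ¬ b.holds σ
  | .and b c => b.holds σ ∧ c.holds σ

def BExp.cost : BExp → ℕ
  | .natLe e f => e.cost + f.cost + 1
  | .realLe r s => r.cost + s.cost + 1
  | .not b => b.cost + 1
  | .and b c => b.cost + c.cost + 1

def Store.setNat (σ : Store) (x v : ℕ) : Store where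
  natVar := Function.update σ.natVar x v
  realVar := σ.realVar
  natArr := σ.natArr
  realArr := σ.realArr

noncomputable def Store.setReal (σ : Store) (x : ℕ) (v : ℝ) : Store where
  natVar := σ.natVar
  realVar := Function.update σ.realVar x v
  natArr := σ.natArr
  realArr := σ.realArr

def Store.writeNat (σ : Store) (a i j v : ℕ) : Store where
  natVar := σ.natVar
  realVar := σ.realVar
  natArr a' i' j' := if a' = a ∧ i' = i ∧ j' = j then v else σ.natArr a' i' j'
  realArr := σ.realArr

noncomputable def Store.writeReal (σ : Store) (a i j : ℕ) (v : ℝ) : Store where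
  natVar := σ.natVar
  realVar := σ.realVar
  natArr := σ.natArr
  realArr a' i' j' := if a' = a ∧ i' = i ∧ j' = j then v else σ.realArr a' i' j'

/-- `Exec P σ t σ'`: started in the state `σ`, the program `P` halts after `t` steps in the state
`σ'`. -/
inductive Exec : Prog → Store → ℕ → Store → Prop
  | skip (σ : Store) : Exec .skip σ 1 σ
  | setNat (σ : Store) (x : ℕ) (e : NExp) :
      Exec (.setNat x e) σ (e.cost + 1) (σ.setNat x (e.eval σ))
  | setReal (σ : Store) (x : ℕ) (r : RExp) :
      Exec (.setReal x r) σ (r.cost + 1) (σ.setReal x (r.eval σ))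
  | writeNat (σ : Store) (a : ℕ) (i j e : NExp) :
      Exec (.writeNat a i j e) σ (i.cost + j.cost + e.cost + 1)
        (σ.writeNat a (i.eval σ) (j.eval σ) (e.eval σ))
  | writeReal (σ : Store) (a : ℕ) (i j : NExp) (r : RExp) :
      Exec (.writeReal a i j r) σ (i.cost + j.cost + r.cost + 1)
        (σ.writeReal a (i.eval σ) (j.eval σ) (r.eval σ))
  | seq (p q : Prog) (σ σ' σ'' : Store) (s t : ℕ) (hp : Exec p σ s σ') (hq : Exec q σ' t σ'') :
      Exec (.seq p q) σ (s + t) σ''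
  | condTrue (b : BExp) (p q : Prog) (σ σ' : Store) (t : ℕ) (hb : b.holds σ)
      (hp : Exec p σ t σ') : Exec (.cond b p q) σ (b.cost + t) σ'
  | condFalse (b : BExp) (p q : Prog) (σ σ' : Store) (t : ℕ) (hb : ¬ b.holds σ)
      (hq : Exec q σ t σ') : Exec (.cond b p q) σ (b.cost + t) σ'
  | loopDone (b : BExp) (p : Prog) (σ : Store) (hb : ¬ b.holds σ) :
      Exec (.loop b p) σ b.cost σ
  | loopStep (b : BExp) (p : Prog) (σ σ' σ'' : Store) (s t : ℕ) (hb : b.holds σ)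
      (hp : Exec p σ s σ') (hq : Exec (.loop b p) σ' t σ'') :
      Exec (.loop b p) σ (b.cost + s + t) σ''

open Classical in
/-- The initial state for the instance `(G, k)` and the parameter `γ`: natural variables `0` and `1`
hold the number `n` of vertices and `k`, real variable `0` holds `γ`, real array `0` is the weighted
adjacency matrix (with `0` for non-adjacent pairs), and everything else is `0`. -/
noncomputable def inputStore {n : ℕ} (G : WeightedGraph (Fin n)) (γ : ℝ) (k : ℕ) : Store where
  natVar x := if x = 0 then n else if x = 1 then k else 0
  realVar x := if x = 0 then γ else 0
  natArr _ _ _ := 0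
  realArr a i j :=
    if h : a = 0 ∧ i < n ∧ j < n then
      if G.graph.Adj ⟨i, h.2.1⟩ ⟨j, h.2.2⟩ then G.weight s(⟨i, h.2.1⟩, ⟨j, h.2.2⟩) else 0
    else 0

/-- The output in a final state: `INFEASIBLE` if natural variable `0` is `0`, and otherwise the set
of all vertices `v` for which the entry `(v, 0)` of natural array `0` is not `0`. -/
def readOutput (n : ℕ) (σ : Store) : Option (Finset (Fin n)) :=
  if σ.natVar 0 = 0 then none
  else some (Finset.univ.filter (fun v : Fin n => σ.natArr 0 v 0 ≠ 0))

/-- The program `P` runs in polynomial time and is an implementation of the bicriteria algorithm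
(with the parameter `γ ∈ [1, 2]` as part of its input): there is one polynomial `q` such that on
each connected edge-weighted graph with `n` vertices and at least one edge, and each positive
integer `k`, the program halts within `q(n)` steps with a possible output of the algorithm. -/
def ImplementsInPolyTime (P : Prog) : Prop :=
  ∃ q : Polynomial ℕ, ∀ (n : ℕ) (G : WeightedGraph (Fin n)) (γ : ℝ) (k : ℕ),
    G.graph.Connected → G.graph.edgeSet.Nonempty → 1 ≤ γ → γ ≤ 2 → 0 < k →
      ∃ (t : ℕ) (σ : Store), t ≤ q.eval n ∧ Exec P (inputStore G γ k) t σ ∧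
        BicriteriaAlgorithm G γ k (readOutput n σ)

end DenseSub

open DenseSub

/-! Quality of the output. Let `D` be a densest subgraph of a maximal `k`-vertex-connected `G[S]`,
let `d` be its density and `τ' = ⌊⌈d / w_max⌉ / 2⌋ + 1`. If `k ≤ γ τ'`, the pass returns an output
of Mader's procedure. Peeling leaves all weighted degrees above `d`, so by the handshake identity
the output has density at least `d / 2`; it is a clique on at least `τ + 1` vertices or has no
separator below `τ`, and `τ ≥ τ'` because the maximum weight inside `D` is at most `w_max`. If `k >
γ τ'`, the pass returns `S`, in which every vertex has at least `k` neighbours, so that `d(S) ≥ k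
w_min / 2`; since `2 τ' ≥ d / w_max + 1`, this is at least `(γ / 4) (w_min / w_max) d`. Every
`k`-vertex-connected `T` lies in some maximal `S` and is at most as dense as the `D` of that `S`
(`bicriteriaPass_spec`, `isBicriteriaOutput_of_algorithm`).

Why Mader's loop never gets stuck. The potential is the excess `w(H) - d (|H| + 1 - τ)`. It is
non-negative at the start, and deleting a vertex of degree at most `d` does not decrease it. If `H`
is cut along `C` with `|C| ≤ τ - 1`, the excesses of the two sides together with `C` add up to at
least the excess of `H`, so some component keeps a non-negative one (`exists_component_excess`). A
set of exactly `2τ - 2` vertices has negative excess when `τ ≥ 2`, hence peeling such a part cannot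
shrink it below `2τ - 1 ≥ τ + 1` vertices (`card_le_of_peel`). So each split has a member of
non-negative excess (`exists_split`). It is enough to follow one such member instead of the whole
family, and it shrinks with every split.

Running time. Programs are written in a small language in which every loop runs exactly `N = 2n + 2`
times; each statement then costs a polynomial in `N` by construction (`Stmt.code_runs`), and
correctness is a matter of showing that a loop body has become stationary by the end
(`iterate_done`). The single algorithmic engine is minimum cut by push-relabel with a polynomially
bounded potential (`minCut_spec`). It yields minimum separators through vertex splitting
(`minSep_spec`). It also yields densest subgraphs: a cut maximizes `w(T) - g |T|`, and with `g`
updated to the density of the current set, the maximizers strictly shrink, so `n` rounds are enough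
(`densest_spec`). The `k`-vertex-connected sets are enumerated by splitting along separators with
fewer than `k` vertices; such a separator never cuts a `k`-vertex-connected subgraph apart, and a
weight on the stack bounds the number of splits (`subset_of_isConn`, `enum_spec`). -/

namespace DenseSub

/-! ### A language with bulk operations, and its translation into programs -/

inductive Ty
  | nat
  | real

abbrev Ty.Val : Ty → Type
  | .nat => ℕ
  | .real => ℝ

theorem Store.ext' {σ τ : Store} (h1 : σ.natVar = τ.natVar) (h2 : σ.realVar = τ.realVar)
    (h3 : σ.natArr = τ.natArr) (h4 : σ.realArr = τ.realArr) : σ = τ := by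
  cases σ; cases τ; simp_all

def Store.get (σ : Store) : (t : Ty) → ℕ → t.Val
  | .nat, x => σ.natVar x
  | .real, x => σ.realVar x

noncomputable def Store.put (σ : Store) : (t : Ty) → ℕ → t.Val → Store
  | .nat, x, v => σ.setNat x v
  | .real, x, v => σ.setReal x v

def Store.arr (σ : Store) : (t : Ty) → ℕ → ℕ → ℕ → t.Val
  | .nat, a => σ.natArr a
  | .real, a => σ.realArr a

noncomputable def Store.putArr (σ : Store) : (t : Ty) → ℕ → (ℕ → ℕ → t.Val) → Store
  | .nat, a, f => { σ with natArr := Function.update σ.natArr a f }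
  | .real, a, f => { σ with realArr := Function.update σ.realArr a f }

/-- Accumulating operations of a bounded loop inside an expression. -/
inductive Op : Ty → Type
  | sumN : Op .nat
  | find : Op .nat
  | sumR : Op .real
  | maxR : Op .real

/-- `find` starts at `N`, the value for "nothing found". `maxR` starts at `0`, so it computes a
maximum together with `0`, which is harmless for non-negative data. -/
def Op.start (N : ℕ) : {t : Ty} → Op t → t.Val
  | _, .sumN => (0 : ℕ)
  | _, .find => N
  | _, .sumR => (0 : ℝ)
  | _, .maxR => (0 : ℝ)

noncomputable def Op.ap (N : ℕ) : {t : Ty} → Op t → ℕ → t.Val → t.Val → t.Val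
  | _, .sumN, _, a, b => Nat.add a b
  | _, .find, i, a, b => if (1 : ℕ) ≤ b ∧ N ≤ a then i else a
  | _, .sumR, _, a, b => Real.instAdd.add a b
  | _, .maxR, _, a, b => if (a : ℝ) ≤ b then b else a

/-- Binary operations. -/
inductive Bin : Ty → Ty → Ty → Type
  | read (a : ℕ) : Bin .nat .nat .nat
  | add : Bin .nat .nat .nat
  | sub : Bin .nat .nat .nat
  | le : Bin .nat .nat .nat
  | rle : Bin .real .real .nat
  | rread (a : ℕ) : Bin .nat .nat .real
  | radd : Bin .real .real .real
  | rsub : Bin .real .real .real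
  | rmul : Bin .real .nat .real
  | rdiv : Bin .real .nat .real

noncomputable def Bin.ap (σ : Store) : {t u v : Ty} → Bin t u v → t.Val → u.Val → v.Val
  | _, _, _, .read a, x, y => σ.natArr a x y
  | _, _, _, .add, x, y => Nat.add x y
  | _, _, _, .sub, x, y => Nat.sub x y
  | _, _, _, .le, x, y => if (x : ℕ) ≤ y then (1 : ℕ) else (0 : ℕ)
  | _, _, _, .rle, x, y => if (x : ℝ) ≤ y then (1 : ℕ) else (0 : ℕ)
  | _, _, _, .rread a, x, y => σ.realArr a x y
  | _, _, _, .radd, x, y => ((x : ℝ) + (y : ℝ) : ℝ)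
  | _, _, _, .rsub, x, y => ((x : ℝ) - (y : ℝ) : ℝ)
  | _, _, _, .rmul, x, y => ((x : ℝ) * ((y : ℕ) : ℝ) : ℝ)
  | _, _, _, .rdiv, x, y => ((x : ℝ) / ((y : ℕ) : ℝ) : ℝ)

/-- Tests are natural expressions, regarded as true when the value is at least `1`. The only
iteration is a fold over the indices below the global bound `N`, which keeps the cost of evaluation
polynomial in `N`. -/
inductive Ex : Ty → Type
  | bound : Ex .nat
  | const (c : ℕ) : Ex .nat
  | var (x : ℕ) : Ex .nat
  | rvar (x : ℕ) : Ex .real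
  | cast (e : Ex .nat) : Ex .real
  | bin {t u v : Ty} (o : Bin t u v) (e : Ex t) (f : Ex u) : Ex v
  | ite {t : Ty} (b : Ex .nat) (e f : Ex t) : Ex t
  | fold {t : Ty} (o : Op t) (x : ℕ) (e : Ex t) : Ex t

/-- `foldTo f a i` applies `f 0`, ..., `f (i - 1)` to `a` in this order. -/
def foldTo {α : Type*} (f : ℕ → α → α) (a : α) : ℕ → α
  | 0 => a
  | i + 1 => f i (foldTo f a i)

noncomputable def Ex.eval (N : ℕ) : {t : Ty} → Ex t → Store → t.Val
  | _, .bound, _ => N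
  | _, .const c, _ => c
  | _, .var x, σ => σ.natVar x
  | _, .rvar x, σ => σ.realVar x
  | _, .cast e, σ => ((e.eval N σ : ℕ) : ℝ)
  | _, .bin o e f, σ => o.ap σ (e.eval N σ) (f.eval N σ)
  | _, .ite b e f, σ => if (1 : ℕ) ≤ b.eval N σ then e.eval N σ else f.eval N σ
  | _, .fold o x e, σ =>
      foldTo (fun i acc => o.ap N i acc (e.eval N (σ.setNat x i))) (o.start N) N

/-- `rep` has no exit test and always runs `N` times. Termination and polynomial cost are thereby
automatic; the price is that a body has to leave a finished state finished. -/
inductive Stmt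
  | set {t : Ty} (x : ℕ) (e : Ex t)
  | fill {t : Ty} (a x y : ℕ) (e : Ex t)
  | seq (p q : Stmt)
  | ite (b : Ex .nat) (p q : Stmt)
  | rep (p : Stmt)
  | skip

/-- The semantics of statements; `N` is the number of repetitions of all loops. -/
noncomputable def Stmt.den (N : ℕ) : Stmt → Store → Store
  | .set (t := t) x e, σ => σ.put t x (e.eval N σ)
  -- All entries are computed from the old state, even if `e` reads the array `a`.
  | .fill (t := t) a x y e, σ => σ.putArr t a (fun i j =>
      if i < N ∧ j < N then e.eval N ((σ.setNat x i).setNat y j) else σ.arr t a i j)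
  | .seq p q, σ => q.den N (p.den N σ)
  | .ite b p q, σ => if (1 : ℕ) ≤ b.eval N σ then p.den N σ else q.den N σ
  | .rep p, σ => (p.den N)^[N] σ
  | .skip, σ => σ

/-! ### The translation -/

/-- `P` started in `τ` halts within `b` steps in a state satisfying `Q`. -/
def Runs (P : Prog) (b : ℕ) (τ : Store) (Q : Store → Prop) : Prop :=
  ∃ s τ', s ≤ b ∧ Exec P τ s τ' ∧ Q τ'

theorem Runs.mono {P : Prog} {b b' : ℕ} {τ : Store} {Q Q' : Store → Prop} (h : Runs P b τ Q)
    (hb : b ≤ b') (hQ : ∀ τ', Q τ' → Q' τ') : Runs P b' τ Q' := by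
  obtain ⟨s, τ', hs, he, hq⟩ := h
  exact ⟨s, τ', hs.trans hb, he, hQ _ hq⟩

theorem Runs.seq {P P' : Prog} {b b' : ℕ} {τ : Store} {Q Q' : Store → Prop}
    (h : Runs P b τ Q) (h' : ∀ τ', Q τ' → Runs P' b' τ' Q') : Runs (.seq P P') (b + b') τ Q' := by
  obtain ⟨s, τ', hs, he, hq⟩ := h
  obtain ⟨s', τ'', hs', he', hq'⟩ := h' _ hq
  exact ⟨s + s', τ'', by omega, .seq _ _ _ _ _ _ _ he he', hq'⟩

theorem Runs.skip {τ : Store} {Q : Store → Prop} (h : Q τ) : Runs .skip 1 τ Q :=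
  ⟨1, _, le_rfl, .skip _, h⟩

theorem Runs.setNat {x : ℕ} {e : NExp} {τ : Store} {Q : Store → Prop}
    (h : Q (τ.setNat x (e.eval τ))) : Runs (.setNat x e) (e.cost + 1) τ Q :=
  ⟨_, _, le_rfl, .setNat _ _ _, h⟩

theorem Runs.setReal {x : ℕ} {e : RExp} {τ : Store} {Q : Store → Prop}
    (h : Q (τ.setReal x (e.eval τ))) : Runs (.setReal x e) (e.cost + 1) τ Q :=
  ⟨_, _, le_rfl, .setReal _ _ _, h⟩

theorem Runs.cond {c : BExp} {P P' : Prog} {b : ℕ} {τ : Store} {Q : Store → Prop}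
    (h : c.holds τ → Runs P b τ Q) (h' : ¬ c.holds τ → Runs P' b τ Q) :
    Runs (.cond c P P') (c.cost + b) τ Q := by
  by_cases hc : c.holds τ
  · obtain ⟨s, τ', hs, he, hq⟩ := h hc
    exact ⟨_, τ', by omega, .condTrue _ _ _ _ _ _ hc he, hq⟩
  · obtain ⟨s, τ', hs, he, hq⟩ := h' hc
    exact ⟨_, τ', by omega, .condFalse _ _ _ _ _ _ hc he, hq⟩

/-- The slot of the temporary variable number `d`. -/
def tmp (d : ℕ) : ℕ := 2 * d + 1

/-- The part of a state that the high-level language sees. -/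
def hl (τ : Store) : Store where
  natVar x := τ.natVar (2 * x)
  realVar x := τ.realVar (2 * x)
  natArr a := τ.natArr (2 * a)
  realArr a := τ.realArr (2 * a)

/-- High-level variables occupy the even slots and temporaries the odd ones, so scratch work is
invisible to `hl`. Temporary `0`, that is slot `1`, is reserved for the bound `N`. -/
theorem hl_put_tmp (τ : Store) (t : Ty) (d : ℕ) (v : t.Val) : hl (τ.put t (tmp d) v) = hl τ := by
  cases t <;> refine Store.ext' ?_ ?_ ?_ ?_ <;> try rfl
  all_goals
    funext x
    simp only [hl, Store.put, Store.setNat, Store.setReal, tmp]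
    rw [Function.update_of_ne (by omega)]

theorem hl_put (τ : Store) (t : Ty) (x : ℕ) (v : t.Val) :
    hl (τ.put t (2 * x) v) = (hl τ).put t x v := by
  cases t <;> refine Store.ext' ?_ ?_ ?_ ?_ <;> try rfl
  all_goals
    funext y
    simp only [hl, Store.put, Store.setNat, Store.setReal, Function.update_apply]
    simp

theorem Store.get_put_self (σ : Store) (t : Ty) (x : ℕ) (v : t.Val) : (σ.put t x v).get t x = v := by
  cases t <;> simp [Store.put, Store.get, Store.setNat, Store.setReal]

theorem Store.get_put (σ : Store) (t u : Ty) (x y : ℕ) (v : t.Val) (h : y ≠ x) :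
    (σ.put t x v).get u y = σ.get u y := by
  cases t <;> cases u <;> simp [Store.put, Store.get, Store.setNat, Store.setReal, h]

theorem Store.setNat_setNat (σ : Store) (x v w : ℕ) :
    (σ.setNat x v).setNat x w = σ.setNat x w := by
  simp [Store.setNat]

theorem Store.setNat_self (σ : Store) (x : ℕ) : σ.setNat x (σ.natVar x) = σ := by
  simp [Store.setNat]

/-- The two states agree on arrays, on temporaries below `d`. -/
structure Keeps (d : ℕ) (τ τ' : Store) : Prop where
  get : ∀ t, ∀ j < d, τ'.get t (tmp j) = τ.get t (tmp j)
  nat : τ'.natArr = τ.natArr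
  real : τ'.realArr = τ.realArr

theorem Keeps.trans {d : ℕ} {τ τ' τ'' : Store} (h : Keeps d τ τ') (h' : Keeps d τ' τ'') :
    Keeps d τ τ'' :=
  ⟨fun t j hj => (h'.get t j hj).trans (h.get t j hj), h'.nat.trans h.nat, h'.real.trans h.real⟩

theorem Keeps.le {d d' : ℕ} {τ τ' : Store} (h : Keeps d τ τ') (hd : d' ≤ d) : Keeps d' τ τ' :=
  ⟨fun t j hj => h.get t j (hj.trans_le hd), h.nat, h.real⟩

theorem Keeps.put_tmp (τ : Store) (t : Ty) {d d' : ℕ} (v : t.Val) (h : d ≤ d') :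
    Keeps d τ (τ.put t (tmp d') v) := by
  refine ⟨fun u j hj => Store.get_put _ _ _ _ _ _ (by unfold tmp; omega), ?_, ?_⟩ <;>
    cases t <;> rfl

theorem Keeps.put_hl (τ : Store) (t : Ty) (d x : ℕ) (v : t.Val) :
    Keeps d τ (τ.put t (2 * x) v) := by
  refine ⟨fun u j hj => Store.get_put _ _ _ _ _ _ (by unfold tmp; omega), ?_, ?_⟩ <;>
    cases t <;> rfl

/-- Copies a variable. -/
def Prog.move : Ty → ℕ → ℕ → Prog
  | .nat, x, y => .setNat x (.var y)
  | .real, x, y => .setReal x (.var y)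

theorem Runs.move (t : Ty) (x y : ℕ) {τ : Store} {Q : Store → Prop}
    (h : Q (τ.put t x (τ.get t y))) : Runs (.move t x y) 2 τ Q := by
  cases t
  · exact Runs.setNat h
  · exact Runs.setReal h

def Op.init : {t : Ty} → Op t → ℕ → Prog
  | _, .sumN, x => .setNat x (.const 0)
  | _, .find, x => .setNat x (.var 1)
  | _, .sumR, x => .setReal x (.ofNat (.const 0))
  | _, .maxR, x => .setReal x (.ofNat (.const 0))

theorem Op.init_runs {t : Ty} (o : Op t) (x : ℕ) {τ : Store} {Q : Store → Prop}
    (h : Q (τ.put t x (o.start (τ.natVar 1)))) : Runs (o.init x) 3 τ Q := by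
  cases o
  · exact (Runs.setNat h).mono (by simp [NExp.cost]) fun _ => id
  · exact (Runs.setNat h).mono (by simp [NExp.cost]) fun _ => id
  · refine (Runs.setReal (Q := Q) ?_).mono (by simp [NExp.cost, RExp.cost]) fun _ => id
    simpa [RExp.eval, NExp.eval, Store.put, Op.start] using h
  · refine (Runs.setReal (Q := Q) ?_).mono (by simp [NExp.cost, RExp.cost]) fun _ => id
    simpa [RExp.eval, NExp.eval, Store.put, Op.start] using h

def Op.step : {t : Ty} → Op t → (x i y : ℕ) → Prog
  | _, .sumN, x, _, y => .setNat x (.add (.var x) (.var y))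
  | _, .find, x, i, y => .cond (.and (.natLe (.const 1) (.var y)) (.natLe (.var 1) (.var x)))
      (.setNat x (.var i)) .skip
  | _, .sumR, x, _, y => .setReal x (.add (.var x) (.var y))
  | _, .maxR, x, _, y => .cond (.realLe (.var x) (.var y)) (.setReal x (.var y)) .skip

theorem Store.put_get_self (σ : Store) (t : Ty) (x : ℕ) : σ.put t x (σ.get t x) = σ := by
  cases t <;> simp [Store.put, Store.get, Store.setNat, Store.setReal]

theorem Op.step_runs {t : Ty} (o : Op t) (x i y : ℕ) {τ : Store} {Q : Store → Prop}
    (h : Q (τ.put t x (o.ap (τ.natVar 1) (τ.natVar i) (τ.get t x) (τ.get t y)))) :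
    Runs (o.step x i y) 10 τ Q := by
  cases o
  · exact (Runs.setNat h).mono (by simp [NExp.cost]) fun _ => id
  · refine (Runs.cond (b := 2) (fun hc => ?_) fun hc => ?_).mono
      (by simp [NExp.cost, BExp.cost]) fun _ => id
    · refine Runs.setNat ?_
      have : (1 : ℕ) ≤ τ.natVar y ∧ τ.natVar 1 ≤ τ.natVar x := hc
      simpa [Op.ap, Store.get, this, Store.put, NExp.eval, RExp.eval] using h
    · refine (Runs.skip ?_).mono (by omega) fun _ => id
      have hn : ¬ ((1 : ℕ) ≤ τ.natVar y ∧ τ.natVar 1 ≤ τ.natVar x) := hc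
      have := h
      simp only [Op.ap, Store.get, hn, if_false] at this
      rwa [show τ.put .nat x (τ.natVar x) = τ from Store.put_get_self τ .nat x] at this
  · exact (Runs.setReal h).mono (by simp [RExp.cost]) fun _ => id
  · refine (Runs.cond (b := 2) (fun hc => ?_) fun hc => ?_).mono
      (by simp [RExp.cost, BExp.cost]) fun _ => id
    · refine Runs.setReal ?_
      have : τ.realVar x ≤ τ.realVar y := hc
      simpa [Op.ap, Store.get, this, Store.put, NExp.eval, RExp.eval] using h
    · refine (Runs.skip ?_).mono (by omega) fun _ => id
      have hn : ¬ (τ.realVar x ≤ τ.realVar y) := hc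
      have := h
      simp only [Op.ap, Store.get, hn, if_false] at this
      rwa [show τ.put .real x (τ.realVar x) = τ from Store.put_get_self τ .real x] at this

def Bin.instr : {t u v : Ty} → Bin t u v → ℕ → Prog
  | _, _, _, .read a, d =>
      .setNat (tmp d) (.read (2 * a) (.var (tmp d)) (.var (tmp (d + 1))))
  | _, _, _, .add, d => .setNat (tmp d) (.add (.var (tmp d)) (.var (tmp (d + 1))))
  | _, _, _, .sub, d => .setNat (tmp d) (.sub (.var (tmp d)) (.var (tmp (d + 1))))
  | _, _, _, .le, d => .cond (.natLe (.var (tmp d)) (.var (tmp (d + 1))))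
      (.setNat (tmp d) (.const 1)) (.setNat (tmp d) (.const 0))
  | _, _, _, .rle, d => .cond (.realLe (.var (tmp d)) (.var (tmp (d + 1))))
      (.setNat (tmp d) (.const 1)) (.setNat (tmp d) (.const 0))
  | _, _, _, .rread a, d =>
      .setReal (tmp d) (.read (2 * a) (.var (tmp d)) (.var (tmp (d + 1))))
  | _, _, _, .radd, d => .setReal (tmp d) (.add (.var (tmp d)) (.var (tmp (d + 1))))
  | _, _, _, .rsub, d => .setReal (tmp d) (.sub (.var (tmp d)) (.var (tmp (d + 1))))
  | _, _, _, .rmul, d => .setReal (tmp d) (.mulNat (.var (tmp d)) (.var (tmp (d + 1))))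
  | _, _, _, .rdiv, d => .setReal (tmp d) (.divNat (.var (tmp d)) (.var (tmp (d + 1))))

theorem Bin.instr_runs {t u v : Ty} (o : Bin t u v) (d : ℕ) {τ : Store} {Q : Store → Prop}
    (h : Q (τ.put v (tmp d) (o.ap (hl τ) (τ.get t (tmp d)) (τ.get u (tmp (d + 1)))))) :
    Runs (o.instr d) 10 τ Q := by
  cases o
  case le =>
    refine (Runs.cond (b := 2) (fun hc => Runs.setNat ?_) fun hc => Runs.setNat ?_).mono
      (by simp [NExp.cost, BExp.cost]) fun _ => id
    · have : τ.natVar (tmp d) ≤ τ.natVar (tmp (d + 1)) := hc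
      simpa only [Bin.ap, Store.get, this, if_true, Store.put, NExp.eval] using h
    · have : ¬ τ.natVar (tmp d) ≤ τ.natVar (tmp (d + 1)) := hc
      simpa only [Bin.ap, Store.get, this, if_false, Store.put, NExp.eval] using h
  case rle =>
    refine (Runs.cond (b := 2) (fun hc => Runs.setNat ?_) fun hc => Runs.setNat ?_).mono
      (by simp [RExp.cost, BExp.cost]) fun _ => id
    · have : τ.realVar (tmp d) ≤ τ.realVar (tmp (d + 1)) := hc
      simpa only [Bin.ap, Store.get, this, if_true, Store.put, NExp.eval] using h
    · have : ¬ τ.realVar (tmp d) ≤ τ.realVar (tmp (d + 1)) := hc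
      simpa only [Bin.ap, Store.get, this, if_false, Store.put, NExp.eval] using h
  case read a => exact (Runs.setNat h).mono (by simp [NExp.cost]) fun _ => id
  case add => exact (Runs.setNat h).mono (by simp [NExp.cost]) fun _ => id
  case sub => exact (Runs.setNat h).mono (by simp [NExp.cost]) fun _ => id
  all_goals exact (Runs.setReal h).mono (by simp [NExp.cost, RExp.cost]) fun _ => id

/-- Runs `body` for the values `0`, ..., `N - 1` of the temporary number `c`. -/
def countLoop (c : ℕ) (body : Prog) : Prog :=
  .seq (.setNat (tmp c) (.const 0))
    (.loop (.not (.natLe (.var 1) (.var (tmp c))))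
      (.seq body (.setNat (tmp c) (.add (.var (tmp c)) (.const 1)))))

/-- A round costs the test (4), the body and the increment (4); the initialization (2) and the last,
failing test (4) give the final 6. The body must leave both the counter and the bound intact, and
the invariant is claimed for the state after the increment. -/
theorem countLoop_runs {c N B : ℕ} {body : Prog} (I : ℕ → Store → Prop)
    (hb : ∀ i τ, i < N → I i τ → τ.natVar (tmp c) = i → τ.natVar 1 = N →
      Runs body B τ (fun τ' => I (i + 1) (τ'.put .nat (tmp c) (i + 1)) ∧ τ'.natVar (tmp c) = i ∧
        τ'.natVar 1 = N))
    {τ : Store} (hc : 1 ≤ c) (hN : τ.natVar 1 = N) (h0 : I 0 (τ.put .nat (tmp c) (0 : ℕ))) :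
    Runs (countLoop c body) (N * (B + 8) + 6) τ (fun τ' => I N τ' ∧ τ'.natVar 1 = N) := by
  have h1 : (1 : ℕ) ≠ tmp c := by unfold tmp; omega
  have key : ∀ m i τ, i + m = N → I i τ → τ.natVar (tmp c) = i → τ.natVar 1 = N →
      Runs (.loop (.not (.natLe (.var 1) (.var (tmp c))))
        (.seq body (.setNat (tmp c) (.add (.var (tmp c)) (.const 1))))) (m * (B + 8) + 4) τ
        (fun τ' => I N τ' ∧ τ'.natVar 1 = N) := by
    intro m
    induction m with
    | zero =>
      intro i τ him hI hi hN
      refine ⟨_, τ, ?_, .loopDone _ _ _ ?_, ?_, hN⟩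
      · simp [BExp.cost, NExp.cost]
      · simp [BExp.holds, NExp.eval]; omega
      · rwa [show N = i by omega]
    | succ m ih =>
      intro i τ him hI hi hN
      have := Runs.seq (b' := 4) (P' := .setNat (tmp c) (.add (.var (tmp c)) (.const 1)))
        (Q' := fun τ' => I (i + 1) τ' ∧ τ'.natVar (tmp c) = i + 1 ∧ τ'.natVar 1 = N)
        (hb i τ (by omega) hI hi hN) (by
          rintro τ' ⟨h2, h3, h4⟩
          refine (Runs.setNat ?_).mono (by simp [NExp.cost]) fun _ => id
          refine ⟨?_, ?_, ?_⟩
          · simpa [NExp.eval, h3, Store.put] using h2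
          · simp [NExp.eval, Store.setNat, h3]
          · simp [Store.setNat, h1, h4])
      obtain ⟨s, τ', hs, he, h2, h3, h4⟩ := this
      obtain ⟨s', τ'', hs', he', hq⟩ := ih (i + 1) τ' (by omega) h2 h3 h4
      refine ⟨_, τ'', ?_, .loopStep _ _ _ _ _ _ _ ?_ he he', hq⟩
      · simp only [BExp.cost, NExp.cost]
        nlinarith
      · simp [BExp.holds, NExp.eval]; omega
  refine (Runs.seq (b' := N * (B + 8) + 4) (Q := fun τ' => τ' = τ.put .nat (tmp c) (0 : ℕ))
    (Runs.setNat rfl) ?_).mono (by simp [NExp.cost]; omega) fun _ => id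
  rintro τ' rfl
  refine key N 0 _ (by omega) h0 ?_ ?_
  · simp [Store.put, Store.setNat]
  · simp [Store.put, Store.setNat, h1, hN]

/-- The code that leaves the value of an expression in the temporary number `d`. -/
def Ex.code : {t : Ty} → Ex t → ℕ → Prog
  | _, .bound, d => .setNat (tmp d) (.var 1)
  | _, .const c, d => .setNat (tmp d) (.const c)
  | _, .var x, d => .setNat (tmp d) (.var (2 * x))
  | _, .rvar x, d => .setReal (tmp d) (.var (2 * x))
  | _, .cast e, d => .seq (e.code d) (.setReal (tmp d) (.ofNat (.var (tmp d))))
  | _, .bin o e f, d => .seq (e.code d) (.seq (f.code (d + 1)) (o.instr d))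
  | _, .ite b e f, d =>
      .seq (b.code d) (.cond (.natLe (.const 1) (.var (tmp d))) (e.code d) (f.code d))
  | _, .fold o x e, d =>
      -- The bound variable is an ordinary program variable: its old value is kept in temporary `d +
      -- 2` and put back at the end, while `e` works above `d + 2`.
      .seq (.move .nat (tmp (d + 2)) (2 * x)) <| .seq (o.init (tmp d)) <|
      .seq (countLoop (d + 1) <|
        .seq (.move .nat (2 * x) (tmp (d + 1))) <|
        .seq (e.code (d + 3)) (o.step (tmp d) (tmp (d + 1)) (tmp (d + 3)))) <|
      .move .nat (2 * x) (tmp (d + 2))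

/-- The polynomial depends on the expression alone, not on `N`, the depth or the state. Preservation
of the temporaries below `d` is what lets partial results wait while a subexpression is evaluated at
a greater depth; `1 ≤ d` protects the slot of `N`. -/
theorem Ex.code_runs {t : Ty} (e : Ex t) : ∃ q : Polynomial ℕ, ∀ (N d : ℕ) (τ : Store), 1 ≤ d →
    τ.natVar 1 = N → Runs (e.code d) (q.eval N) τ (fun τ' =>
      hl τ' = hl τ ∧ Keeps d τ τ' ∧ τ'.get t (tmp d) = e.eval N (hl τ)) := by
  induction e with
  | bound =>
    refine ⟨Polynomial.C 2, fun N d τ hd hN => ?_⟩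
    rw [Polynomial.eval_C]
    refine Runs.setNat ⟨hl_put_tmp τ .nat d _, Keeps.put_tmp τ .nat _ le_rfl, ?_⟩
    simp [Store.get, Store.setNat, NExp.eval, hN, Ex.eval]
  | const c =>
    refine ⟨Polynomial.C 2, fun N d τ hd hN => ?_⟩
    rw [Polynomial.eval_C]
    refine Runs.setNat ⟨hl_put_tmp τ .nat d _, Keeps.put_tmp τ .nat _ le_rfl, ?_⟩
    simp [Store.get, Store.setNat, NExp.eval, Ex.eval]
  | var x =>
    refine ⟨Polynomial.C 2, fun N d τ hd hN => ?_⟩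
    rw [Polynomial.eval_C]
    refine Runs.setNat ⟨hl_put_tmp τ .nat d _, Keeps.put_tmp τ .nat _ le_rfl, ?_⟩
    simp [Store.get, Store.setNat, NExp.eval, Ex.eval, hl]
  | rvar x =>
    refine ⟨Polynomial.C 2, fun N d τ hd hN => ?_⟩
    rw [Polynomial.eval_C]
    refine Runs.setReal ⟨hl_put_tmp τ .real d _, Keeps.put_tmp τ .real _ le_rfl, ?_⟩
    simp [Store.get, Store.setReal, RExp.eval, Ex.eval, hl]
  | cast e ih =>
    obtain ⟨q, hq⟩ := ih
    refine ⟨q + Polynomial.C 3, fun N d τ hd hN => ?_⟩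
    rw [Polynomial.eval_add, Polynomial.eval_C]
    refine (hq N d τ hd hN).seq ?_
    rintro τ' ⟨h1, h2, h3⟩
    refine Runs.setReal ⟨(hl_put_tmp τ' .real d _).trans h1,
      h2.trans (Keeps.put_tmp τ' .real _ le_rfl), ?_⟩
    have h3' : τ'.natVar (tmp d) = e.eval N (hl τ) := h3
    simp [Store.get, Store.setReal, RExp.eval, NExp.eval, Ex.eval, h3']
  | @bin t u v o e f ihe ihf =>
    obtain ⟨qe, he⟩ := ihe
    obtain ⟨qf, hf⟩ := ihf
    refine ⟨qe + (qf + Polynomial.C 10), fun N d τ hd hN => ?_⟩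
    rw [Polynomial.eval_add, Polynomial.eval_add, Polynomial.eval_C]
    refine (he N d τ hd hN).seq ?_
    rintro τ' ⟨h1, h2, h3⟩
    refine (hf N (d + 1) τ' (by omega) ((h2.get .nat 0 (by omega)).trans hN)).seq ?_
    rintro τ'' ⟨k1, k2, k3⟩
    refine o.instr_runs d ⟨(hl_put_tmp τ'' _ d _).trans (k1.trans h1),
      (h2.trans (k2.le (by omega))).trans (Keeps.put_tmp τ'' _ _ le_rfl), ?_⟩
    rw [Store.get_put_self, k3, k2.get t d (by omega), h3, k1, h1]
    rfl
  | @ite t b e f ihb ihe ihf =>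
    obtain ⟨qb, hb⟩ := ihb
    obtain ⟨qe, he⟩ := ihe
    obtain ⟨qf, hf⟩ := ihf
    refine ⟨qb + (Polynomial.C 3 + (qe + qf)), fun N d τ hd hN => ?_⟩
    rw [Polynomial.eval_add, Polynomial.eval_add, Polynomial.eval_add, Polynomial.eval_C]
    refine (hb N d τ hd hN).seq ?_
    rintro τ' ⟨h1, h2, h3⟩
    have hN' : τ'.natVar 1 = N := (h2.get .nat 0 (by omega)).trans hN
    have h3' : τ'.natVar (tmp d) = b.eval N (hl τ) := h3
    refine Runs.cond (fun hc => ?_) fun hc => ?_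
    · refine (he N d τ' hd hN').mono (by omega) ?_
      rintro τ'' ⟨k1, k2, k3⟩
      refine ⟨k1.trans h1, h2.trans k2, ?_⟩
      have : 1 ≤ τ'.natVar (tmp d) := hc
      rw [h3'] at this
      simp only [Ex.eval, this, if_true, k3, h1]
    · refine (hf N d τ' hd hN').mono (by omega) ?_
      rintro τ'' ⟨k1, k2, k3⟩
      refine ⟨k1.trans h1, h2.trans k2, ?_⟩
      have : ¬ 1 ≤ τ'.natVar (tmp d) := hc
      rw [h3'] at this
      simp only [Ex.eval, this, if_false, k3, h1]
  | @fold t o x e ih =>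
    obtain ⟨q, hq⟩ := ih
    refine ⟨Polynomial.C 2 + (Polynomial.C 3 + ((Polynomial.X * ((Polynomial.C 2 + (q +
      Polynomial.C 10)) + Polynomial.C 8) + Polynomial.C 6) + Polynomial.C 2)),
      fun N d τ hd hN => ?_⟩
    simp only [Polynomial.eval_add, Polynomial.eval_mul, Polynomial.eval_C, Polynomial.eval_X]
    have n1 : tmp d ≠ tmp (d + 1) := by unfold tmp; omega
    have n2 : tmp d ≠ tmp (d + 2) := by unfold tmp; omega
    have n3 : tmp (d + 2) ≠ tmp (d + 1) := by unfold tmp; omega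
    have n4 : ∀ j, tmp j ≠ 2 * x := by intro j; unfold tmp; omega
    have m1 : 1 ≠ tmp d := by unfold tmp; omega
    have m2 : 1 ≠ tmp (d + 2) := by unfold tmp; omega
    have m3 : 1 ≠ tmp (d + 1) := by unfold tmp; omega
    -- The first clause says that the visible state differs from the original one at most in the
    -- bound variable.
    let I : ℕ → Store → Prop := fun i τ' =>
      (hl τ').setNat x (τ.natVar (2 * x)) = hl τ ∧ Keeps d τ τ' ∧
      τ'.natVar (tmp (d + 2)) = τ.natVar (2 * x) ∧
      τ'.get t (tmp d) =
        foldTo (fun i acc => o.ap N i acc (e.eval N ((hl τ).setNat x i))) (o.start N) i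
    refine (Runs.move .nat (tmp (d + 2)) (2 * x) (Q := fun τ' => hl τ' = hl τ ∧ Keeps d τ τ' ∧
      τ'.natVar (tmp (d + 2)) = τ.natVar (2 * x) ∧ τ'.natVar 1 = N) ?_).seq ?_
    · refine ⟨hl_put_tmp _ _ _ _, Keeps.put_tmp _ _ _ (by omega), Store.get_put_self _ .nat _ _, ?_⟩
      exact (Store.get_put _ .nat .nat _ _ _ m2).trans hN
    rintro τ1 ⟨a1, a2, a3, a4⟩
    refine (o.init_runs (tmp d) (Q := fun τ' => I 0 τ' ∧ τ'.natVar 1 = N) ?_).seq ?_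
    · refine ⟨⟨?_, a2.trans (Keeps.put_tmp _ _ _ le_rfl), ?_, ?_⟩, ?_⟩
      · rw [hl_put_tmp, a1]
        exact Store.setNat_self _ _
      · exact (Store.get_put _ _ .nat _ _ _ n2.symm).trans a3
      · rw [Store.get_put_self, a4]; rfl
      · exact (Store.get_put _ _ .nat _ _ _ m1).trans a4
    rintro τ2 ⟨hI, hN2⟩
    have hIput : ∀ i j τ', I i τ' → I i (τ'.put .nat (tmp (d + 1)) j) := by
      rintro i j τ' ⟨b1, b2, b3, b4⟩
      refine ⟨?_, b2.trans (Keeps.put_tmp _ _ _ (by omega)), ?_, ?_⟩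
      · rw [hl_put_tmp, b1]
      · exact (Store.get_put _ .nat .nat _ _ _ n3).trans b3
      · rw [Store.get_put _ _ _ _ _ _ n1, b4]
    refine (countLoop_runs (N := N) (B := 2 + (q.eval N + 10)) I ?_ (by omega) hN2
      (hIput _ _ _ hI)).seq ?_
    · rintro i τ3 hi ⟨b1, b2, b3, b4⟩ hc hN3
      refine (Runs.move .nat (2 * x) (tmp (d + 1)) (Q := fun τ' =>
        hl τ' = (hl τ).setNat x i ∧ Keeps (d + 3) τ3 τ' ∧ τ'.natVar 1 = N) ?_).seq ?_
      · refine ⟨?_, Keeps.put_hl _ _ _ _ _, ?_⟩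
        · rw [hl_put, ← b1]
          change (hl τ3).setNat x _ = _
          rw [Store.setNat_setNat]
          exact congrArg _ hc
        · exact (Store.get_put _ .nat .nat _ _ _ (n4 0)).trans hN3
      rintro τ4 ⟨c1, c2, c3⟩
      refine (hq N (d + 3) τ4 (by omega) c3).seq ?_
      rintro τ5 ⟨d1, d2, d3⟩
      have f1 : τ5.natVar (tmp (d + 1)) = i :=
        ((c2.trans d2).get .nat (d + 1) (by omega)).trans hc
      have f2 : τ5.natVar (tmp (d + 2)) = τ.natVar (2 * x) :=
        ((c2.trans d2).get .nat (d + 2) (by omega)).trans b3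
      have f3 : τ5.natVar 1 = N := ((c2.trans d2).get .nat 0 (by omega)).trans hN3
      have f4 := ((c2.trans d2).get t d (by omega)).trans b4
      refine o.step_runs _ _ _ ⟨hIput _ _ _ ⟨?_, ?_, ?_, ?_⟩, ?_, ?_⟩
      · rw [hl_put_tmp, d1, c1, Store.setNat_setNat]
        exact Store.setNat_self _ _
      · exact ((b2.trans (c2.le (by omega))).trans (d2.le (by omega))).trans
          (Keeps.put_tmp _ _ _ le_rfl)
      · exact (Store.get_put _ _ .nat _ _ _ n2.symm).trans f2
      · rw [Store.get_put_self, f4, d3, c1, f1, f3]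
        rfl
      · exact (Store.get_put _ _ .nat _ _ _ n1.symm).trans f1
      · exact (Store.get_put _ _ .nat _ _ _ m1).trans f3
    rintro τ6 ⟨⟨b1, b2, b3, b4⟩, hN6⟩
    refine Runs.move _ _ _ ⟨?_, b2.trans (Keeps.put_hl _ _ _ _ _), ?_⟩
    · rw [hl_put, ← b1]
      exact congrArg _ b3
    · rw [Store.get_put _ _ _ _ _ _ (n4 d), b4]
      rfl

/-! ### Translation of array updates and statements -/

noncomputable def Store.write (σ : Store) : (t : Ty) → (a i j : ℕ) → t.Val → Store
  | .nat, a, i, j, v => σ.writeNat a i j v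
  | .real, a, i, j, v => σ.writeReal a i j v

theorem Store.get_write (σ : Store) (t u : Ty) (a i j x : ℕ) (v : t.Val) :
    (σ.write t a i j v).get u x = σ.get u x := by
  cases t <;> cases u <;> rfl

theorem Store.arr_write (σ : Store) (t : Ty) (a i j a' i' j' : ℕ) (v : t.Val) :
    (σ.write t a i j v).arr t a' i' j' =
      if a' = a ∧ i' = i ∧ j' = j then v else σ.arr t a' i' j' := by
  cases t <;> rfl

theorem Store.arr_put (σ : Store) (t u : Ty) (a x : ℕ) (v : t.Val) :
    (σ.put t x v).arr u a = σ.arr u a := by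
  cases t <;> cases u <;> rfl

theorem hl_write_buffer (τ : Store) (t : Ty) (i j : ℕ) (v : t.Val) :
    hl (τ.write t 1 i j v) = hl τ := by
  cases t <;> refine Store.ext' ?_ ?_ ?_ ?_ <;> try rfl
  all_goals
    funext b k l
    simp only [hl, Store.write, Store.writeNat, Store.writeReal]
    rw [if_neg (by omega)]

theorem hl_write (τ : Store) (t : Ty) (a i j : ℕ) (v : t.Val) :
    hl (τ.write t (2 * a) i j v) = (hl τ).write t a i j v := by
  cases t <;> refine Store.ext' ?_ ?_ ?_ ?_ <;> try rfl
  all_goals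
    funext b k l
    simp [hl, Store.write, Store.writeNat, Store.writeReal]

theorem Store.putArr_write (σ : Store) (t : Ty) (a i j : ℕ) (f g : ℕ → ℕ → t.Val) (v : t.Val)
    (h : ∀ k l, g k l = if k = i ∧ l = j then v else f k l) :
    (σ.putArr t a f).write t a i j v = σ.putArr t a g := by
  cases t <;> refine Store.ext' ?_ ?_ ?_ ?_ <;> try rfl
  all_goals
    funext b k l
    simp only [Store.putArr, Store.write, Store.writeNat, Store.writeReal, Function.update_apply]
    by_cases hb : b = a
    · simp [hb, h]
    · simp [hb]

theorem Store.putArr_self (σ : Store) (t : Ty) (a : ℕ) (f : ℕ → ℕ → t.Val)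
    (h : ∀ k l, f k l = σ.arr t a k l) : σ.putArr t a f = σ := by
  have : f = σ.arr t a := by funext k l; exact h k l
  subst this
  cases t <;> refine Store.ext' ?_ ?_ ?_ ?_ <;> try rfl
  all_goals simp [Store.putArr, Store.arr]

/-- Stores the variable `x` in the entry of the array `a` whose indices are in `i` and `j`. -/
def Prog.store : Ty → (a i j x : ℕ) → Prog
  | .nat, a, i, j, x => .writeNat a (.var i) (.var j) (.var x)
  | .real, a, i, j, x => .writeReal a (.var i) (.var j) (.var x)

theorem Runs.store (t : Ty) (a i j x : ℕ) {τ : Store} {Q : Store → Prop}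
    (h : Q (τ.write t a (τ.natVar i) (τ.natVar j) (τ.get t x))) :
    Runs (.store t a i j x) 4 τ Q := by
  cases t
  · exact ⟨_, _, by simp [NExp.cost], .writeNat _ _ _ _ _, h⟩
  · exact ⟨_, _, by simp [NExp.cost, RExp.cost], .writeReal _ _ _ _ _, h⟩

/-- Copies an entry of the buffer to the array `a`. -/
def Prog.copy : Ty → (a i j : ℕ) → Prog
  | .nat, a, i, j => .writeNat a (.var i) (.var j) (.read 1 (.var i) (.var j))
  | .real, a, i, j => .writeReal a (.var i) (.var j) (.read 1 (.var i) (.var j))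

theorem Runs.copy (t : Ty) (a i j : ℕ) {τ : Store} {Q : Store → Prop}
    (h : Q (τ.write t a (τ.natVar i) (τ.natVar j) (τ.arr t 1 (τ.natVar i) (τ.natVar j)))) :
    Runs (.copy t a i j) 6 τ Q := by
  cases t
  · exact ⟨_, _, by simp [NExp.cost], .writeNat _ _ _ _ _, h⟩
  · exact ⟨_, _, by simp [NExp.cost, RExp.cost], .writeReal _ _ _ _ _, h⟩

/-- Two nested counting loops. -/
theorem doubleLoop_runs {d N B : ℕ} {body : Prog} (I : ℕ → ℕ → Store → Prop) (hd : 1 ≤ d)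
    (hput : ∀ i j c v τ, d ≤ c → c ≤ d + 1 → I i j τ → I i j (τ.put .nat (tmp c) v))
    (hnext : ∀ i τ, I i N τ → I (i + 1) 0 τ)
    (hb : ∀ i j τ, i < N → j < N → I i j τ → τ.natVar (tmp d) = i → τ.natVar (tmp (d + 1)) = j →
      τ.natVar 1 = N → Runs body B τ (fun τ' => I i (j + 1) τ' ∧ τ'.natVar (tmp d) = i ∧
        τ'.natVar (tmp (d + 1)) = j ∧ τ'.natVar 1 = N))
    {τ : Store} (hN : τ.natVar 1 = N) (h0 : I 0 0 τ) :
    Runs (countLoop d (countLoop (d + 1) body)) (N * (N * (B + 8) + 6 + 8) + 6) τ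
      (fun τ' => I N 0 τ' ∧ τ'.natVar 1 = N) := by
  have n1 : tmp d ≠ tmp (d + 1) := by unfold tmp; omega
  refine countLoop_runs (fun i => I i 0) ?_ hd hN (hput _ _ _ _ _ le_rfl (by omega) h0)
  intro i τ1 hi hI hc hN1
  refine (countLoop_runs (N := N) (B := B) (c := d + 1)
    (fun j τ' => I i j τ' ∧ τ'.natVar (tmp d) = i) ?_ (by omega) hN1 ?_).mono le_rfl ?_
  · rintro j τ2 hj ⟨hI2, hi2⟩ hj2 hN2
    refine (hb i j τ2 hi hj hI2 hi2 hj2 hN2).mono le_rfl ?_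
    rintro τ3 ⟨e1, e2, e3, e4⟩
    exact ⟨⟨hput _ _ _ _ _ (by omega) le_rfl e1,
      (Store.get_put _ .nat .nat _ _ _ n1).trans e2⟩, e3, e4⟩
  · exact ⟨hput _ _ _ _ _ (by omega) le_rfl hI, (Store.get_put _ .nat .nat _ _ _ n1).trans hc⟩
  · rintro τ3 ⟨⟨e1, e2⟩, e3⟩
    exact ⟨hput _ _ _ _ _ le_rfl (by omega) (hnext _ _ e1), e2, e3⟩

def Stmt.code : Stmt → ℕ → Prog
  | .set (t := t) x e, d => .seq (e.code d) (.move t (2 * x) (tmp d))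
  | .fill (t := t) a x y e, d =>
      .seq (.move .nat (tmp (d + 2)) (2 * x)) <| .seq (.move .nat (tmp (d + 3)) (2 * y)) <|
      .seq (countLoop d <| countLoop (d + 1) <|
        .seq (.move .nat (2 * x) (tmp d)) <| .seq (.move .nat (2 * y) (tmp (d + 1))) <|
        .seq (e.code (d + 4)) (.store t 1 (tmp d) (tmp (d + 1)) (tmp (d + 4)))) <|
      .seq (.move .nat (2 * x) (tmp (d + 2))) <| .seq (.move .nat (2 * y) (tmp (d + 3))) <|
      countLoop d <| countLoop (d + 1) <| .copy t (2 * a) (tmp d) (tmp (d + 1))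
  | .seq p q, d => .seq (p.code d) (q.code d)
  | .ite b p q, d =>
      .seq (b.code d) (.cond (.natLe (.const 1) (.var (tmp d))) (p.code d) (q.code d))
  | .rep p, d => countLoop d (p.code (d + 1))
  | .skip, _ => .skip

theorem Store.setNat_restore (σ : Store) (x y a b a' b' : ℕ) :
    ((((σ.setNat x a).setNat y b).setNat x a').setNat y b') = (σ.setNat x a').setNat y b' := by
  refine Store.ext' ?_ rfl rfl rfl
  funext z
  simp only [Store.setNat, Function.update_apply]
  split_ifs <;> rfl

theorem Store.setNat_self₂ (σ : Store) (x y : ℕ) :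
    (σ.setNat x (σ.natVar x)).setNat y (σ.natVar y) = σ := by
  rw [Store.setNat_self, Store.setNat_self]

/-- Since `e` may read the array that is being overwritten, the values are collected in the
low-level array `1`, which is odd and so invisible to `hl`, and copied in a second double loop. The
invariants `I` and `J` record the progress of the two loops in the lexicographic order of the index
pairs. -/
theorem fill_runs {t : Ty} (a x y : ℕ) (e : Ex t) : ∃ q : Polynomial ℕ, ∀ (N d : ℕ) (τ : Store),
    1 ≤ d → τ.natVar 1 = N → Runs ((Stmt.fill a x y e).code d) (q.eval N) τ (fun τ' =>
      hl τ' = (Stmt.fill a x y e).den N (hl τ) ∧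
      ∀ t, ∀ j < d, τ'.get t (tmp j) = τ.get t (tmp j)) := by
  obtain ⟨q, hq⟩ := e.code_runs
  refine ⟨Polynomial.C 2 + (Polynomial.C 2 + ((Polynomial.X * (Polynomial.X * (Polynomial.C 2 +
    (Polynomial.C 2 + (q + Polynomial.C 4)) + Polynomial.C 8) + Polynomial.C 6 + Polynomial.C 8) +
    Polynomial.C 6) + (Polynomial.C 2 + (Polynomial.C 2 + (Polynomial.X * (Polynomial.X *
    (Polynomial.C 6 + Polynomial.C 8) + Polynomial.C 6 + Polynomial.C 8) + Polynomial.C 6))))),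
    fun N d τ hd hN => ?_⟩
  simp only [Polynomial.eval_add, Polynomial.eval_mul, Polynomial.eval_C, Polynomial.eval_X]
  have nt : ∀ i j, i ≠ j → tmp i ≠ tmp j := by intro i j; unfold tmp; omega
  have nx : ∀ j x, tmp j ≠ 2 * x := by intro i j; unfold tmp; omega
  set x0 := τ.natVar (2 * x) with hx0
  set y0 := τ.natVar (2 * y) with hy0
  let E : ℕ → ℕ → t.Val := fun i j => e.eval N (((hl τ).setNat x i).setNat y j)
  let I : ℕ → ℕ → Store → Prop := fun i j τ' =>
    ((hl τ').setNat x x0).setNat y y0 = hl τ ∧ (∀ u, ∀ k < d, τ'.get u (tmp k) = τ.get u (tmp k)) ∧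
    τ'.natVar (tmp (d + 2)) = x0 ∧ τ'.natVar (tmp (d + 3)) = y0 ∧
    ∀ i' j', j' < N → (i' < i ∨ i' = i ∧ j' < j) → τ'.arr t 1 i' j' = E i' j'
  let F : ℕ → ℕ → ℕ → ℕ → t.Val := fun i j i' j' =>
    if (i' < N ∧ j' < N) ∧ (i' < i ∨ i' = i ∧ j' < j) then E i' j' else (hl τ).arr t a i' j'
  let J : ℕ → ℕ → Store → Prop := fun i j τ' =>
    hl τ' = (hl τ).putArr t a (F i j) ∧ (∀ u, ∀ k < d, τ'.get u (tmp k) = τ.get u (tmp k)) ∧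
    ∀ i' j', i' < N → j' < N → τ'.arr t 1 i' j' = E i' j'
  refine (Runs.move .nat (tmp (d + 2)) (2 * x) (Q := fun τ' => hl τ' = hl τ ∧ Keeps d τ τ' ∧
    τ'.natVar (tmp (d + 2)) = x0 ∧ τ'.natVar 1 = N) ?_).seq ?_
  · exact ⟨hl_put_tmp _ _ _ _, Keeps.put_tmp _ _ _ (by omega), Store.get_put_self _ .nat _ _,
      (Store.get_put _ .nat .nat _ _ _ (nt 0 _ (by omega))).trans hN⟩
  rintro τ1 ⟨a1, a2, a3, a4⟩
  refine (Runs.move .nat (tmp (d + 3)) (2 * y) (Q := fun τ' => I 0 0 τ' ∧ τ'.natVar 1 = N)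
    ?_).seq ?_
  · refine ⟨⟨?_, (a2.trans (Keeps.put_tmp _ _ _ (by omega))).get, ?_, ?_, ?_⟩, ?_⟩
    · rw [hl_put_tmp, a1]
      exact Store.setNat_self₂ _ _ _
    · exact (Store.get_put _ .nat .nat _ _ _ (nt _ _ (by omega))).trans a3
    · refine (Store.get_put_self _ .nat _ _).trans ?_
      exact congrFun (congrArg Store.natVar a1) y
    · intro i' j' _ h; omega
    · exact (Store.get_put _ .nat .nat _ _ _ (nt 0 _ (by omega))).trans a4
  rintro τ2 ⟨hI, hN2⟩
  refine (doubleLoop_runs (N := N) (B := 2 + (2 + (q.eval N + 4))) I hd ?_ ?_ ?_ hN2 hI).seq ?_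
  · rintro i j c v τ' hc hc' ⟨b1, b2, b3, b4, b5⟩
    refine ⟨?_, ?_, ?_, ?_, ?_⟩
    · rw [hl_put_tmp, b1]
    · intro u k hk
      rw [Store.get_put _ _ _ _ _ _ (nt _ _ (by omega)), b2 u k hk]
    · exact (Store.get_put _ .nat .nat _ _ _ (nt _ _ (by omega))).trans b3
    · exact (Store.get_put _ .nat .nat _ _ _ (nt _ _ (by omega))).trans b4
    · intro i' j' h h'
      rw [Store.arr_put, b5 i' j' h h']
  · rintro i τ' ⟨b1, b2, b3, b4, b5⟩
    exact ⟨b1, b2, b3, b4, fun i' j' h h' => b5 i' j' h (by omega)⟩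
  · rintro i j τ3 hi hj ⟨b1, b2, b3, b4, b5⟩ hc1 hc2 hN3
    refine (Runs.move .nat (2 * x) (tmp d) (Q := fun τ' =>
      hl τ' = (hl τ3).setNat x i ∧ Keeps (d + 4) τ3 τ') ?_).seq ?_
    · refine ⟨?_, Keeps.put_hl _ _ _ _ _⟩
      rw [hl_put]
      exact congrArg _ hc1
    rintro τ4 ⟨c1, c2⟩
    refine (Runs.move .nat (2 * y) (tmp (d + 1)) (Q := fun τ' =>
      hl τ' = ((hl τ).setNat x i).setNat y j ∧ Keeps (d + 4) τ3 τ') ?_).seq ?_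
    · refine ⟨?_, c2.trans (Keeps.put_hl _ _ _ _ _)⟩
      rw [hl_put, c1, ← b1, Store.setNat_restore]
      exact congrArg _ ((c2.get .nat (d + 1) (by omega)).trans hc2)
    rintro τ5 ⟨d1, d2⟩
    refine (hq N (d + 4) τ5 (by omega) ((d2.get .nat 0 (by omega)).trans hN3)).seq ?_
    rintro τ6 ⟨e1, e2, e3⟩
    have hf := d2.trans e2
    have f1 : τ6.natVar (tmp d) = i := (hf.get .nat d (by omega)).trans hc1
    have f2 : τ6.natVar (tmp (d + 1)) = j := (hf.get .nat (d + 1) (by omega)).trans hc2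
    refine Runs.store _ _ _ _ _ ⟨⟨?_, ?_, ?_, ?_, ?_⟩, ?_, ?_, ?_⟩
    · rw [hl_write_buffer, e1, d1, Store.setNat_restore]
      exact Store.setNat_self₂ _ _ _
    · intro u k hk
      rw [Store.get_write, hf.get u k (by omega), b2 u k hk]
    · exact (Store.get_write _ _ .nat _ _ _ _ _).trans ((hf.get .nat (d + 2) (by omega)).trans b3)
    · exact (Store.get_write _ _ .nat _ _ _ _ _).trans ((hf.get .nat (d + 3) (by omega)).trans b4)
    · intro i' j' h h'
      rw [Store.arr_write, f1, f2]
      by_cases hh : i' = i ∧ j' = j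
      · rw [if_pos ⟨rfl, hh⟩, e3, d1, hh.1, hh.2]
      · rw [if_neg (fun h => hh h.2)]
        have : τ6.arr t 1 i' j' = τ3.arr t 1 i' j' := by
          cases t
          · exact congrFun (congrFun (congrFun hf.nat 1) i') j'
          · exact congrFun (congrFun (congrFun hf.real 1) i') j'
        rw [this, b5 i' j' h (by omega)]
    · exact (Store.get_write _ _ .nat _ _ _ _ _).trans f1
    · exact (Store.get_write _ _ .nat _ _ _ _ _).trans f2
    · exact (Store.get_write _ _ .nat _ _ _ _ _).trans ((hf.get .nat 0 (by omega)).trans hN3)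
  rintro τ7 ⟨⟨b1, b2, b3, b4, b5⟩, hN7⟩
  refine (Runs.move .nat (2 * x) (tmp (d + 2)) (Q := fun τ' =>
    hl τ' = (hl τ7).setNat x x0 ∧ Keeps (d + 4) τ7 τ') ?_).seq ?_
  · refine ⟨?_, Keeps.put_hl _ _ _ _ _⟩
    rw [hl_put]
    exact congrArg _ b3
  rintro τ8 ⟨c1, c2⟩
  refine (Runs.move .nat (2 * y) (tmp (d + 3)) (Q := fun τ' =>
    hl τ' = hl τ ∧ Keeps (d + 4) τ7 τ') ?_).seq ?_
  · refine ⟨?_, c2.trans (Keeps.put_hl _ _ _ _ _)⟩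
    rw [hl_put, c1, ← b1]
    exact congrArg _ ((c2.get .nat (d + 3) (by omega)).trans b4)
  rintro τ9 ⟨d1, d2⟩
  refine (doubleLoop_runs (N := N) (B := 6) J hd ?_ ?_ ?_
    ((d2.get .nat 0 (by omega)).trans hN7) ?_).mono le_rfl ?_
  · rintro i j c v τ' hc hc' ⟨k1, k2, k3⟩
    refine ⟨?_, ?_, ?_⟩
    · rw [hl_put_tmp, k1]
    · intro u k hk
      rw [Store.get_put _ _ _ _ _ _ (nt _ _ (by omega)), k2 u k hk]
    · intro i' j' h h'
      rw [Store.arr_put, k3 i' j' h h']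
  · rintro i τ' ⟨k1, k2, k3⟩
    refine ⟨?_, k2, k3⟩
    rw [k1]
    congr 1
    funext i' j'
    simp only [F]
    congr 1
    apply propext
    omega
  · rintro i j τ' hi hj ⟨k1, k2, k3⟩ hc1 hc2 hN'
    refine Runs.copy _ _ _ _ ⟨⟨?_, ?_, ?_⟩, ?_, ?_, ?_⟩
    · rw [hl_write, k1, hc1, hc2]
      apply Store.putArr_write
      intro i' j'
      rw [k3 i j hi hj]
      simp only [F]
      by_cases hh : i' = i ∧ j' = j
      · obtain ⟨rfl, rfl⟩ := hh
        simp [hi, hj]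
      · rw [if_neg hh]
        congr 1
        apply propext
        omega
    · intro u k hk
      rw [Store.get_write, k2 u k hk]
    · intro i' j' h h'
      rw [Store.arr_write, if_neg (by omega), k3 i' j' h h']
    · exact (Store.get_write _ _ .nat _ _ _ _ _).trans hc1
    · exact (Store.get_write _ _ .nat _ _ _ _ _).trans hc2
    · exact (Store.get_write _ _ .nat _ _ _ _ _).trans hN'
  · refine ⟨?_, ?_, ?_⟩
    · rw [d1, Store.putArr_self]
      intro k l
      simp [F]
    · intro u k hk
      rw [d2.get u k (by omega), b2 u k hk]
    · intro i' j' h h'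
      have : τ9.arr t 1 i' j' = τ7.arr t 1 i' j' := by
        cases t
        · exact congrFun (congrFun (congrFun d2.nat 1) i') j'
        · exact congrFun (congrFun (congrFun d2.real 1) i') j'
      rw [this, b5 i' j' h' (Or.inl h)]
  · rintro τ' ⟨⟨k1, k2, k3⟩, -⟩
    refine ⟨?_, k2⟩
    rw [k1]
    simp only [Stmt.den, F]
    congr 1
    funext i' j'
    congr 1
    apply propext
    omega

/-- A repetition multiplies the polynomial of its body, up to constants, by `X`. Nesting only raises
the degree. -/
theorem Stmt.code_runs (p : Stmt) : ∃ q : Polynomial ℕ, ∀ (N d : ℕ) (τ : Store), 1 ≤ d →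
    τ.natVar 1 = N → Runs (p.code d) (q.eval N) τ (fun τ' => hl τ' = p.den N (hl τ) ∧
      ∀ t, ∀ j < d, τ'.get t (tmp j) = τ.get t (tmp j)) := by
  induction p with
  | @set t x e =>
    obtain ⟨q, hq⟩ := e.code_runs
    refine ⟨q + Polynomial.C 2, fun N d τ hd hN => ?_⟩
    rw [Polynomial.eval_add, Polynomial.eval_C]
    refine (hq N d τ hd hN).seq ?_
    rintro τ' ⟨h1, h2, h3⟩
    refine Runs.move _ _ _ ⟨?_, (h2.trans (Keeps.put_hl _ _ _ _ _)).get⟩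
    rw [hl_put, h1, h3]
    rfl
  | @fill t a x y e => exact fill_runs a x y e
  | seq p q ihp ihq =>
    obtain ⟨qp, hp⟩ := ihp
    obtain ⟨qq, hq⟩ := ihq
    refine ⟨qp + qq, fun N d τ hd hN => ?_⟩
    rw [Polynomial.eval_add]
    refine (hp N d τ hd hN).seq ?_
    rintro τ' ⟨h1, h2⟩
    refine (hq N d τ' hd ((h2 .nat 0 (by omega)).trans hN)).mono le_rfl ?_
    rintro τ'' ⟨k1, k2⟩
    refine ⟨?_, fun t j hj => (k2 t j hj).trans (h2 t j hj)⟩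
    rw [k1, h1]
    rfl
  | ite b p q ihp ihq =>
    obtain ⟨qb, hb⟩ := b.code_runs
    obtain ⟨qp, hp⟩ := ihp
    obtain ⟨qq, hq⟩ := ihq
    refine ⟨qb + (Polynomial.C 3 + (qp + qq)), fun N d τ hd hN => ?_⟩
    rw [Polynomial.eval_add, Polynomial.eval_add, Polynomial.eval_add, Polynomial.eval_C]
    refine (hb N d τ hd hN).seq ?_
    rintro τ' ⟨h1, h2, h3⟩
    have hN' : τ'.natVar 1 = N := (h2.get .nat 0 (by omega)).trans hN
    have h3' : τ'.natVar (tmp d) = b.eval N (hl τ) := h3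
    refine Runs.cond (fun hc => ?_) fun hc => ?_
    · refine (hp N d τ' hd hN').mono (by omega) ?_
      rintro τ'' ⟨k1, k2⟩
      refine ⟨?_, fun t j hj => (k2 t j hj).trans (h2.get t j hj)⟩
      have : 1 ≤ τ'.natVar (tmp d) := hc
      rw [h3'] at this
      simp only [Stmt.den, this, if_true, k1, h1]
    · refine (hq N d τ' hd hN').mono (by omega) ?_
      rintro τ'' ⟨k1, k2⟩
      refine ⟨?_, fun t j hj => (k2 t j hj).trans (h2.get t j hj)⟩
      have : ¬ 1 ≤ τ'.natVar (tmp d) := hc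
      rw [h3'] at this
      simp only [Stmt.den, this, if_false, k1, h1]
  | rep p ih =>
    obtain ⟨q, hq⟩ := ih
    refine ⟨Polynomial.X * (q + Polynomial.C 8) + Polynomial.C 6, fun N d τ hd hN => ?_⟩
    simp only [Polynomial.eval_add, Polynomial.eval_mul, Polynomial.eval_C, Polynomial.eval_X]
    have nt : ∀ i j, i ≠ j → tmp i ≠ tmp j := by intro i j; unfold tmp; omega
    let I : ℕ → Store → Prop := fun i τ' => hl τ' = (p.den N)^[i] (hl τ) ∧
      ∀ t, ∀ j < d, τ'.get t (tmp j) = τ.get t (tmp j)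
    have hput : ∀ i v τ', I i τ' → I i (τ'.put .nat (tmp d) v) := by
      rintro i v τ' ⟨h1, h2⟩
      refine ⟨?_, fun t j hj => ?_⟩
      · rw [hl_put_tmp, h1]
      · rw [Store.get_put _ _ _ _ _ _ (nt _ _ (by omega)), h2 t j hj]
    refine (countLoop_runs (N := N) (B := q.eval N) I ?_ hd hN (hput _ _ _ ⟨rfl, fun _ _ _ => rfl⟩)).mono
      le_rfl fun τ' h => h.1
    rintro i τ1 hi ⟨h1, h2⟩ hc hN1
    refine (hq N (d + 1) τ1 (by omega) hN1).mono le_rfl ?_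
    rintro τ2 ⟨k1, k2⟩
    refine ⟨hput _ _ _ ⟨?_, fun t j hj => ?_⟩, ?_, ?_⟩
    · rw [k1, h1, Function.iterate_succ_apply']
    · rw [k2 t j (by omega), h2 t j hj]
    · exact (k2 .nat d (by omega)).trans hc
    · exact (k2 .nat 0 (by omega)).trans hN1
  | skip =>
    refine ⟨Polynomial.C 1, fun N d τ hd hN => ?_⟩
    rw [Polynomial.eval_C]
    exact Runs.skip ⟨rfl, fun _ _ _ => rfl⟩

/-! ### Programs for graph instances -/

/-- The number of repetitions of loops on graphs with `n` vertices. -/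
def loopBound (n : ℕ) : ℕ := n + n + 2

/-- The state in which a statement of the high-level language starts. -/
noncomputable def startStore {n : ℕ} (G : WeightedGraph (Fin n)) (γ : ℝ) (k : ℕ) : Store where
  natVar x := if x = 0 then n else if x = 1 then k else 0
  realVar x := if x = 0 then γ else 0
  natArr _ _ _ := 0
  realArr := (inputStore G γ k).realArr

/-- The program for a statement. -/
def Stmt.prog (p : Stmt) : Prog :=
  .seq (.setNat 2 (.var 1)) <| .seq (.setNat 1 (.add (.add (.var 0) (.var 0)) (.const 2))) <|
    p.code 1

/-- This turns the running-time claim into a statement about the function `den`. The prologue moves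
`k` to slot `2`, the home of high-level variable `1`, and stores `N = 2n + 2` in slot `1`. This `N`
is large enough for the nodes of both flow networks and for the columns of the stack used below. -/
theorem implements_of_stmt (p : Stmt)
    (h : ∀ (n : ℕ) (G : WeightedGraph (Fin n)) (γ : ℝ) (k : ℕ), G.graph.Connected →
      G.graph.edgeSet.Nonempty → 1 ≤ γ → γ ≤ 2 → 0 < k →
        BicriteriaAlgorithm G γ k (readOutput n (p.den (loopBound n) (startStore G γ k)))) :
    ImplementsInPolyTime p.prog := by
  obtain ⟨q, hq⟩ := p.code_runs
  refine ⟨Polynomial.C 8 + q.comp (Polynomial.X + Polynomial.X + Polynomial.C 2),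
    fun n G γ k h1 h2 h3 h4 h5 => ?_⟩
  have key : Runs p.prog (2 + (6 + q.eval (loopBound n))) (inputStore G γ k) (fun τ =>
      hl τ = p.den (loopBound n) (startStore G γ k)) := by
    refine (Runs.setNat (x := 2) (e := .var 1)
      (Q := fun τ => τ = (inputStore G γ k).setNat 2 k) (by simp [NExp.eval, inputStore])).seq ?_
    rintro τ1 rfl
    refine (Runs.setNat (x := 1) (e := .add (.add (.var 0) (.var 0)) (.const 2)) (Q := fun τ =>
      τ = ((inputStore G γ k).setNat 2 k).setNat 1 (loopBound n))
      (by simp [NExp.eval, inputStore, Store.setNat, loopBound])).seq ?_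
    rintro τ2 rfl
    refine (hq (loopBound n) 1 _ le_rfl (by simp [Store.setNat])).mono le_rfl fun τ hτ => ?_
    rw [hτ.1]
    congr 1
    refine Store.ext' ?_ ?_ ?_ ?_
    · funext x
      simp only [hl, Store.setNat, inputStore, startStore, Function.update_apply]
      by_cases hx : x = 0
      · simp [hx]
      · by_cases hx1 : x = 1
        · simp [hx1]
        · simp [hx, hx1, show 2 * x ≠ 1 by omega, show 2 * x ≠ 2 by omega]
    · funext x
      simp [hl, Store.setNat, inputStore, startStore]
    · rfl
    · funext a i j
      simp only [hl, Store.setNat, inputStore, startStore]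
      simp
  obtain ⟨s, τ, hs, he, hτ⟩ := key
  refine ⟨s, τ, ?_, he, ?_⟩
  · simp only [Polynomial.eval_add, Polynomial.eval_C, Polynomial.eval_comp, Polynomial.eval_X]
    unfold loopBound at hs
    omega
  · have := h n G γ k h1 h2 h3 h4 h5
    -- Variable `0` and array `0` keep their numbers under `hl`, so the output can be read in either
    -- state.
    rw [← hτ] at this
    exact this

/-! ### Weights and degrees -/

section Graph

variable {V : Type*} (G : WeightedGraph V)

open Classical in
/-- The weighted adjacency matrix. -/
noncomputable def WeightedGraph.mat (u v : V) : ℝ := if G.graph.Adj u v then G.weight s(u, v) else 0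

theorem mat_comm (u v : V) : G.mat u v = G.mat v u := by
  rw [WeightedGraph.mat, WeightedGraph.mat, Sym2.eq_swap (a := u) (b := v)]
  by_cases h : G.graph.Adj u v
  · rw [if_pos h, if_pos h.symm]
  · rw [if_neg h, if_neg fun h' => h h'.symm]

theorem mat_pos_iff (u v : V) : 0 < G.mat u v ↔ G.graph.Adj u v := by
  unfold WeightedGraph.mat
  split_ifs with h
  · exact ⟨fun _ => h, fun _ => G.weight_pos _ h⟩
  · simp [h]

theorem mat_nonneg (u v : V) : 0 ≤ G.mat u v := by
  by_cases h : G.graph.Adj u v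
  · exact ((mat_pos_iff G u v).2 h).le
  · simp [WeightedGraph.mat, h]

theorem mat_self (u : V) : G.mat u u = 0 := by simp [WeightedGraph.mat]

theorem degIn_eq_sum (S : Finset V) (v : V) : G.degIn S v = ∑ u ∈ S, G.mat v u := by
  simp only [WeightedGraph.degIn, WeightedGraph.mat, Finset.sum_filter]

theorem degIn_mono {S T : Finset V} (h : S ⊆ T) (v : V) : G.degIn S v ≤ G.degIn T v := by
  rw [degIn_eq_sum, degIn_eq_sum]
  exact Finset.sum_le_sum_of_subset_of_nonneg h fun _ _ _ => mat_nonneg G _ _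

theorem mem_edgesIn {S : Finset V} {u v : V} :
    s(u, v) ∈ G.edgesIn S ↔ u ∈ S ∧ v ∈ S ∧ G.graph.Adj u v := by
  simp [WeightedGraph.edgesIn, and_assoc]

set_option linter.unusedSectionVars false

variable [DecidableEq V]

theorem weightIn_insert {S : Finset V} {v : V} (hv : v ∉ S) :
    G.weightIn (insert v S) = G.weightIn S + G.degIn S v := by
  classical
  have h : G.edgesIn (insert v S) =
      G.edgesIn S ∪ (S.filter (fun u => G.graph.Adj v u)).image (fun u => s(v, u)) := by
    ext e
    induction e with | _ a b
    simp only [Finset.mem_union, mem_edgesIn, Finset.mem_insert, Finset.mem_image,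
      Finset.mem_filter, Sym2.eq_iff]
    constructor
    · rintro ⟨rfl | ha, rfl | hb, hab⟩
      · exact absurd hab (G.graph.irrefl)
      · exact Or.inr ⟨b, ⟨hb, hab⟩, Or.inl ⟨rfl, rfl⟩⟩
      · exact Or.inr ⟨a, ⟨ha, hab.symm⟩, Or.inr ⟨rfl, rfl⟩⟩
      · exact Or.inl ⟨ha, hb, hab⟩
    · rintro (⟨ha, hb, hab⟩ | ⟨u, ⟨hu, hvu⟩, ⟨rfl, rfl⟩ | ⟨rfl, rfl⟩⟩)
      · exact ⟨Or.inr ha, Or.inr hb, hab⟩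
      · exact ⟨Or.inl rfl, Or.inr hu, hvu⟩
      · exact ⟨Or.inr hu, Or.inl rfl, hvu.symm⟩
  rw [WeightedGraph.weightIn, h, Finset.sum_union, Finset.sum_image]
  · rfl
  · intro a _ b _ hab
    rcases Sym2.eq_iff.1 hab with h | h
    · exact h.2
    · exact h.2.trans h.1
  · rw [Finset.disjoint_left]
    rintro e he he'
    simp only [Finset.mem_image, Finset.mem_filter] at he'
    obtain ⟨u, -, rfl⟩ := he'
    exact hv ((mem_edgesIn G).1 he).1

theorem weightIn_empty : G.weightIn ∅ = 0 := by
  simp [WeightedGraph.weightIn, WeightedGraph.edgesIn]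

/-- Double sums over vertices replace sums over unordered pairs; monotonicity and evaluation by a
program then work term by term. -/
theorem two_weightIn (S : Finset V) : 2 * G.weightIn S = ∑ u ∈ S, ∑ v ∈ S, G.mat u v := by
  induction S using Finset.induction_on with
  | empty => simp [weightIn_empty]
  | insert v S hv ih =>
    rw [weightIn_insert G hv, Finset.sum_insert hv, Finset.sum_insert hv, mat_self]
    simp_rw [Finset.sum_insert hv]
    rw [Finset.sum_add_distrib, ← ih, degIn_eq_sum]
    simp_rw [mat_comm G _ v]
    ring

theorem weightIn_erase {S : Finset V} {v : V} (hv : v ∈ S) :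
    G.weightIn S = G.weightIn (S.erase v) + G.degIn S v := by
  conv_lhs => rw [← Finset.insert_erase hv]
  rw [weightIn_insert G (Finset.notMem_erase v S), degIn_eq_sum, degIn_eq_sum,
    ← Finset.add_sum_erase S _ hv, mat_self, zero_add]

theorem weightIn_nonneg (S : Finset V) : 0 ≤ G.weightIn S := by
  have := two_weightIn G S
  have h : 0 ≤ ∑ u ∈ S, ∑ v ∈ S, G.mat u v :=
    Finset.sum_nonneg fun _ _ => Finset.sum_nonneg fun _ _ => mat_nonneg G _ _
  linarith

theorem weightIn_mono {S T : Finset V} (h : S ⊆ T) : G.weightIn S ≤ G.weightIn T := by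
  have h1 := two_weightIn G S
  have h2 := two_weightIn G T
  have : ∑ u ∈ S, ∑ v ∈ S, G.mat u v ≤ ∑ u ∈ T, ∑ v ∈ T, G.mat u v :=
    (Finset.sum_le_sum fun _ _ => Finset.sum_le_sum_of_subset_of_nonneg h
      fun _ _ _ => mat_nonneg G _ _).trans
    (Finset.sum_le_sum_of_subset_of_nonneg h fun _ _ _ =>
      Finset.sum_nonneg fun _ _ => mat_nonneg G _ _)
  linarith

theorem sum_degIn (S : Finset V) : ∑ v ∈ S, G.degIn S v = 2 * G.weightIn S := by
  rw [two_weightIn]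
  exact Finset.sum_congr rfl fun v _ => degIn_eq_sum G S v

theorem density_mul_card {S : Finset V} (h : S.Nonempty) :
    G.density S * S.card = G.weightIn S := by
  have : (S.card : ℝ) ≠ 0 := by exact_mod_cast h.card_pos.ne'
  rw [WeightedGraph.density]
  field_simp

theorem density_nonneg (S : Finset V) : 0 ≤ G.density S :=
  div_nonneg (weightIn_nonneg G S) (Nat.cast_nonneg _)

/-- By the handshake identity the degrees sum to `2 w(S)`. This is where the factor `1/2` of Mader's
procedure is lost. -/
theorem half_le_density {S : Finset V} {d : ℝ} (h : S.Nonempty) (hd : ∀ v ∈ S, d ≤ G.degIn S v) :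
    d / 2 ≤ G.density S := by
  have hc : (0 : ℝ) < S.card := by exact_mod_cast h.card_pos
  have h1 := Finset.card_nsmul_le_sum S _ d hd
  rw [sum_degIn, nsmul_eq_mul] at h1
  rw [WeightedGraph.density, le_div_iff₀ hc]
  linarith

theorem degIn_le_mul {S : Finset V} {v : V} (hv : v ∈ S) {w : ℝ} 
    (h : ∀ u ∈ S, G.mat v u ≤ w) : G.degIn S v ≤ w * (S.card - 1 : ℝ) := by
  rw [degIn_eq_sum, ← Finset.add_sum_erase S _ hv, mat_self, zero_add]
  refine (Finset.sum_le_card_nsmul _ _ w fun u hu => h u (Finset.mem_of_mem_erase hu)).trans ?_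
  rw [Finset.card_erase_of_mem hv, nsmul_eq_mul, Nat.cast_sub (Finset.card_pos.2 ⟨v, hv⟩)]
  simp [mul_comm]

theorem two_weightIn_le {S : Finset V} {w : ℝ} (h : ∀ u ∈ S, ∀ v ∈ S, G.mat u v ≤ w) :
    2 * G.weightIn S ≤ w * S.card * (S.card - 1 : ℝ) := by
  rw [← sum_degIn]
  refine (Finset.sum_le_card_nsmul _ _ _ fun v hv => degIn_le_mul G hv (h v hv)).trans ?_
  rw [nsmul_eq_mul]
  exact le_of_eq (by ring)

/-! ### Connected subsets and separators -/

/-- No edge of `G[U]` leaves `A`. -/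
def WeightedGraph.Closed (U A : Finset V) : Prop := ∀ a ∈ A, ∀ b ∈ U, G.graph.Adj a b → b ∈ A

/-- Closed sets replace paths and subtypes from here on. For the harder direction the vertices
reachable from a given one form a closed set. -/
theorem preconnected_iff (S : Finset V) : (G.graph.induce (S : Set V)).Preconnected ↔
    ∀ A ⊆ S, A.Nonempty → G.Closed S A → S ⊆ A := by
  classical
  constructor
  · rintro h A hA ⟨a, ha⟩ hc b hb
    have hr := h ⟨a, hA ha⟩ ⟨b, hb⟩
    rw [SimpleGraph.reachable_iff_reflTransGen] at hr
    have : ∀ x : (S : Set V), Relation.ReflTransGen (G.graph.induce (S : Set V)).Adj ⟨a, hA ha⟩ x →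
        (x : V) ∈ A := by
      intro x hx
      induction hx with
      | refl => exact ha
      | @tail y z _ hyz ih => exact hc _ ih _ z.2 hyz
    exact this _ hr
  · rintro h ⟨a, ha⟩ ⟨b, hb⟩
    let A := S.filter (fun x => ∃ hx : x ∈ (S : Set V),
      (G.graph.induce (S : Set V)).Reachable ⟨a, ha⟩ ⟨x, hx⟩)
    have : S ⊆ A := by
      refine h A (Finset.filter_subset _ _) ⟨a, Finset.mem_filter.2 ⟨ha, ha, .refl _⟩⟩ ?_
      intro x hx y hy hxy
      obtain ⟨hxS, hx', hr⟩ := Finset.mem_filter.1 hx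
      refine Finset.mem_filter.2 ⟨hy, hy, hr.trans (SimpleGraph.Adj.reachable ?_)⟩
      exact hxy
    exact (Finset.mem_filter.1 (this hb)).2.2

theorem isSeparator_iff (S C : Finset V) : G.IsSeparator S C ↔
    C ⊆ S ∧ ∃ A ⊆ S \ C, A.Nonempty ∧ G.Closed (S \ C) A ∧ ¬ S \ C ⊆ A := by
  rw [WeightedGraph.IsSeparator, preconnected_iff]
  push Not
  rfl

theorem closed_compl {U A : Finset V} (h : G.Closed U A) :
    G.Closed U (U \ A) := by
  intro a ha b hb hab
  rw [Finset.mem_sdiff] at ha ⊢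
  exact ⟨hb, fun hbA => ha.2 (h b hbA a ha.1 hab.symm)⟩

/-- Maximality amounts to closedness: if an edge led from `A` to a vertex outside, that vertex could
be added without destroying connectivity. -/
theorem isComponent_iff (U A : Finset V) : G.IsComponent U A ↔
    A ⊆ U ∧ G.Closed U A ∧ A.Nonempty ∧ ∀ B ⊆ A, B.Nonempty → G.Closed A B → A ⊆ B := by
  classical
  constructor
  · rintro ⟨h1, h2, h3⟩
    have hp := (preconnected_iff G A).1 h2.preconnected
    obtain ⟨⟨a, ha⟩⟩ := h2.nonempty
    refine ⟨h1, ?_, ⟨a, ha⟩, hp⟩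
    intro x hx y hy hxy
    have := h3 (insert y A) (Finset.insert_subset hy h1) (Finset.subset_insert _ _) ?_
    · rw [← this]; exact Finset.mem_insert_self _ _
    · have : Nonempty ((insert y A : Finset V) : Set V) := ⟨⟨y, by simp⟩⟩
      refine ⟨(preconnected_iff G _).2 fun B hB hne hc => ?_⟩
      have key : ∀ z ∈ B, z ∈ A → A ⊆ B := by
        intro z hz hzA
        have := hp (B ∩ A) Finset.inter_subset_right ⟨z, by simp [hz, hzA]⟩ ?_
        · exact this.trans Finset.inter_subset_left
        · intro p hp q hq hpq
          rw [Finset.mem_inter] at hp ⊢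
          exact ⟨hc p hp.1 q (Finset.mem_insert_of_mem hq) hpq, hq⟩
      have hAB : A ⊆ B := by
        obtain ⟨z, hz⟩ := hne
        rcases Finset.mem_insert.1 (hB hz) with rfl | hzA
        · have hxB : x ∈ B := hc z hz x (Finset.mem_insert_of_mem hx) hxy.symm
          exact key x hxB hx
        · exact key z hz hzA
      exact Finset.insert_subset (hc x (hAB hx) y (Finset.mem_insert_self _ _) hxy) hAB
  · rintro ⟨h1, h2, ⟨a, ha⟩, h4⟩
    have : Nonempty (A : Set V) := ⟨⟨a, ha⟩⟩
    refine ⟨h1, ⟨(preconnected_iff G A).2 h4⟩, fun T hT hAT hconn => ?_⟩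
    refine (hAT.antisymm ?_).symm
    exact (preconnected_iff G T).1 hconn.preconnected A hAT ⟨a, ha⟩ fun x hx y hy => h2 x hx y (hT hy)

theorem isComponent_unique {U A B : Finset V} {v : V} (hA : G.IsComponent U A)
    (hB : G.IsComponent U B) (hvA : v ∈ A) (hvB : v ∈ B) : A = B := by
  classical
  rw [isComponent_iff] at hA hB
  have key : ∀ A B : Finset V, G.Closed U B → A ⊆ U → (∀ B ⊆ A, B.Nonempty → G.Closed A B → A ⊆ B) →
      v ∈ A → v ∈ B → A ⊆ B := by
    intro A B h1 h2 h3 h4 h5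
    refine (h3 (B ∩ A) Finset.inter_subset_right ⟨v, by simp [h4, h5]⟩ ?_).trans
      Finset.inter_subset_left
    intro p hp q hq hpq
    rw [Finset.mem_inter] at hp ⊢
    exact ⟨h1 p hp.1 q (h2 hq) hpq, hq⟩
  exact (key A B hB.2.1 hA.1 hA.2.2.2 hvA hvB).antisymm (key B A hA.2.1 hB.1 hB.2.2.2 hvB hvA)

/-! ### Vertex connectivity -/

theorem isSeparator_of_not_adj {S : Finset V} {u v : V} (hu : u ∈ S) (hv : v ∈ S) (huv : u ≠ v)
    (h : ¬ G.graph.Adj u v) : G.IsSeparator S (S \ {u, v}) := by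
  have hS : S \ (S \ {u, v}) = {u, v} := by
    ext x
    simp only [Finset.mem_sdiff, Finset.mem_insert, Finset.mem_singleton]
    constructor
    · tauto
    · rintro (rfl | rfl) <;> tauto
  rw [isSeparator_iff, hS]
  refine ⟨Finset.sdiff_subset, {u}, by simp, by simp, ?_, ?_⟩
  · intro a ha b hb hab
    simp only [Finset.mem_singleton, Finset.mem_insert] at *
    rcases hb with rfl | rfl
    · rfl
    · subst ha; exact absurd hab h
  · intro hsub
    have := hsub (show v ∈ ({u, v} : Finset V) by simp)
    simp at this
    exact huv this.symm

theorem not_isClique_iff (S : Finset V) : ¬ G.graph.IsClique (S : Set V) ↔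
    ∃ u ∈ S, ∃ v ∈ S, u ≠ v ∧ ¬ G.graph.Adj u v := by
  simp only [SimpleGraph.IsClique, Set.Pairwise, Finset.mem_coe]
  push Not
  rfl

/-- All vertices except a non-adjacent pair separate that pair. Thus the infimum in `kappa` is over
a non-empty set, and connectivity is at most `|S| - 2` off cliques. -/
theorem exists_separator {S : Finset V} (h : ¬ G.graph.IsClique (S : Set V)) :
    ∃ C, G.IsSeparator S C ∧ C.card + 2 = S.card := by
  obtain ⟨u, hu, v, hv, huv, hadj⟩ := (not_isClique_iff G S).1 h
  refine ⟨_, isSeparator_of_not_adj G hu hv huv hadj, ?_⟩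
  have h2 : ({u, v} : Finset V).card = 2 := Finset.card_pair huv
  have hs : ({u, v} : Finset V) ⊆ S := by
    intro x; simp only [Finset.mem_insert, Finset.mem_singleton]; rintro (rfl | rfl) <;> assumption
  rw [← h2]
  exact Finset.card_sdiff_add_card_eq_card hs

theorem not_isClique_of_isSeparator {S C : Finset V} (h : G.IsSeparator S C) :
    ¬ G.graph.IsClique (S : Set V) := by
  obtain ⟨-, A, hA, ⟨a, ha⟩, hc, hn⟩ := (isSeparator_iff G S C).1 h
  obtain ⟨b, hb, hbA⟩ := Finset.not_subset.1 hn
  intro hcl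
  refine hbA (hc a ha b hb (hcl ?_ ?_ ?_))
  · exact (Finset.mem_sdiff.1 (hA ha)).1
  · exact (Finset.mem_sdiff.1 hb).1
  · rintro rfl; exact hbA ha

theorem kappa_of_isMinSeparator {S C : Finset V} (h : G.IsMinSeparator S C) :
    G.kappa S = C.card := by
  rw [WeightedGraph.kappa, if_neg (not_isClique_of_isSeparator G h.1)]
  refine le_antisymm (Nat.sInf_le ⟨C, h.1, rfl⟩) ?_
  refine le_csInf ⟨_, C, h.1, rfl⟩ ?_
  rintro m ⟨C', hC', rfl⟩
  exact h.2 C' hC'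

/-- Positivity of `k` makes the truncated `|S| - 1` harmless and excludes the empty set. -/
theorem isConn_iff {k : ℕ} (hk : 0 < k) (S : Finset V) : G.IsConn k S ↔
    (G.graph.IsClique (S : Set V) ∧ k + 1 ≤ S.card) ∨
      (¬ G.graph.IsClique (S : Set V) ∧ ∀ C, G.IsSeparator S C → k ≤ C.card) := by
  rw [WeightedGraph.IsConn, WeightedGraph.kappa, Nat.cast_le]
  split_ifs with h
  · simp only [h, true_and, not_true_eq_false, false_and, or_false]
    omega
  · simp only [h, false_and, not_false_eq_true, true_and, false_or]
    obtain ⟨C, hC, -⟩ := exists_separator G h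
    constructor
    · intro h' C' hC'
      exact h'.trans (Nat.sInf_le ⟨C', hC', rfl⟩)
    · intro h'
      refine le_csInf ⟨_, C, hC, rfl⟩ ?_
      rintro m ⟨C', hC', rfl⟩
      exact h' C' hC'

theorem card_of_isConn {k : ℕ} (hk : 0 < k) {S : Finset V} (h : G.IsConn k S) :
    k + 1 ≤ S.card := by
  rcases (isConn_iff G hk S).1 h with ⟨-, h⟩ | ⟨h1, h2⟩
  · exact h
  · obtain ⟨C, hC, hc⟩ := exists_separator G h1
    have := h2 C hC
    omega

/-- A `k`-vertex-connected subgraph lies on one side of a separator with fewer than `k` vertices. -/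
theorem subset_of_isConn {k : ℕ} (hk : 0 < k) {H C A T : Finset V} (hT : G.IsConn k T)
    (hTH : T ⊆ H) (hC : C.card < k) (hA : G.Closed (H \ C) A) :
    T ⊆ A ∪ C ∨ T ⊆ H \ (A \ C) := by
  by_contra! hcon
  obtain ⟨h1, h2⟩ := hcon
  obtain ⟨b, hbT, hb⟩ := Finset.not_subset.1 h1
  obtain ⟨a, haT, ha⟩ := Finset.not_subset.1 h2
  simp only [Finset.mem_union, Finset.mem_sdiff, not_or, not_and, not_not] at ha hb
  have haA : a ∈ A ∧ a ∉ C := by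
    by_contra hcon
    exact ha (hTH haT) fun h => by_contra fun h' => hcon ⟨h, h'⟩
  have hcross : ∀ x ∈ A, ∀ y ∈ T, y ∉ C → y ∉ A → ¬ G.graph.Adj x y := fun x hx y hy hyC hyA hxy =>
    hyA (hA x hx y (Finset.mem_sdiff.2 ⟨hTH hy, hyC⟩) hxy)
  have hab : ¬ G.graph.Adj a b := hcross a haA.1 b hbT hb.2 hb.1
  have hne : a ≠ b := by rintro rfl; exact hb.1 haA.1
  rcases (isConn_iff G hk T).1 hT with ⟨hcl, -⟩ | ⟨-, hsep⟩
  · exact hab (hcl haT hbT hne)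
  -- The vertices `a` and `b` of `T` lie on different sides, so `T ∩ C` separates `G[T]` with fewer
  -- than `k` vertices.
  · have := hsep (T ∩ C) ((isSeparator_iff G _ _).2 ⟨Finset.inter_subset_left,
      (T ∩ A) \ C, ?_, ⟨a, ?_⟩, ?_, ?_⟩)
    · have := Finset.card_le_card (Finset.inter_subset_right (s₁ := T) (s₂ := C))
      omega
    · intro x; simp only [Finset.mem_sdiff, Finset.mem_inter]; tauto
    · simp [haT, haA]
    · intro x hx y hy hxy
      simp only [Finset.mem_sdiff, Finset.mem_inter] at hx hy ⊢
      by_contra hcon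
      exact hcross x hx.1.2 y hy.1 (by tauto) (by tauto) hxy
    · intro hsub
      have := hsub (show b ∈ T \ (T ∩ C) by simp [hbT, hb.2])
      simp only [Finset.mem_sdiff, Finset.mem_inter] at this
      exact hb.1 this.1.2

/-- If `v` has a non-neighbour, its neighbourhood separates the two and so has at least `k`
vertices; otherwise all the other vertices, at least `k` of them, are neighbours. -/
theorem le_card_nbrs_of_isConn {k : ℕ} (hk : 0 < k) {S : Finset V} (h : G.IsConn k S) {v : V}
    (hv : v ∈ S) : ∃ B ⊆ S, k ≤ B.card ∧ ∀ u ∈ B, G.graph.Adj v u := by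
  classical
  refine ⟨S.filter (fun u => G.graph.Adj v u), Finset.filter_subset _ _, ?_,
    fun u hu => (Finset.mem_filter.1 hu).2⟩
  by_cases hall : ∀ u ∈ S, u ≠ v → G.graph.Adj v u
  · have hsub : S.erase v ⊆ S.filter (fun u => G.graph.Adj v u) := by
      intro u hu
      rw [Finset.mem_erase] at hu
      exact Finset.mem_filter.2 ⟨hu.2, hall u hu.2 hu.1⟩
    have := Finset.card_le_card hsub
    rw [Finset.card_erase_of_mem hv] at this
    have := card_of_isConn G hk h
    omega
  · push Not at hall
    obtain ⟨u, hu, huv, hadj⟩ := hall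
    rcases (isConn_iff G hk S).1 h with ⟨hcl, -⟩ | ⟨-, hsep⟩
    · exact absurd (hcl hv hu huv.symm) hadj
    · refine hsep _ ((isSeparator_iff G _ _).2 ⟨Finset.filter_subset _ _, {v}, ?_, by simp, ?_, ?_⟩)
      · simp [hv]
      · intro a ha b hb hab
        simp only [Finset.mem_singleton, Finset.mem_sdiff, Finset.mem_filter] at ha hb
        subst ha
        exact absurd ⟨hb.1, hab⟩ hb.2
      · intro hsub
        have := hsub (show u ∈ _ by simp [hu, hadj])
        simp at this
        exact huv this

/-! ### Peeling -/

/-- `R` is the largest subset of `S` in which all weighted degrees exceed `d`. -/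
def WeightedGraph.IsCore (d : ℝ) (S R : Finset V) : Prop :=
  R ⊆ S ∧ (∀ v ∈ R, d < G.degIn R v) ∧ ∀ T ⊆ S, (∀ v ∈ T, d < G.degIn T v) → T ⊆ R

theorem isCore_unique {d : ℝ} {S R R' : Finset V} (h : G.IsCore d S R) (h' : G.IsCore d S R') :
    R = R' :=
  (h'.2.2 R h.1 h.2.1).antisymm (h.2.2 R' h'.1 h'.2.1)

/-- A set with inner degrees above `d` never loses a vertex, because the first one deleted would
have at most that degree in a larger set. So the outcome of peeling does not depend on the order or
on ties. -/
theorem isCore_of_peel {d : ℝ} {S R : Finset V} (h : Peel G d S R) : G.IsCore d S R := by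
  induction h with
  | done S h => exact ⟨subset_rfl, h, fun T hT _ => hT⟩
  | remove S R v hv hmin hd hR ih =>
    refine ⟨ih.1.trans (Finset.erase_subset _ _), ih.2.1, fun T hT hdeg => ih.2.2 T ?_ hdeg⟩
    intro x hx
    refine Finset.mem_erase.2 ⟨?_, hT hx⟩
    rintro rfl
    exact absurd (hdeg x hx) (not_lt.2 ((degIn_mono G hT x).trans hd))

theorem exists_peel (d : ℝ) (S : Finset V) : ∃ R, Peel G d S R := by
  induction S using Finset.strongInduction with
  | H S ih =>
    by_cases h : ∀ v ∈ S, d < G.degIn S v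
    · exact ⟨S, .done S h⟩
    · push Not at h
      obtain ⟨u, hu, hud⟩ := h
      obtain ⟨v, hv, hmin⟩ := S.exists_min_image (G.degIn S) ⟨u, hu⟩
      obtain ⟨R, hR⟩ := ih _ (Finset.erase_ssubset hv)
      exact ⟨R, .remove S R v hv hmin ((hmin u hu).trans hud) hR⟩

theorem peel_iff_isCore {d : ℝ} {S R : Finset V} : Peel G d S R ↔ G.IsCore d S R := by
  refine ⟨isCore_of_peel G, fun h => ?_⟩
  obtain ⟨R', hR'⟩ := exists_peel G d S
  rwa [isCore_unique G h (isCore_of_peel G hR')]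

end Graph

set_option linter.unusedSectionVars false

section Graph

variable {V : Type*} (G : WeightedGraph V) [DecidableEq V]

/-! ### Weight excess over `d` per vertex -/

/-- `w(S) - d (|S| - (τ - 1))`. -/
noncomputable def WeightedGraph.excess (d : ℝ) (τ : ℕ) (S : Finset V) : ℝ :=
  G.weightIn S - d * (S.card + 1 - τ : ℝ)

/-- The deletion costs weight at most `d`, and the subtracted term drops by exactly `d`. -/
theorem excess_le_erase {d : ℝ} {τ : ℕ} {S : Finset V} {v : V} (hv : v ∈ S)
    (hd : G.degIn S v ≤ d) : G.excess d τ S ≤ G.excess d τ (S.erase v) := by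
  have h1 := weightIn_erase G hv
  have h2 : ((S.erase v).card : ℝ) = S.card - 1 := by
    rw [Finset.card_erase_of_mem hv, Nat.cast_sub (Finset.card_pos.2 ⟨v, hv⟩)]
    simp
  unfold WeightedGraph.excess
  rw [h2]
  linarith

theorem excess_le_of_peel {d : ℝ} {τ : ℕ} {S R : Finset V} (h : Peel G d S R) :
    G.excess d τ S ≤ G.excess d τ R := by
  induction h with
  | done => exact le_rfl
  | remove S R v hv hmin hd hR ih => exact (excess_le_erase G hv hd).trans ih

theorem connBound_pos (d w : ℝ) : 1 ≤ connBound d w := by unfold connBound; omega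

theorem connBound_spec {d w : ℝ} : 2 * connBound d w ≤ ⌈d / w⌉₊ + 2 ∧
    ⌈d / w⌉₊ + 1 ≤ 2 * connBound d w := by
  unfold connBound; omega

/-- On `2τ - 2` vertices the weight is at most `w (τ - 1)(2τ - 3)`. From `2τ - 2 ≤ ⌈d / w⌉` follows
`2τ - 3 < d / w`, so the weight is below `d (τ - 1)`, which is the term subtracted in the excess. -/
theorem excess_neg {d w : ℝ} {S : Finset V} (hw : 0 < w)
    (hS : ∀ u ∈ S, ∀ v ∈ S, G.mat u v ≤ w) (hτ : 2 ≤ connBound d w)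
    (hcard : S.card + 2 = 2 * connBound d w) : G.excess d (connBound d w) S < 0 := by
  set τ := connBound d w
  have h1 := two_weightIn_le G hS
  have h2 : 2 * τ ≤ ⌈d / w⌉₊ + 2 := connBound_spec.1
  have h3 : ((2 * τ - 3 : ℕ) : ℝ) < d / w := by
    apply Nat.lt_ceil.1
    omega
  have h4 : (S.card : ℝ) = 2 * τ - 2 := by
    have : (S.card : ℝ) + 2 = 2 * τ := by exact_mod_cast hcard
    linarith
  rw [Nat.cast_sub (by omega), lt_div_iff₀ hw] at h3
  push_cast at h3
  have h5 : (2 : ℝ) ≤ τ := by exact_mod_cast hτ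
  unfold WeightedGraph.excess
  rw [h4] at h1 ⊢
  nlinarith [mul_pos (show (0 : ℝ) < τ - 1 by linarith) (sub_pos.2 h3)]

/-- Vertices go one at a time, so shrinking below `2τ - 1` would pass through a set of exactly `2τ -
2` vertices. Its excess would be negative, although peeling never decreases the excess. -/
theorem card_le_of_peel {d w : ℝ} {S R : Finset V} (hw : 0 < w)
    (hS : ∀ u ∈ S, ∀ v ∈ S, G.mat u v ≤ w) (hτ : 2 ≤ connBound d w) (h : Peel G d S R)
    (hf : 0 ≤ G.excess d (connBound d w) S) (hc : 2 * connBound d w ≤ S.card + 1) :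
    2 * connBound d w ≤ R.card + 1 := by
  induction h with
  | done => exact hc
  | remove S R v hv hmin hdeg hR ih =>
    have h1 := hf.trans (excess_le_erase G (τ := connBound d w) hv hdeg)
    have h2 := Finset.card_erase_of_mem hv
    have h3 := Finset.card_pos.2 ⟨v, hv⟩
    have hS' : ∀ u ∈ S.erase v, ∀ z ∈ S.erase v, G.mat u z ≤ w := fun u hu z hz =>
      hS u (Finset.mem_of_mem_erase hu) z (Finset.mem_of_mem_erase hz)
    refine ih hS' h1 ?_
    by_contra hcon
    exact absurd h1 (not_le.2 (excess_neg G hw hS' hτ (by omega)))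

/-- A vertex of degree above `d` has many vertices around it. -/
theorem card_of_degIn {d w : ℝ} {S : Finset V} {v : V} (hv : v ∈ S) (hd : 0 < d) (hw : 0 < w)
    (hS : ∀ u ∈ S, ∀ v ∈ S, G.mat u v ≤ w) (hdeg : d < G.degIn S v) :
    2 * connBound d w ≤ S.card + 1 ∧ 2 ≤ S.card := by
  have h1 := hdeg.trans_le (degIn_le_mul G hv (hS v hv))
  have h2 : 2 * connBound d w ≤ ⌈d / w⌉₊ + 2 := connBound_spec.1
  have hpos := Finset.card_pos.2 ⟨v, hv⟩
  have h3 : d / w < ((S.card - 1 : ℕ) : ℝ) := by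
    rw [div_lt_iff₀ hw, Nat.cast_sub hpos, mul_comm]
    simpa using h1
  have h4 : ⌈d / w⌉₊ ≤ S.card - 1 := Nat.ceil_le.2 h3.le
  have h5 : 0 < ⌈d / w⌉₊ := Nat.ceil_pos.2 (div_pos hd hw)
  omega

theorem degIn_closed {H C A : Finset V} (hA : A ⊆ H \ C) (hC : C ⊆ H)
    (hcl : G.Closed (H \ C) A) {v : V} (hv : v ∈ A) : G.degIn (A ∪ C) v = G.degIn H v := by
  rw [degIn_eq_sum, degIn_eq_sum]
  refine Finset.sum_subset (Finset.union_subset (hA.trans Finset.sdiff_subset) hC) ?_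
  intro x hx hxA
  rw [Finset.mem_union, not_or] at hxA
  by_contra hne
  have : G.graph.Adj v x := by
    rw [← mat_pos_iff]
    exact lt_of_le_of_ne (mat_nonneg G _ _) (Ne.symm hne)
  exact hxA.1 (hcl v hv x (Finset.mem_sdiff.2 ⟨hx, hxA.2⟩) this)

/-- Without edges between `A` and `B`, each edge lies on one of the two sides, and the edges within
`C` lie on both. -/
theorem weightIn_union_le {A B C : Finset V} (h : ∀ a ∈ A, ∀ b ∈ B, ¬ G.graph.Adj a b) :
    G.weightIn (A ∪ B ∪ C) + G.weightIn C ≤ G.weightIn (A ∪ C) + G.weightIn (B ∪ C) := by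
  classical
  have hsub : G.edgesIn (A ∪ B ∪ C) ⊆ G.edgesIn (A ∪ C) ∪ G.edgesIn (B ∪ C) := by
    intro e
    induction e with | _ a b
    simp only [Finset.mem_union, mem_edgesIn]
    rintro ⟨ha, hb, hab⟩
    have h1 := h a
    have h2 := h b
    have h3 := hab.symm
    tauto
  have hsub2 : G.edgesIn C ⊆ G.edgesIn (A ∪ C) ∩ G.edgesIn (B ∪ C) := by
    intro e
    induction e with | _ a b
    simp only [Finset.mem_union, Finset.mem_inter, mem_edgesIn]
    tauto
  have hnn : ∀ S, ∀ e ∈ G.edgesIn S, 0 ≤ G.weight e := by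
    intro S e he
    rw [WeightedGraph.edgesIn, Finset.mem_filter] at he
    exact (G.weight_pos e he.2).le
  unfold WeightedGraph.weightIn
  rw [← Finset.sum_union_inter (s₁ := G.edgesIn (A ∪ C))]
  refine add_le_add (Finset.sum_le_sum_of_subset_of_nonneg hsub fun e he _ => ?_)
    (Finset.sum_le_sum_of_subset_of_nonneg hsub2 fun e he _ => ?_)
  · rcases Finset.mem_union.1 he with he | he <;> exact hnn _ e he
  · exact hnn _ e (Finset.mem_inter.1 he).1

/-- Splitting `B` into closed parts `A` and `B \ A` counts `C` twice, which changes the sum of the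
excesses by `w(C) - d (|C| + 1 - τ)` or more. This is non-negative by the size of `C`, so one part
inherits a non-negative excess; the descent ends at a component. -/
theorem exists_component_excess {d : ℝ} {τ : ℕ} {H C : Finset V} (hd : 0 ≤ d)
    (hτ : C.card + 1 ≤ τ) (B : Finset V) (hB : B ⊆ H \ C) (hne : B.Nonempty)
    (hcl : G.Closed (H \ C) B) (hf : 0 ≤ G.excess d τ (B ∪ C)) :
    ∃ S, G.IsComponent (H \ C) S ∧ 0 ≤ G.excess d τ (S ∪ C) := by
  induction B using Finset.strongInduction with
  | H B ih =>
    by_cases hcon : ∀ A ⊆ B, A.Nonempty → G.Closed B A → B ⊆ A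
    · exact ⟨B, (isComponent_iff G _ _).2 ⟨hB, hcl, hne, hcon⟩, hf⟩
    push Not at hcon
    obtain ⟨A, hA, hAne, hAcl, hn⟩ := hcon
    obtain ⟨b, hb, hbA⟩ := Finset.not_subset.1 hn
    have hclA : ∀ A ⊆ B, G.Closed B A → G.Closed (H \ C) A := fun A hA hAcl x hx y hy hxy =>
      hAcl x hx y (hcl x (hA hx) y hy hxy) hxy
    have hcl1 := hclA A hA hAcl
    have hcl2 := hclA (B \ A) Finset.sdiff_subset (closed_compl G hAcl)
    have hss1 : A ⊂ B := Finset.ssubset_iff_subset_ne.2 ⟨hA, by rintro rfl; exact hbA hb⟩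
    have hss2 : B \ A ⊂ B := by
      obtain ⟨a, ha⟩ := hAne
      refine Finset.ssubset_iff_subset_ne.2 ⟨Finset.sdiff_subset, fun h => ?_⟩
      have := hA ha
      rw [← h, Finset.mem_sdiff] at this
      exact this.2 ha
    have hw := weightIn_union_le G (A := A) (B := B \ A) (C := C) (by
      intro x hx y hy hxy
      rw [Finset.mem_sdiff] at hy
      exact hy.2 (hAcl x hx y hy.1 hxy))
    rw [Finset.union_sdiff_of_subset hA] at hw
    have hdis : ∀ A ⊆ B, ((A ∪ C).card : ℝ) = A.card + C.card := by
      intro A hA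
      rw [Finset.card_union_of_disjoint]
      · push_cast; rfl
      · exact Finset.disjoint_of_subset_left (hA.trans hB) Finset.sdiff_disjoint
    have hcard : (A.card : ℝ) + (B \ A).card = B.card := by
      have := Finset.card_sdiff_add_card_eq_card hA
      rw [add_comm]
      exact_mod_cast this
    have hsum : G.excess d τ (B ∪ C) ≤ G.excess d τ (A ∪ C) + G.excess d τ (B \ A ∪ C) := by
      unfold WeightedGraph.excess
      rw [hdis B subset_rfl, hdis A hA, hdis _ Finset.sdiff_subset]
      have h1 : (C.card : ℝ) + 1 ≤ τ := by exact_mod_cast hτ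
      have h2 := weightIn_nonneg G C
      nlinarith [mul_nonneg hd (sub_nonneg.2 h1)]
    by_cases h0 : 0 ≤ G.excess d τ (A ∪ C)
    · exact ih A hss1 (hA.trans hB) hAne hcl1 h0
    · refine ih (B \ A) hss2 (Finset.sdiff_subset.trans hB) ⟨b, by simp [hb, hbA]⟩ hcl2 ?_
      linarith

/-- When a subgraph with non-negative excess is split along a small separator, one of the parts
has non-negative excess again, and it is not too small. -/
theorem exists_split {d w : ℝ} {H C : Finset V} (hd : 0 < d) (hw : 0 < w)
    (hH : ∀ u ∈ H, ∀ v ∈ H, G.mat u v ≤ w) (hdeg : ∀ v ∈ H, d < G.degIn H v)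
    (hf : 0 ≤ G.excess d (connBound d w) H) (hC : C ⊆ H) (hne : (H \ C).Nonempty)
    (hcard : C.card < connBound d w) :
    ∃ S, G.IsComponent (H \ C) S ∧ ∀ R, G.IsCore d (S ∪ C) R →
      0 ≤ G.excess d (connBound d w) R ∧ connBound d w + 1 ≤ R.card := by
  obtain ⟨S, hS, hfS⟩ := exists_component_excess G hd.le (τ := connBound d w) (C := C) (H := H)
    hcard (H \ C) subset_rfl hne (fun _ _ b hb _ => hb)
    (by rwa [Finset.sdiff_union_of_subset hC])
  refine ⟨S, hS, fun R hR => ?_⟩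
  have hpeel := (peel_iff_isCore G).2 hR
  refine ⟨hfS.trans (excess_le_of_peel G hpeel), ?_⟩
  obtain ⟨h1, h2, ⟨v, hv⟩, -⟩ := (isComponent_iff G _ _).1 hS
  have hsub : S ∪ C ⊆ H := Finset.union_subset (h1.trans Finset.sdiff_subset) hC
  have hSC : ∀ u ∈ S ∪ C, ∀ v ∈ S ∪ C, G.mat u v ≤ w := fun u hu v hv =>
    hH u (hsub hu) v (hsub hv)
  -- Vertices of `S` keep all their neighbours in `S ∪ C`. One of them already forces `2τ - 1`
  -- vertices before peeling.
  have hdegS : ∀ v ∈ S, d < G.degIn (S ∪ C) v := by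
    intro v hv
    rw [degIn_closed G h1 hC h2 hv]
    exact hdeg v (Finset.mem_sdiff.1 (h1 hv)).1
  have hc := card_of_degIn G (Finset.mem_union_left C hv) hd hw hSC (hdegS v hv)
  -- For `τ ≥ 2` the bound `2τ - 1` is at least `τ + 1`. For `τ = 1` the separator is empty and no
  -- vertex of `S` is peeled off, so at least two vertices remain.
  by_cases hτ : 2 ≤ connBound d w
  · have := card_le_of_peel G hw hSC hτ hpeel hfS hc.1
    omega
  · have hC0 : C = ∅ := by
      rw [← Finset.card_eq_zero]; omega
    subst hC0
    rw [Finset.union_empty] at *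
    have := Finset.card_le_card (hR.2.2 S subset_rfl hdegS)
    omega

/-- Each deletion costs weight at most `d`, and the last vertex costs `0 < d`; hence the strict
inequality, which fails for `d` equal to the density. -/
theorem weightIn_lt_of_peel_empty {d : ℝ} (hd : 0 < d) {S R : Finset V} (h : Peel G d S R)
    (hR : R = ∅) (hS : S.Nonempty) : G.weightIn S < d * S.card := by
  induction h with
  | done S h => exact absurd hR hS.ne_empty
  | remove S R v hv hmin hdeg hP ih =>
    have h1 := weightIn_erase G hv
    have h2 : ((S.erase v).card : ℝ) = S.card - 1 := by
      rw [Finset.card_erase_of_mem hv, Nat.cast_sub (Finset.card_pos.2 ⟨v, hv⟩)]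
      simp
    rcases (S.erase v).eq_empty_or_nonempty with he | hne
    · have h3 : G.degIn S v = 0 := by
        rw [degIn_eq_sum, ← Finset.add_sum_erase S _ hv, he, mat_self]
        simp
      have h4 : (0 : ℝ) < S.card := by exact_mod_cast Finset.card_pos.2 hS
      rw [he, weightIn_empty, h3] at h1
      rw [h1]
      nlinarith
    · have := ih hR hne
      rw [h2] at this
      linarith

/-- Peeling at the density leaves something, of non-negative excess. -/
theorem core_density (w : ℝ) {U H : Finset V} (hU : U.Nonempty) (hd : 0 < G.density U)
    (hH : G.IsCore (G.density U) U H) :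
    H.Nonempty ∧ 0 ≤ G.excess (G.density U) (connBound (G.density U) w) H := by
  have hpeel := (peel_iff_isCore G).2 hH
  set d := G.density U with hddef
  have hwU : d * U.card = G.weightIn U := density_mul_card G hU
  have hτ := connBound_pos d w
  refine ⟨?_, le_trans ?_ (excess_le_of_peel G hpeel)⟩
  · rw [Finset.nonempty_iff_ne_empty]
    intro he
    exact absurd (weightIn_lt_of_peel_empty G hd hpeel he hU) (by rw [hwU]; exact lt_irrefl _)
  -- As `w(U) = d |U|`, the excess of `U` is `d (τ - 1)`.
  · have : (1 : ℝ) ≤ connBound d w := by exact_mod_cast hτ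
    unfold WeightedGraph.excess
    nlinarith [mul_nonneg hd.le (sub_nonneg.2 this)]

/-! ### Guarantees for the output -/

/-- A clique on `τ + 1` vertices has connectivity at least `τ`, and the other exit tests a minimum
separator directly. Degrees above `d` survive because every new member has just been peeled. -/
theorem maderLoop_spec {d : ℝ} {τ : ℕ} {𝓗 : Finset (Finset V)} {R : Finset V}
    (h : MaderLoop G d τ 𝓗 R) (hH : ∀ K ∈ 𝓗, τ + 1 ≤ K.card ∧ ∀ v ∈ K, d < G.degIn K v) :
    (τ + 1 ≤ R.card ∧ ∀ v ∈ R, d < G.degIn R v) ∧ τ ≤ G.kappa R := by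
  have hsp : ∀ {H C 𝓗'}, IsSplit G d τ H C 𝓗' →
      ∀ K ∈ 𝓗', τ + 1 ≤ K.card ∧ ∀ v ∈ K, d < G.degIn K v := by
    intro H C 𝓗' hs K hK
    obtain ⟨h1, S, -, hP⟩ := (hs K).1 hK
    exact ⟨h1, (isCore_of_peel G hP).2.1⟩
  induction h with
  | found 𝓗 H C hmem hC hτ => exact ⟨hH H hmem, by rwa [kappa_of_isMinSeparator G hC]⟩
  | clique 𝓗 𝓗' H C K hmem hC hτ hsplit hK hcl =>
    refine ⟨hsp hsplit K hK, ?_⟩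
    rw [WeightedGraph.kappa, if_pos hcl]
    have := (hsp hsplit K hK).1
    omega
  | next 𝓗 𝓗' H C R hmem hC hτ hsplit hnone hR ih =>
    refine ih fun K hK => ?_
    rcases Finset.mem_union.1 hK with hK | hK
    · exact hH K (Finset.mem_of_mem_erase hK)
    · exact hsp hsplit K hK

/-- Soundness needs only the degrees and the sizes of the members. The excess matters only for the
existence of an output. -/
theorem maderSubgraph_spec {U R : Finset V} (h : MaderSubgraph G U R) :
    R.Nonempty ∧ connBound (G.density U) (G.wmaxIn U) ≤ G.kappa R ∧
      G.density U / 2 ≤ G.density R := by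
  obtain ⟨H, 𝓗, hP, h𝓗, hR⟩ := h
  have hcore := isCore_of_peel G hP
  have hmem : ∀ K ∈ 𝓗, connBound (G.density U) (G.wmaxIn U) + 1 ≤ K.card ∧
      ∀ v ∈ K, G.density U < G.degIn K v := by
    intro K hK
    obtain ⟨h1, h2⟩ := (h𝓗 K).1 hK
    obtain ⟨h3, h4, -, -⟩ := (isComponent_iff G _ _).1 h1
    refine ⟨h2, fun v hv => ?_⟩
    have := degIn_closed G (H := H) (C := ∅) (A := K) (by simpa using h3) (by simp)
      (by simpa using h4) hv
    rw [Finset.union_empty] at this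
    rw [this]
    exact hcore.2.1 v (h3 hv)
  have key : (connBound (G.density U) (G.wmaxIn U) + 1 ≤ R.card ∧
      ∀ v ∈ R, G.density U < G.degIn R v) ∧ connBound (G.density U) (G.wmaxIn U) ≤ G.kappa R := by
    rcases hR with ⟨hR, hcl⟩ | ⟨-, hR⟩
    · refine ⟨hmem R hR, ?_⟩
      rw [WeightedGraph.kappa, if_pos hcl]
      have := (hmem R hR).1
      omega
    · exact maderLoop_spec G hR hmem
  have hne : R.Nonempty := Finset.card_pos.1 (by have := key.1.1; omega)
  exact ⟨hne, key.2, half_le_density G hne fun v hv => (key.1.2 v hv).le⟩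

/-! ### Extremal edge weights and bounds for one pass -/

theorem mat_le_wmax [Finite V] (u v : V) (he : G.graph.edgeSet.Nonempty) : G.mat u v ≤ G.wmax := by
  have hfin : (G.weight '' G.graph.edgeSet).Finite := Set.toFinite _
  by_cases h : G.graph.Adj u v
  · rw [WeightedGraph.mat, if_pos h]
    exact le_csSup hfin.bddAbove ⟨_, h, rfl⟩
  · rw [WeightedGraph.mat, if_neg h]
    obtain ⟨e, he⟩ := he
    exact (G.weight_pos e he).le.trans (le_csSup hfin.bddAbove ⟨_, he, rfl⟩)

theorem wmin_le [Finite V] {u v : V} (h : G.graph.Adj u v) : G.wmin ≤ G.mat u v := by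
  have hfin : (G.weight '' G.graph.edgeSet).Finite := Set.toFinite _
  rw [WeightedGraph.mat, if_pos h]
  exact csInf_le hfin.bddBelow ⟨_, h, rfl⟩

theorem wmin_pos [Finite V] (he : G.graph.edgeSet.Nonempty) : 0 < G.wmin := by
  have hfin : (G.weight '' G.graph.edgeSet).Finite := Set.toFinite _
  obtain ⟨e, he', h⟩ := (he.image G.weight).csInf_mem hfin
  rw [WeightedGraph.wmin, ← h]
  exact G.weight_pos e he'

theorem wmin_le_wmax [Finite V] (he : G.graph.edgeSet.Nonempty) : G.wmin ≤ G.wmax := by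
  have hfin : (G.weight '' G.graph.edgeSet).Finite := Set.toFinite _
  obtain ⟨e, he⟩ := he
  exact (csInf_le hfin.bddBelow ⟨e, he, rfl⟩).trans (le_csSup hfin.bddAbove ⟨e, he, rfl⟩)

theorem wmaxIn_le_wmax [Finite V] {S : Finset V} (hS : (G.edgesIn S).Nonempty) :
    G.wmaxIn S ≤ G.wmax := by
  have hfin : (G.weight '' G.graph.edgeSet).Finite := Set.toFinite _
  refine csSup_le_csSup hfin.bddAbove (by simpa using hS) (Set.image_mono ?_)
  intro e he
  rw [WeightedGraph.edgesIn, Finset.coe_filter] at he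
  exact he.2

theorem mat_le_wmaxIn {S : Finset V} {u v : V} (hu : u ∈ S) (hv : v ∈ S) :
    G.mat u v ≤ G.wmaxIn S := by
  have hfin : (G.weight '' (G.edgesIn S : Set (Sym2 V))).Finite := Set.toFinite _
  by_cases h : G.graph.Adj u v
  · rw [WeightedGraph.mat, if_pos h]
    exact le_csSup hfin.bddAbove ⟨_, (mem_edgesIn G).2 ⟨hu, hv, h⟩, rfl⟩
  · rw [WeightedGraph.mat, if_neg h]
    -- If `G[S]` has no edge, the supremum has the default value `0`, which still suffices.
    apply Real.sSup_nonneg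
    rintro _ ⟨e, he, rfl⟩
    rw [WeightedGraph.edgesIn, Finset.coe_filter] at he
    exact (G.weight_pos e he.2).le

theorem edgesIn_nonempty_of_density_pos {S : Finset V} (h : 0 < G.density S) :
    (G.edgesIn S).Nonempty := by
  rw [Finset.nonempty_iff_ne_empty]
  intro he
  simp [WeightedGraph.density, WeightedGraph.weightIn, he] at h

theorem wmaxIn_pos {S : Finset V} (h : 0 < G.density S) : 0 < G.wmaxIn S := by
  obtain ⟨e, he⟩ := edgesIn_nonempty_of_density_pos G h
  induction e with | _ u v
  obtain ⟨hu, hv, huv⟩ := (mem_edgesIn G).1 he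
  exact ((mat_pos_iff G u v).2 huv).trans_le (mat_le_wmaxIn G hu hv)

/-- The test of the algorithm uses the maximum weight of `G`, Mader's procedure that of its input.
The smaller weight gives the larger bound, so the discrepancy is favourable. -/
theorem connBound_anti {d w w' : ℝ} (hd : 0 ≤ d) (hw : 0 < w) (h : w ≤ w') :
    connBound d w' ≤ connBound d w := by
  unfold connBound
  have : ⌈d / w'⌉₊ ≤ ⌈d / w⌉₊ := Nat.ceil_mono (div_le_div_of_nonneg_left hd hw h)
  omega

theorem density_pos_of_isConn {k : ℕ} (hk : 0 < k) {S : Finset V} (h : G.IsConn k S) :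
    0 < G.density S := by
  have hcard := card_of_isConn G hk h
  have hne : S.Nonempty := Finset.card_pos.1 (by omega)
  refine div_pos ?_ (by exact_mod_cast hne.card_pos)
  have : 0 < ∑ v ∈ S, G.degIn S v := by
    refine Finset.sum_pos (fun v hv => ?_) hne
    obtain ⟨B, hBS, hB, hadj⟩ := le_card_nbrs_of_isConn G hk h hv
    obtain ⟨u, hu⟩ := Finset.card_pos.1 (hk.trans_le hB)
    rw [degIn_eq_sum]
    exact Finset.sum_pos' (fun _ _ => mat_nonneg G _ _)
      ⟨u, hBS hu, (mat_pos_iff G _ _).2 (hadj u hu)⟩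
  rw [sum_degIn] at this
  linarith

/-- With at least `k` neighbours, every weighted degree is at least `k w_min`. -/
theorem le_density_of_isConn [Finite V] {k : ℕ} (hk : 0 < k) (he : G.graph.edgeSet.Nonempty)
    {S : Finset V} (h : G.IsConn k S) : k * G.wmin / 2 ≤ G.density S := by
  have hcard := card_of_isConn G hk h
  refine half_le_density G (Finset.card_pos.1 (by omega)) fun v hv => ?_
  obtain ⟨B, hBS, hB, hadj⟩ := le_card_nbrs_of_isConn G hk h hv
  rw [degIn_eq_sum]
  refine le_trans ?_ (Finset.sum_le_sum_of_subset_of_nonneg hBS fun _ _ _ => mat_nonneg G _ _)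
  refine le_trans ?_ (Finset.card_nsmul_le_sum B _ G.wmin fun u hu => wmin_le G (hadj u hu))
  rw [nsmul_eq_mul]
  exact mul_le_mul_of_nonneg_right (by exact_mod_cast hB) (wmin_pos G he).le

theorem exists_isMaxConn [Finite V] {k : ℕ} {T : Finset V} (h : G.IsConn k T) :
    ∃ S, T ⊆ S ∧ G.IsMaxConn k S := by
  have hfin : {S : Finset V | T ⊆ S ∧ G.IsConn k S}.Finite := Set.toFinite _
  obtain ⟨S, hS⟩ := hfin.exists_maximal ⟨T, subset_rfl, h⟩
  exact ⟨S, hS.prop.1, hS.prop.2, fun T' hST hT' =>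
    (hST.antisymm (hS.le_of_ge ⟨hS.prop.1.trans hST, hT'⟩ hST)).symm⟩

/-- Both branches are compared with the density of `D`, which bounds the density of every `T ⊆ S`.
Mader's branch loses a factor `2` in density and `γ` in connectivity. The other branch keeps the
full connectivity, and its failed test bounds the density of `D` in terms of `k`. -/
theorem bicriteriaPass_spec [Finite V] {γ : ℝ} {k : ℕ} (hk : 0 < k)
    (he : G.graph.edgeSet.Nonempty) (h1 : 1 ≤ γ) (h2 : γ ≤ 2) {S R : Finset V}
    (hS : G.IsConn k S) (h : BicriteriaPass G γ k S R) :
    R.Nonempty ∧ G.IsConn (1 / γ * k) R ∧ ∀ T ⊆ S, T.Nonempty →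
      γ / 4 * (G.wmin / G.wmax) * G.density T ≤ G.density R := by
  have hγ : 0 < γ := by linarith
  have hmin := wmin_pos G he
  have hmm := wmin_le_wmax G he
  have hmax := hmin.trans_le hmm
  have hratio : G.wmin / G.wmax ≤ 1 := (div_le_one hmax).2 hmm
  have hratio0 : 0 < G.wmin / G.wmax := div_pos hmin hmax
  have hSne : S.Nonempty := Finset.card_pos.1 (by have := card_of_isConn G hk hS; omega)
  obtain ⟨D, ⟨hDS, hDne, hDmax⟩, hD⟩ := h
  have hDpos := (density_pos_of_isConn G hk hS).trans_le (hDmax S subset_rfl hSne)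
  rcases hD with ⟨hc, hM⟩ | ⟨hc, rfl⟩
  · obtain ⟨m1, m2, m3⟩ := maderSubgraph_spec G hM
    refine ⟨m1, ?_, fun T hT hTne => ?_⟩
    · have h3 := connBound_anti hDpos.le (wmaxIn_pos G hDpos)
        (wmaxIn_le_wmax G (edgesIn_nonempty_of_density_pos G hDpos))
      have h4 : (connBound (G.density D) G.wmax : ℝ) ≤ G.kappa R := by exact_mod_cast h3.trans m2
      rw [WeightedGraph.IsConn, one_div, inv_mul_le_iff₀ hγ]
      exact hc.trans (mul_le_mul_of_nonneg_left h4 hγ.le)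
    · have h3 := hDmax T hT hTne
      -- Here `γ ≤ 2` and `w_min ≤ w_max` enter.
      have h4 : γ / 4 * (G.wmin / G.wmax) ≤ 1 / 2 := by nlinarith
      have h5 := density_nonneg G T
      nlinarith
  · refine ⟨hSne, ?_, fun T hT hTne => ?_⟩
    · rw [WeightedGraph.IsConn] at hS ⊢
      refine le_trans ?_ hS
      rw [one_div, inv_mul_le_iff₀ hγ]
      have : (0 : ℝ) ≤ k := Nat.cast_nonneg _
      nlinarith
    · refine le_trans (mul_le_mul_of_nonneg_left (hDmax T hT hTne) (by positivity)) ?_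
      refine le_trans ?_ (le_density_of_isConn G hk he hS)
      set d := G.density D
      rw [not_le] at hc
      have h3 : (⌈d / G.wmax⌉₊ : ℝ) + 1 ≤ 2 * connBound d G.wmax := by
        exact_mod_cast (connBound_spec (d := d) (w := G.wmax)).2
      have h4 := Nat.le_ceil (d / G.wmax)
      -- The failed test gives `γ τ' < k`, and `d / w_max ≤ ⌈d / w_max⌉ ≤ 2 τ' - 1`.
      have h5 : γ * (d / G.wmax) ≤ 2 * k := by nlinarith
      have h6 : γ / 4 * (G.wmin / G.wmax) * d = G.wmin * (γ * (d / G.wmax)) / 4 := by ring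
      rw [h6]
      nlinarith

/-- A `k`-vertex-connected `T` extends to a maximal one. The pass for that set already beats `T` up
to the factor, and the returned set is at least as dense. -/
theorem isBicriteriaOutput_of_algorithm [Finite V] {γ : ℝ} {k : ℕ} (hk : 0 < k)
    (he : G.graph.edgeSet.Nonempty) (h1 : 1 ≤ γ) (h2 : γ ≤ 2) {out : Option (Finset V)}
    (h : BicriteriaAlgorithm G γ k out) :
    IsBicriteriaOutput G (γ / 4 * (G.wmin / G.wmax)) (1 / γ) k out := by
  cases out with
  | none =>
    intro T hT
    obtain ⟨S, -, hS⟩ := exists_isMaxConn G hT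
    exact h S hS
  | some R =>
    obtain ⟨star, hstar, ⟨S, hS, rfl⟩, hbest⟩ := h
    obtain ⟨r1, r2, -⟩ := bicriteriaPass_spec G hk he h1 h2 hS.1 (hstar S hS)
    refine ⟨r1, r2, fun T hT => ?_⟩
    obtain ⟨S', hTS', hS'⟩ := exists_isMaxConn G hT
    have hTne : T.Nonempty := Finset.card_pos.1 (by have := card_of_isConn G hk hT; omega)
    exact ((bicriteriaPass_spec G hk he h1 h2 hS'.1 (hstar S' hS')).2.2 T hTS' hTne).trans
      (hbest S' hS')

theorem isApproxOutput_of_algorithm [Finite V] {k : ℕ} (hk : 0 < k)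
    (he : G.graph.edgeSet.Nonempty) {out : Option (Finset V)} (h : BicriteriaAlgorithm G 1 k out) :
    IsApproxOutput G (1 / 4 * (G.wmin / G.wmax)) k out := by
  have := isBicriteriaOutput_of_algorithm G hk he le_rfl one_le_two h
  cases out with
  | none => exact this
  | some R => exact ⟨this.1, by simpa using this.2.1, this.2.2⟩

end Graph

/-! ### Minimum cuts by push-relabel -/

/-- The capacity of the cut `(X, {0, ..., N - 1} \ X)`. -/
noncomputable def cutVal (N : ℕ) (c : ℕ → ℕ → ℝ) (X : Finset ℕ) : ℝ :=
  ∑ u ∈ X, ∑ v ∈ Finset.range N \ X, c u v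

/-- `X` is a minimum cut that separates `s` from `t`. -/
def IsMinCut (N : ℕ) (c : ℕ → ℕ → ℝ) (s t : ℕ) (X : Finset ℕ) : Prop :=
  X ⊆ Finset.range N ∧ s ∈ X ∧ t ∉ X ∧
    ∀ Y ⊆ Finset.range N, s ∈ Y → t ∉ Y → cutVal N c X ≤ cutVal N c Y

/-- The invariant of push-relabel for the residual capacities `r`, the excesses `e` and the
labels `h`; the source starts with more than it can send. -/
structure Preflow (N : ℕ) (c : ℕ → ℕ → ℝ) (s t : ℕ) (r : ℕ → ℕ → ℝ) (e : ℕ → ℝ) (h : ℕ → ℕ) :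
    Prop where
  res_nonneg : ∀ u < N, ∀ v < N, 0 ≤ r u v
  res_add : ∀ u < N, ∀ v < N, r u v + r v u = c u v + c v u
  exc_nonneg : ∀ u < N, 0 ≤ e u
  exc_eq : ∀ u < N, e u = (if u = s then ∑ x ∈ Finset.range N, c s x + 1 else 0) +
    ∑ x ∈ Finset.range N, (c x u - r x u)
  label : ∀ u < N, ∀ v < N, 0 < r u v → h u ≤ h v + 1
  label_le : ∀ u < N, h u ≤ N
  label_sink : h t = 0

/-- `v` can be processed. -/
def Overflows (N t : ℕ) (e : ℕ → ℝ) (h : ℕ → ℕ) (v : ℕ) : Prop := 0 < e v ∧ v ≠ t ∧ h v < N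

section

variable {N : ℕ} {c : ℕ → ℕ → ℝ} {s t : ℕ} {r r' : ℕ → ℕ → ℝ} {e e' : ℕ → ℝ} {h h' : ℕ → ℕ}

/-- In contrast to the usual initialization the source is not lifted: all labels are `0`, and the
source is an ordinary vertex whose excess is one more than its outgoing capacity. A vertex whose
label reaches `N` is retired. -/
theorem Preflow.init (hc : ∀ u < N, ∀ v < N, 0 ≤ c u v) (hr : ∀ u < N, ∀ v < N, r u v = c u v)
    (he : ∀ u < N, e u = if u = s then ∑ x ∈ Finset.range N, c s x + 1 else 0)
    (hh : ∀ u < N, h u = 0) (hs : s < N) (ht : t < N) : Preflow N c s t r e h where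
  res_nonneg u hu v hv := by rw [hr u hu v hv]; exact hc u hu v hv
  res_add u hu v hv := by rw [hr u hu v hv, hr v hv u hu]
  exc_nonneg u hu := by
    rw [he u hu]
    split_ifs
    · have := Finset.sum_nonneg fun x (hx : x ∈ Finset.range N) =>
        hc s hs x (Finset.mem_range.1 hx)
      linarith
    · exact le_rfl
  exc_eq u hu := by
    have : ∑ x ∈ Finset.range N, (c x u - r x u) = 0 := Finset.sum_eq_zero fun x hx => by
      rw [hr x (Finset.mem_range.1 hx) u hu, sub_self]
    rw [he u hu, this, add_zero]
  label u hu v hv _ := by rw [hh u hu]; omega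
  label_le u hu := by rw [hh u hu]; omega
  label_sink := hh t ht

theorem Preflow.push (H : Preflow N c s t r e h) {v w : ℕ} (hv : v < N) (hw : w < N)
    (hvw : h v = h w + 1) {δ : ℝ} (h0 : 0 ≤ δ) (h1 : δ ≤ e v) (h2 : δ ≤ r v w)
    (hr : ∀ a < N, ∀ b < N, r' a b =
      r a b + (if a = w ∧ b = v then δ else 0) - (if a = v ∧ b = w then δ else 0))
    (he : ∀ a < N, e' a = e a + (if a = w then δ else 0) - (if a = v then δ else 0)) :
    Preflow N c s t r' e' h where
  res_nonneg a ha b hb := by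
    have := H.res_nonneg a ha b hb
    rw [hr a ha b hb]
    split_ifs with p q q
    · obtain ⟨rfl, rfl⟩ := p; obtain ⟨rfl, -⟩ := q; omega
    · linarith
    · obtain ⟨rfl, rfl⟩ := q; linarith
    · linarith
  res_add a ha b hb := by
    rw [hr a ha b hb, hr b hb a ha, ← H.res_add a ha b hb]
    simp only [and_comm (a := b = w), and_comm (a := b = v)]
    ring
  exc_nonneg a ha := by
    have := H.exc_nonneg a ha
    rw [he a ha]
    split_ifs with p q q
    · linarith
    · linarith
    · subst q; linarith
    · linarith
  exc_eq a ha := by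
    have : ∀ x ∈ Finset.range N, c x a - r' x a = (c x a - r x a) -
        (if x = w then (if a = v then δ else 0) else 0) +
        (if x = v then (if a = w then δ else 0) else 0) := by
      intro x hx
      rw [hr x (Finset.mem_range.1 hx) a ha, ite_and, ite_and]
      ring
    rw [Finset.sum_congr rfl this, Finset.sum_add_distrib, Finset.sum_sub_distrib,
      Finset.sum_ite_eq', Finset.sum_ite_eq', if_pos (Finset.mem_range.2 hw),
      if_pos (Finset.mem_range.2 hv), he a ha, H.exc_eq a ha]
    ring
  label a ha b hb hpos := by
    -- Only the reverse arc can gain residual capacity, and it leads to a higher label.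
    by_cases hab : a = w ∧ b = v
    · obtain ⟨rfl, rfl⟩ := hab; omega
    · refine H.label a ha b hb (hpos.trans_le ?_)
      rw [hr a ha b hb, if_neg hab]
      split_ifs <;> linarith
  label_le := H.label_le
  label_sink := H.label_sink

/-- With no admissible arc at `v`, every residual arc from `v` satisfies `h v ≤ h w`, which leaves
room to raise the label by one. -/
theorem Preflow.relabel (H : Preflow N c s t r e h) {v : ℕ} (hact : Overflows N t e h v)
    (hno : ∀ w < N, ¬ (0 < r v w ∧ h v = h w + 1)) (hv : v < N)
    (hh : ∀ a < N, h' a = if a = v then h a + 1 else h a) (ht : t < N) :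
    Preflow N c s t r e h' where
  res_nonneg := H.res_nonneg
  res_add := H.res_add
  exc_nonneg := H.exc_nonneg
  exc_eq := H.exc_eq
  label a ha b hb hpos := by
    have := H.label a ha b hb hpos
    rw [hh a ha, hh b hb]
    by_cases hav : a = v
    · subst hav
      have := hno b hb
      simp only [hpos, true_and] at this
      split_ifs <;> omega
    · split_ifs <;> omega
  label_le a ha := by
    rw [hh a ha]
    split_ifs with p
    · subst p; exact hact.2.2
    · exact H.label_le a ha
  label_sink := by rw [hh t ht, if_neg hact.2.1.symm, H.label_sink]

open Classical in
/-- The lexicographic measure that each operation decreases. -/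
noncomputable def flowMeasure (N t : ℕ) (r : ℕ → ℕ → ℝ) (e : ℕ → ℝ) (h : ℕ → ℕ) : ℕ :=
  (∑ v ∈ Finset.range N, (N - h v)) * (N * N + 1) ^ 2 +
  ((Finset.range N ×ˢ Finset.range N).filter
    (fun p => 0 < r p.1 p.2 ∧ h p.1 = h p.2 + 1)).card * (N * N + 1) +
  ∑ v ∈ Finset.range N, (if Overflows N t e h v then h v else 0)

/-- The triple is read as a number in base `M + 1`; only the last two digits need to be bounded. -/
theorem lex_lt {M A A' B B' C C' : ℕ} (hB' : B' ≤ M) (hC' : C' ≤ M)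
    (h : A' < A ∨ A' ≤ A ∧ (B' < B ∨ B' ≤ B ∧ C' < C)) :
    A' * (M + 1) ^ 2 + B' * (M + 1) + C' < A * (M + 1) ^ 2 + B * (M + 1) + C := by
  rcases h with h | ⟨h, h1 | ⟨h1, h2⟩⟩
  · nlinarith [Nat.mul_le_mul_right ((M + 1) ^ 2) h, Nat.mul_le_mul_right (M + 1) hB']
  · nlinarith [Nat.mul_le_mul_right ((M + 1) ^ 2) h, Nat.mul_le_mul_right (M + 1) h1]
  · nlinarith [Nat.mul_le_mul_right ((M + 1) ^ 2) h, Nat.mul_le_mul_right (M + 1) h1]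

open Classical in
theorem admissible_card_le : ((Finset.range N ×ˢ Finset.range N).filter
    (fun p => 0 < r p.1 p.2 ∧ h p.1 = h p.2 + 1)).card ≤ N * N := by
  refine (Finset.card_filter_le _ _).trans ?_
  simp

open Classical in
theorem overflow_sum_le :
    ∑ v ∈ Finset.range N, (if Overflows N t e h v then h v else 0) ≤ N * N := by
  refine (Finset.sum_le_card_nsmul _ _ N fun v _ => ?_).trans (by simp)
  split_ifs with hv
  · exact hv.2.2.le
  · omega

theorem flowMeasure_le : flowMeasure N t r e h ≤ (N * N + 1) ^ 3 := by
  have h1 : ∑ v ∈ Finset.range N, (N - h v) ≤ N * N :=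
    (Finset.sum_le_card_nsmul _ _ N fun v _ => Nat.sub_le _ _).trans (by simp)
  have := lex_lt (M := N * N) (A := N * N + 1) (B := 0) (C := 0) (admissible_card_le (N := N)
    (r := r) (h := h)) (overflow_sum_le (N := N) (t := t) (e := e) (h := h)) (Or.inl
      (Nat.lt_succ_of_le h1))
  unfold flowMeasure
  refine this.le.trans (le_of_eq (by ring))

theorem flowMeasure_relabel {v : ℕ} (hact : Overflows N t e h v) (hv : v < N)
    (hh : ∀ a < N, h' a = if a = v then h a + 1 else h a) :
    flowMeasure N t r e h' < flowMeasure N t r e h := by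
  refine lex_lt admissible_card_le overflow_sum_le (Or.inl ?_)
  refine Finset.sum_lt_sum (fun a ha => ?_) ⟨v, Finset.mem_range.2 hv, ?_⟩
  · rw [hh a (Finset.mem_range.1 ha)]
    split_ifs <;> omega
  · have := hact.2.2
    rw [hh v hv, if_pos rfl]
    omega

/-- A saturating push removes `(v, w)` from the admissible arcs and adds none, as the reverse arc
leads upwards. A push of the full excess stops `v` from overflowing; at most `w` starts to, and its
label is smaller by one. -/
theorem flowMeasure_push {v w : ℕ} (hact : Overflows N t e h v)
    (hv : v < N) (hw : w < N) (hpos : 0 < r v w) (hvw : h v = h w + 1) {δ : ℝ} (h0 : 0 ≤ δ)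
    (hδ : δ = e v ∨ δ = r v w)
    (hr : ∀ a < N, ∀ b < N, r' a b =
      r a b + (if a = w ∧ b = v then δ else 0) - (if a = v ∧ b = w then δ else 0))
    (he : ∀ a < N, e' a = e a + (if a = w then δ else 0) - (if a = v then δ else 0)) :
    flowMeasure N t r' e' h < flowMeasure N t r e h := by
  classical
  have hne : v ≠ w := by rintro rfl; omega
  refine lex_lt admissible_card_le overflow_sum_le (Or.inr ⟨le_rfl, ?_⟩)
  have hsub : ∀ p ∈ (Finset.range N ×ˢ Finset.range N).filter
      (fun p => 0 < r' p.1 p.2 ∧ h p.1 = h p.2 + 1), p ∈ (Finset.range N ×ˢ Finset.range N).filter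
      (fun p => 0 < r p.1 p.2 ∧ h p.1 = h p.2 + 1) := by
    rintro ⟨a, b⟩ hp
    simp only [Finset.mem_filter, Finset.mem_product, Finset.mem_range] at hp ⊢
    obtain ⟨⟨ha, hb⟩, hp1, hp2⟩ := hp
    refine ⟨⟨ha, hb⟩, ?_, hp2⟩
    rw [hr a ha b hb, if_neg (by rintro ⟨rfl, rfl⟩; omega)] at hp1
    split_ifs at hp1 <;> linarith
  rcases hδ with rfl | rfl
  · refine Or.inr ⟨Finset.card_le_card hsub, ?_⟩
    -- The correction terms `h v` at `v` and `h w` at `w` turn the comparison of the sums into one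
    -- term by term.
    have key : ∑ a ∈ Finset.range N, ((if Overflows N t e' h a then h a else 0) +
        (if a = v then h v else 0)) ≤ ∑ a ∈ Finset.range N,
        ((if Overflows N t e h a then h a else 0) + (if a = w then h w else 0)) := by
      refine Finset.sum_le_sum fun a ha => ?_
      have hea := he a (Finset.mem_range.1 ha)
      by_cases hav : a = v
      · subst hav
        rw [if_neg hne, if_pos rfl] at hea
        rw [if_neg (fun hh : Overflows N t e' h a => by have := hh.1; linarith), if_pos rfl,
          if_pos hact, if_neg hne]
        omega
      · by_cases haw : a = w
        · subst haw
          rw [if_neg hav, if_pos rfl]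
          split_ifs <;> omega
        · rw [if_neg hav, if_neg haw]
          rw [if_neg hav, if_neg haw, add_zero, sub_zero] at hea
          rw [Overflows, Overflows, hea]
    rw [Finset.sum_add_distrib, Finset.sum_add_distrib, Finset.sum_ite_eq', Finset.sum_ite_eq',
      if_pos (Finset.mem_range.2 hv), if_pos (Finset.mem_range.2 hw)] at key
    omega
  · refine Or.inl (Finset.card_lt_card (Finset.ssubset_iff_subset_ne.2 ⟨hsub, fun heq => ?_⟩))
    have hmem : (v, w) ∈ (Finset.range N ×ˢ Finset.range N).filter
      (fun p => 0 < r p.1 p.2 ∧ h p.1 = h p.2 + 1) := by simp [hv, hw, hpos, hvw]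
    rw [← heq] at hmem
    simp only [Finset.mem_filter] at hmem
    have := hmem.2.1
    rw [hr v hv w hw, if_neg (fun hh => hne hh.1), if_pos ⟨rfl, rfl⟩] at this
    linarith

/-- The net flow `c - r` is antisymmetric, so its contributions between two vertices outside `X`
cancel and only the flow across the cut remains. -/
theorem Preflow.sum_exc (H : Preflow N c s t r e h) {X : Finset ℕ} (hX : X ⊆ Finset.range N)
    (hs : s ∈ X) : ∑ u ∈ Finset.range N \ X, e u =
      ∑ x ∈ X, ∑ u ∈ Finset.range N \ X, (c x u - r x u) := by
  set Y := Finset.range N \ X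
  have hYN : ∀ u ∈ Y, u < N := fun u hu => Finset.mem_range.1 (Finset.mem_sdiff.1 hu).1
  have h1 : ∀ u ∈ Y, e u = ∑ x ∈ X, (c x u - r x u) + ∑ x ∈ Y, (c x u - r x u) := by
    intro u hu
    rw [H.exc_eq u (hYN u hu), if_neg (by rintro rfl; exact (Finset.mem_sdiff.1 hu).2 hs), zero_add,
      ← Finset.sum_sdiff hX, add_comm]
  have h2 : ∑ u ∈ Y, ∑ x ∈ Y, (c x u - r x u) = 0 := by
    have h3 : ∑ u ∈ Y, ∑ x ∈ Y, (c x u - r x u) = - ∑ u ∈ Y, ∑ x ∈ Y, (c x u - r x u) := by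
      conv_lhs => rw [Finset.sum_comm]
      rw [← Finset.sum_neg_distrib]
      refine Finset.sum_congr rfl fun u hu => ?_
      rw [← Finset.sum_neg_distrib]
      refine Finset.sum_congr rfl fun x hx => ?_
      have := H.res_add u (hYN u hu) x (hYN x hx)
      linarith
    linarith
  rw [Finset.sum_congr rfl h1, Finset.sum_add_distrib, h2, add_zero, Finset.sum_comm]

/-- The net loss of the source is at most its outgoing capacity, and it began with one unit more. So
the source stops overflowing only when its label reaches `N`. -/
theorem Preflow.source (H : Preflow N c s t r e h) (hs : s < N) : 0 < e s := by
  have h1 : ∑ x ∈ Finset.range N, (c x s - r x s) =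
      ∑ x ∈ Finset.range N, r s x - ∑ x ∈ Finset.range N, c s x := by
    rw [← Finset.sum_sub_distrib]
    refine Finset.sum_congr rfl fun x hx => ?_
    have := H.res_add s hs x (Finset.mem_range.1 hx)
    linarith
  have h2 : 0 ≤ ∑ x ∈ Finset.range N, r s x :=
    Finset.sum_nonneg fun x hx => H.res_nonneg s hs x (Finset.mem_range.1 hx)
  rw [H.exc_eq s hs, if_pos rfl, h1]
  linarith

/-- At the end the source has label `N`. The other `N - 1` vertices cannot occupy all `N` labels
below `N`. -/
theorem Preflow.exists_gap (H : Preflow N c s t r e h) (hs : s < N) (hst : s ≠ t)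
    (hend : ∀ v < N, ¬ Overflows N t e h v) : ∃ l < N, ∀ v < N, h v ≠ l := by
  by_contra! hcon
  have hsub : Finset.range N ⊆ ((Finset.range N).erase s).image h := by
    intro l hl
    obtain ⟨v, hv, rfl⟩ := hcon l (Finset.mem_range.1 hl)
    refine Finset.mem_image.2 ⟨v, Finset.mem_erase.2 ⟨?_, Finset.mem_range.2 hv⟩, rfl⟩
    rintro rfl
    exact hend v hs ⟨H.source hs, hst, Finset.mem_range.1 hl⟩
  have h1 := Finset.card_le_card hsub
  have h2 := h1.trans Finset.card_image_le
  rw [Finset.card_erase_of_mem (Finset.mem_range.2 hs), Finset.card_range] at h2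
  omega

/-- The cut is made at a gap `l` of the labels. Below the gap no vertex except the sink has excess,
and no residual arc crosses it, so the value of the cut equals the excess of the sink. Every
separating cut is at least that excess. -/
theorem Preflow.isMinCut (H : Preflow N c s t r e h) (hs : s < N) (ht : t < N) (hst : s ≠ t)
    (hend : ∀ v < N, ¬ Overflows N t e h v) {l : ℕ} (hl : l < N) (hgap : ∀ v < N, h v ≠ l) :
    IsMinCut N c s t ((Finset.range N).filter (fun v => l < h v)) := by
  set X := (Finset.range N).filter (fun v => l < h v) with hXdef
  have hsX : s ∈ X := by
    refine Finset.mem_filter.2 ⟨Finset.mem_range.2 hs, ?_⟩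
    by_contra hcon
    exact hend s hs ⟨H.source hs, hst, by omega⟩
  have htX : t ∉ X := by
    intro h
    have := (Finset.mem_filter.1 h).2
    rw [H.label_sink] at this
    omega
  have hXN : X ⊆ Finset.range N := Finset.filter_subset _ _
  refine ⟨hXN, hsX, htX, fun Z hZ hsZ htZ => ?_⟩
  have hupper : e t ≤ cutVal N c Z := by
    have h1 : e t ≤ ∑ u ∈ Finset.range N \ Z, e u :=
      Finset.single_le_sum (f := e)
        (fun u hu => H.exc_nonneg u (Finset.mem_range.1 (Finset.mem_sdiff.1 hu).1))
        (Finset.mem_sdiff.2 ⟨Finset.mem_range.2 ht, htZ⟩)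
    rw [H.sum_exc hZ hsZ] at h1
    refine h1.trans (Finset.sum_le_sum fun x hx => Finset.sum_le_sum fun u hu => ?_)
    have := H.res_nonneg x (Finset.mem_range.1 (hZ hx)) u
      (Finset.mem_range.1 (Finset.mem_sdiff.1 hu).1)
    linarith
  refine le_trans (le_of_eq ?_) hupper
  have h1 : ∑ u ∈ Finset.range N \ X, e u = e t := by
    refine Finset.sum_eq_single_of_mem t (Finset.mem_sdiff.2 ⟨Finset.mem_range.2 ht, htX⟩) ?_
    intro u hu hut
    obtain ⟨huN, huX⟩ := Finset.mem_sdiff.1 hu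
    rw [Finset.mem_range] at huN
    by_contra hne
    refine hend u huN ⟨lt_of_le_of_ne (H.exc_nonneg u huN) (Ne.symm hne), hut, ?_⟩
    by_contra hcon
    exact huX (Finset.mem_filter.2 ⟨Finset.mem_range.2 huN, by omega⟩)
  rw [← h1, H.sum_exc hXN hsX]
  refine Finset.sum_congr rfl fun x hx => Finset.sum_congr rfl fun u hu => ?_
  obtain ⟨hxN, hxl⟩ := Finset.mem_filter.1 hx
  obtain ⟨huN, huX⟩ := Finset.mem_sdiff.1 hu
  rw [Finset.mem_range] at hxN huN
  have hul : ¬ l < h u := fun h => huX (Finset.mem_filter.2 ⟨Finset.mem_range.2 huN, h⟩)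
  have h3 := hgap u huN
  -- A residual arc descends by at most one label, while the labels here lie strictly above and
  -- strictly below `l`.
  have h4 : r x u = 0 := by
    by_contra hne
    have := H.label x hxN u huN (lt_of_le_of_ne (H.res_nonneg x hxN u huN) (Ne.symm hne))
    omega
  rw [h4, sub_zero]

end

/-! ### Evaluation of expressions and statements -/

/-- Loops without exit test are treated by this: a goal `D` that is preserved once reached, and a
measure that drops until then. Any number of rounds that is at least the initial measure will do. -/
theorem iterate_done {α : Type*} {f : α → α} {I D : α → Prop} (m : α → ℕ)
    (hI : ∀ x, I x → I (f x)) (hD : ∀ x, I x → D x → D (f x))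
    (hm : ∀ x, I x → ¬ D x → m (f x) < m x) :
    ∀ K x, I x → m x ≤ K → I (f^[K] x) ∧ D (f^[K] x) := by
  intro K
  induction K with
  | zero =>
    intro x hx hK
    refine ⟨hx, by_contra fun hn => ?_⟩
    have := hm x hx hn
    omega
  | succ K ih =>
    intro x hx hK
    by_cases hd : D x
    · have : ∀ j y, I y → D y → I (f^[j] y) ∧ D (f^[j] y) := by
        intro j
        induction j with
        | zero => exact fun y h h' => ⟨h, h'⟩
        | succ j ihj => exact fun y h h' => ihj _ (hI y h) (hD y h h')
      exact this _ x hx hd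
    · have := hm x hx hd
      exact ih (f x) (hI x hx) (by omega)

namespace Ex

/-- The truth of an expression used as a test. -/
def Holds (N : ℕ) (σ : Store) (b : Ex .nat) : Prop := 1 ≤ b.eval N σ

noncomputable instance (N : ℕ) (σ : Store) (b : Ex .nat) : Decidable (b.Holds N σ) :=
  Nat.decLe 1 (b.eval N σ)

def and (a b : Ex .nat) : Ex .nat := .ite a b (.const 0)
def or (a b : Ex .nat) : Ex .nat := .ite a (.const 1) b
def not (a : Ex .nat) : Ex .nat := .ite a (.const 0) (.const 1)
def add (a b : Ex .nat) : Ex .nat := .bin .add a b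
def sub (a b : Ex .nat) : Ex .nat := .bin .sub a b
def le (a b : Ex .nat) : Ex .nat := .bin .le a b
def lt (a b : Ex .nat) : Ex .nat := .bin .le (.add a (.const 1)) b
def eq (a b : Ex .nat) : Ex .nat := .and (.le a b) (.le b a)
def rle (a b : Ex .real) : Ex .nat := .bin .rle a b
def rlt (a b : Ex .real) : Ex .nat := .not (.bin .rle b a)
def read (a : ℕ) (i j : Ex .nat) : Ex .nat := .bin (.read a) i j
def rread (a : ℕ) (i j : Ex .nat) : Ex .real := .bin (.rread a) i j
def radd (a b : Ex .real) : Ex .real := .bin .radd a b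
def rsub (a b : Ex .real) : Ex .real := .bin .rsub a b
def rmul (a : Ex .real) (b : Ex .nat) : Ex .real := .bin .rmul a b
def rdiv (a : Ex .real) (b : Ex .nat) : Ex .real := .bin .rdiv a b
def sum (x : ℕ) (e : Ex .nat) : Ex .nat := .fold .sumN x e
def rsum (x : ℕ) (e : Ex .real) : Ex .real := .fold .sumR x e
def rmax (x : ℕ) (e : Ex .real) : Ex .real := .fold .maxR x e
def find (x : ℕ) (e : Ex .nat) : Ex .nat := .fold .find x e
def ex (x : ℕ) (b : Ex .nat) : Ex .nat := .sum x (.ite b (.const 1) (.const 0))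
def all (x : ℕ) (b : Ex .nat) : Ex .nat := .not (.ex x (.not b))

variable (N : ℕ) (σ : Store)

theorem eval_ite {t : Ty} (b : Ex .nat) (e f : Ex t) :
    (ite b e f).eval N σ = if b.Holds N σ then e.eval N σ else f.eval N σ := rfl
theorem eval_bound : bound.eval N σ = N := rfl
theorem eval_const (c : ℕ) : (const c).eval N σ = c := rfl
theorem eval_var (x : ℕ) : (var x).eval N σ = σ.natVar x := rfl
theorem eval_rvar (x : ℕ) : (rvar x).eval N σ = σ.realVar x := rfl
theorem eval_cast (e : Ex .nat) : (cast e).eval N σ = ((e.eval N σ : ℕ) : ℝ) := rfl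
theorem eval_add (a b : Ex .nat) : (add a b).eval N σ = (a.eval N σ + b.eval N σ : ℕ) := rfl
theorem eval_sub (a b : Ex .nat) : (sub a b).eval N σ = (a.eval N σ - b.eval N σ : ℕ) := rfl
theorem eval_read (a : ℕ) (i j : Ex .nat) :
    (read a i j).eval N σ = σ.natArr a (i.eval N σ) (j.eval N σ) := rfl
theorem eval_rread (a : ℕ) (i j : Ex .nat) :
    (rread a i j).eval N σ = σ.realArr a (i.eval N σ) (j.eval N σ) := rfl
theorem eval_radd (a b : Ex .real) : (radd a b).eval N σ = (a.eval N σ + b.eval N σ : ℝ) := rfl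
theorem eval_rsub (a b : Ex .real) : (rsub a b).eval N σ = (a.eval N σ - b.eval N σ : ℝ) := rfl
theorem eval_rmul (a : Ex .real) (b : Ex .nat) :
    (rmul a b).eval N σ = (a.eval N σ * ((b.eval N σ : ℕ) : ℝ) : ℝ) := rfl
theorem eval_rdiv (a : Ex .real) (b : Ex .nat) :
    (rdiv a b).eval N σ = (a.eval N σ / ((b.eval N σ : ℕ) : ℝ) : ℝ) := rfl

theorem holds_iff (b : Ex .nat) : b.Holds N σ ↔ 1 ≤ b.eval N σ := Iff.rfl
theorem holds_const (c : ℕ) : (const c).Holds N σ ↔ 1 ≤ c := Iff.rfl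
theorem holds_var (x : ℕ) : (var x).Holds N σ ↔ 1 ≤ σ.natVar x := Iff.rfl
theorem holds_read (a : ℕ) (i j : Ex .nat) : (read a i j).Holds N σ ↔
    1 ≤ σ.natArr a (i.eval N σ) (j.eval N σ) := Iff.rfl
theorem holds_and (a b : Ex .nat) : (and a b).Holds N σ ↔ a.Holds N σ ∧ b.Holds N σ := by
  rw [holds_iff, and, eval_ite]
  split_ifs with h
  · simp [h, holds_iff]
  · simp [h, eval_const]
theorem holds_or (a b : Ex .nat) : (or a b).Holds N σ ↔ a.Holds N σ ∨ b.Holds N σ := by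
  rw [holds_iff, or, eval_ite]
  split_ifs with h
  · simp [h, eval_const]
  · simp [h, holds_iff]
theorem holds_not (a : Ex .nat) : (not a).Holds N σ ↔ ¬ a.Holds N σ := by
  rw [holds_iff, not, eval_ite]
  split_ifs with h <;> simp [h, eval_const]
theorem holds_le (a b : Ex .nat) : (le a b).Holds N σ ↔ a.eval N σ ≤ b.eval N σ := by
  rw [holds_iff]
  simp only [le, eval, Bin.ap]
  split_ifs with h <;> simp [h]
theorem holds_lt (a b : Ex .nat) : (lt a b).Holds N σ ↔ a.eval N σ < b.eval N σ :=
  holds_le N σ _ _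
theorem holds_eq (a b : Ex .nat) : (eq a b).Holds N σ ↔ a.eval N σ = b.eval N σ := by
  rw [eq, holds_and, holds_le, holds_le]
  exact ⟨fun h => Nat.le_antisymm h.1 h.2, fun h => ⟨Nat.le_of_eq h, Nat.le_of_eq h.symm⟩⟩
theorem holds_rle (a b : Ex .real) :
    (rle a b).Holds N σ ↔ (a.eval N σ : ℝ) ≤ b.eval N σ := by
  rw [holds_iff]
  simp only [rle, eval, Bin.ap]
  split_ifs with h <;> simp [h]
theorem holds_rlt (a b : Ex .real) :
    (rlt a b).Holds N σ ↔ (a.eval N σ : ℝ) < b.eval N σ := by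
  rw [rlt, holds_not]
  exact (not_congr (holds_rle N σ b a)).trans not_le

theorem foldTo_sum {M : Type*} [AddCommMonoid M] (f : ℕ → M) (i : ℕ) :
    foldTo (fun i acc => acc + f i) 0 i = ∑ j ∈ Finset.range i, f j := by
  induction i with
  | zero => rfl
  | succ i ih => rw [Finset.sum_range_succ, ← ih]; rfl

theorem eval_sum (x : ℕ) (e : Ex .nat) : (sum x e).eval N σ =
    ∑ i ∈ Finset.range N, (e.eval N (σ.setNat x i) : ℕ) := foldTo_sum _ _
theorem eval_rsum (x : ℕ) (e : Ex .real) : (rsum x e).eval N σ =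
    ∑ i ∈ Finset.range N, (e.eval N (σ.setNat x i) : ℝ) := foldTo_sum _ _

theorem holds_ex (x : ℕ) (b : Ex .nat) :
    (ex x b).Holds N σ ↔ ∃ i < N, b.Holds N (σ.setNat x i) := by
  rw [holds_iff, ex, eval_sum, Nat.one_le_iff_ne_zero, Ne, Finset.sum_eq_zero_iff]
  simp only [Finset.mem_range, eval_ite, eval_const]
  push Not
  refine exists_congr fun i => and_congr_right fun _ => ?_
  split_ifs with h <;> simp [h]

theorem holds_all (x : ℕ) (b : Ex .nat) :
    (all x b).Holds N σ ↔ ∀ i < N, b.Holds N (σ.setNat x i) := by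
  rw [all, holds_not, holds_ex]
  simp only [holds_not]
  push Not
  rfl

theorem find_spec (x : ℕ) (b : Ex .nat) :
    (((find x b).eval N σ : ℕ) < N ∧ b.Holds N (σ.setNat x ((find x b).eval N σ))) ∨
    ((find x b).eval N σ = N ∧ ∀ i < N, ¬ b.Holds N (σ.setNat x i)) := by
  have key : ∀ i ≤ N, ∀ a : ℕ, a = foldTo (fun i acc => Op.find.ap N i acc
      (b.eval N (σ.setNat x i))) (Op.find.start N) i →
      (a < N ∧ b.Holds N (σ.setNat x a)) ∨ (a = N ∧ ∀ j < i, ¬ b.Holds N (σ.setNat x j)) := by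
    intro i
    induction i with
    | zero => rintro - a rfl; exact Or.inr ⟨rfl, fun j hj => absurd hj (Nat.not_lt_zero j)⟩
    | succ i ih =>
      rintro hi a rfl
      have ih' := ih (by omega) _ rfl
      simp only [foldTo]
      set acc := foldTo (fun i acc => Op.find.ap N i acc
        (b.eval N (σ.setNat x i))) (Op.find.start N) i
      by_cases hb : b.Holds N (σ.setNat x i) ∧ N ≤ acc
      · have : Op.find.ap N i acc (b.eval N (σ.setNat x i)) = i := if_pos hb
        rw [this]
        exact Or.inl ⟨hi, hb.1⟩
      · have : Op.find.ap N i acc (b.eval N (σ.setNat x i)) = acc := if_neg hb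
        rw [this]
        rcases ih' with h | ⟨h1, h2⟩
        · exact Or.inl h
        · refine Or.inr ⟨h1, fun j hj => ?_⟩
          rcases Nat.lt_succ_iff_lt_or_eq.1 hj with h | rfl
          · exact h2 j h
          · exact fun h => hb ⟨h, h1.ge⟩
  exact key N le_rfl _ rfl

theorem rmax_spec (x : ℕ) (e : Ex .real) :
    (((rmax x e).eval N σ : ℝ) = 0 ∨ ∃ i < N, (rmax x e).eval N σ = e.eval N (σ.setNat x i)) ∧
    (0 : ℝ) ≤ (rmax x e).eval N σ ∧
    ∀ i < N, (e.eval N (σ.setNat x i) : ℝ) ≤ (rmax x e).eval N σ := by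
  have key : ∀ i ≤ N, ∀ a : ℝ, a = foldTo (fun i acc => Op.maxR.ap N i acc
      (e.eval N (σ.setNat x i))) (Op.maxR.start N) i →
      (a = 0 ∨ ∃ j < N, a = e.eval N (σ.setNat x j)) ∧ (0 : ℝ) ≤ a ∧
      ∀ j < i, (e.eval N (σ.setNat x j) : ℝ) ≤ a := by
    intro i
    induction i with
    | zero => rintro - a rfl; exact ⟨Or.inl rfl, le_rfl, fun j hj => absurd hj (Nat.not_lt_zero j)⟩
    | succ i ih =>
      rintro hi a rfl
      have ih' := ih (by omega) _ rfl
      simp only [foldTo]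
      set acc : ℝ := foldTo (fun i acc => Op.maxR.ap N i acc
        (e.eval N (σ.setNat x i))) (Op.maxR.start N) i
      by_cases hb : acc ≤ (e.eval N (σ.setNat x i) : ℝ)
      · have : Op.maxR.ap N i acc (e.eval N (σ.setNat x i)) = e.eval N (σ.setNat x i) := if_pos hb
        rw [this]
        refine ⟨Or.inr ⟨i, hi, rfl⟩, ih'.2.1.trans hb, fun j hj => ?_⟩
        rcases Nat.lt_succ_iff_lt_or_eq.1 hj with h | rfl
        · exact (ih'.2.2 j h).trans hb
        · exact le_rfl
      · have : Op.maxR.ap N i acc (e.eval N (σ.setNat x i)) = acc := if_neg hb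
        rw [this]
        refine ⟨ih'.1, ih'.2.1, fun j hj => ?_⟩
        rcases Nat.lt_succ_iff_lt_or_eq.1 hj with h | rfl
        · exact ih'.2.2 j h
        · exact (not_le.1 hb).le
  exact key N le_rfl _ rfl

end Ex

/-! ### Projections of updated states -/

section

variable (σ : Store)

theorem natVar_setNat (x v y : ℕ) :
    (σ.setNat x v).natVar y = if y = x then v else σ.natVar y := Function.update_apply _ _ _ _
theorem realVar_setNat (x v : ℕ) : (σ.setNat x v).realVar = σ.realVar := rfl
theorem natArr_setNat (x v : ℕ) : (σ.setNat x v).natArr = σ.natArr := rfl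
theorem realArr_setNat (x v : ℕ) : (σ.setNat x v).realArr = σ.realArr := rfl
theorem natVar_setReal (x : ℕ) (v : ℝ) : (σ.setReal x v).natVar = σ.natVar := rfl
theorem realVar_setReal (x y : ℕ) (v : ℝ) :
    (σ.setReal x v).realVar y = if y = x then v else σ.realVar y := Function.update_apply _ _ _ _
theorem natArr_setReal (x : ℕ) (v : ℝ) : (σ.setReal x v).natArr = σ.natArr := rfl
theorem realArr_setReal (x : ℕ) (v : ℝ) : (σ.setReal x v).realArr = σ.realArr := rfl
theorem natVar_putArr (t : Ty) (a : ℕ) (f : ℕ → ℕ → t.Val) :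
    (σ.putArr t a f).natVar = σ.natVar := by cases t <;> rfl
theorem realVar_putArr (t : Ty) (a : ℕ) (f : ℕ → ℕ → t.Val) :
    (σ.putArr t a f).realVar = σ.realVar := by cases t <;> rfl
theorem natArr_putArr (a b : ℕ) (f : ℕ → ℕ → ℕ) :
    (σ.putArr .nat a f).natArr b = if b = a then f else σ.natArr b := Function.update_apply _ _ _ _
theorem realArr_putArr (a b : ℕ) (f : ℕ → ℕ → ℝ) :
    (σ.putArr .real a f).realArr b = if b = a then f else σ.realArr b :=
  Function.update_apply _ _ _ _
theorem natArr_putArr_real (a : ℕ) (f : ℕ → ℕ → ℝ) : (σ.putArr .real a f).natArr = σ.natArr := rfl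
theorem realArr_putArr_nat (a : ℕ) (f : ℕ → ℕ → ℕ) : (σ.putArr .nat a f).realArr = σ.realArr := rfl

end

/-! ### Evaluation of statements, frame properties and counting loops -/

namespace Stmt

variable (N : ℕ) (σ : Store)

theorem den_set_nat (x : ℕ) (e : Ex .nat) : (set x e).den N σ = σ.setNat x (e.eval N σ) := rfl
theorem den_set_real (x : ℕ) (e : Ex .real) : (set x e).den N σ = σ.setReal x (e.eval N σ) := rfl
theorem den_fill_nat (a x y : ℕ) (e : Ex .nat) : (fill a x y e).den N σ =
    σ.putArr .nat a (fun i j => if i < N ∧ j < N then e.eval N ((σ.setNat x i).setNat y j) else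
      σ.natArr a i j) := rfl
theorem den_fill_real (a x y : ℕ) (e : Ex .real) : (fill a x y e).den N σ =
    σ.putArr .real a (fun i j => if i < N ∧ j < N then e.eval N ((σ.setNat x i).setNat y j) else
      σ.realArr a i j) := rfl
theorem den_seq (p q : Stmt) : (seq p q).den N σ = q.den N (p.den N σ) := rfl
theorem den_ite (b : Ex .nat) (p q : Stmt) :
    (ite b p q).den N σ = if b.Holds N σ then p.den N σ else q.den N σ := rfl
theorem den_rep (p : Stmt) : (rep p).den N σ = (p.den N)^[N] σ := rfl
theorem den_skip : skip.den N σ = σ := rfl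

/-- Nesting supplies a higher power of `N` as the number of rounds. -/
def reps : ℕ → Stmt → Stmt
  | 0, p => p
  | j + 1, p => .rep (reps j p)

theorem den_reps (j : ℕ) (p : Stmt) : (reps j p).den N = (p.den N)^[N ^ j] := by
  induction j with
  | zero => rfl
  | succ j ih =>
    funext σ
    rw [reps, den_rep, ih, ← Function.iterate_mul, pow_succ]

/-- Runs `p` for the values `0`, ..., `N - 1` of the variable `x`. -/
def forAll (x : ℕ) (p : Stmt) : Stmt :=
  .seq (.set x (.const 0)) (.rep (.seq p (.set x (.add (.var x) (.const 1)))))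

/-- A syntactic frame condition. It is computable, so for concrete programs `rfl` shows that a
variable is left alone. -/
def writesVar : Stmt → Ty → ℕ → Bool
  | .set (t := .nat) x _, .nat, y => x == y
  | .set (t := .real) x _, .real, y => x == y
  | .set _ _, _, _ => false
  | .fill _ _ _ _, _, _ => false
  | .seq p q, u, y => p.writesVar u y || q.writesVar u y
  | .ite _ p q, u, y => p.writesVar u y || q.writesVar u y
  | .rep p, u, y => p.writesVar u y
  | .skip, _, _ => false

def writesArr : Stmt → Ty → ℕ → Bool
  | .fill (t := .nat) a _ _ _, .nat, b => a == b
  | .fill (t := .real) a _ _ _, .real, b => a == b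
  | .fill _ _ _ _, _, _ => false
  | .set _ _, _, _ => false
  | .seq p q, u, y => p.writesArr u y || q.writesArr u y
  | .ite _ p q, u, y => p.writesArr u y || q.writesArr u y
  | .rep p, u, y => p.writesArr u y
  | .skip, _, _ => false

theorem get_den (p : Stmt) (u : Ty) (y : ℕ) (h : p.writesVar u y = false) :
    (p.den N σ).get u y = σ.get u y := by
  induction p generalizing σ with
  | @set t x e =>
    cases t <;> cases u <;> first
      | rfl
      | (have : y ≠ x := fun hh => by simp [writesVar, hh] at h
         exact Store.get_put _ _ _ _ _ _ this)
  | @fill t a x z e => cases t <;> cases u <;> rfl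
  | seq p q ihp ihq =>
    simp only [writesVar, Bool.or_eq_false_iff] at h
    rw [den_seq, ihq _ h.2, ihp _ h.1]
  | ite b p q ihp ihq =>
    simp only [writesVar, Bool.or_eq_false_iff] at h
    rw [den_ite]
    split_ifs
    · exact ihp _ h.1
    · exact ihq _ h.2
  | rep p ih =>
    have : ∀ j σ, ((p.den N)^[j] σ).get u y = σ.get u y := by
      intro j
      induction j with
      | zero => exact fun _ => rfl
      | succ j ihj => intro σ; rw [Function.iterate_succ_apply, ihj, ih _ h]
    exact this N σ
  | skip => rfl

theorem arr_den (p : Stmt) (u : Ty) (b : ℕ) (h : p.writesArr u b = false) :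
    (p.den N σ).arr u b = σ.arr u b := by
  induction p generalizing σ with
  | @set t x e => cases t <;> cases u <;> rfl
  | @fill t a x z e =>
    cases t <;> cases u <;> first
      | rfl
      | (have : b ≠ a := fun hh => by simp [writesArr, hh] at h
         exact Function.update_of_ne this _ _)
  | seq p q ihp ihq =>
    simp only [writesArr, Bool.or_eq_false_iff] at h
    rw [den_seq, ihq _ h.2, ihp _ h.1]
  | ite b p q ihp ihq =>
    simp only [writesArr, Bool.or_eq_false_iff] at h
    rw [den_ite]
    split_ifs
    · exact ihp _ h.1
    · exact ihq _ h.2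
  | rep p ih =>
    have : ∀ j σ, ((p.den N)^[j] σ).arr u b = σ.arr u b := by
      intro j
      induction j with
      | zero => exact fun _ => rfl
      | succ j ihj => intro σ; rw [Function.iterate_succ_apply, ihj, ih _ h]
    exact this N σ
  | skip => rfl

theorem natVar_den {p : Stmt} {x : ℕ} (h : p.writesVar .nat x = false) :
    (p.den N σ).natVar x = σ.natVar x := get_den N σ p .nat x h
theorem realVar_den {p : Stmt} {x : ℕ} (h : p.writesVar .real x = false) :
    (p.den N σ).realVar x = σ.realVar x := get_den N σ p .real x h
theorem natArr_den {p : Stmt} {a : ℕ} (h : p.writesArr .nat a = false) :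
    (p.den N σ).natArr a = σ.natArr a := arr_den N σ p .nat a h
theorem realArr_den {p : Stmt} {a : ℕ} (h : p.writesArr .real a = false) :
    (p.den N σ).realArr a = σ.realArr a := arr_den N σ p .real a h

/-- An invariant of a counting loop. -/
theorem forAll_inv {x : ℕ} {p : Stmt} (hx : p.writesVar .nat x = false) {I : ℕ → Store → Prop}
    (h0 : I 0 (σ.setNat x 0))
    (hs : ∀ i τ, i < N → τ.natVar x = i → I i τ → I (i + 1) ((p.den N τ).setNat x (i + 1))) :
    I N ((forAll x p).den N σ) := by
  have : ∀ j ≤ N, I j (((seq p (set x (.add (.var x) (.const 1)))).den N)^[j] (σ.setNat x 0)) ∧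
      (((seq p (set x (.add (.var x) (.const 1)))).den N)^[j] (σ.setNat x 0)).natVar x = j := by
    intro j
    induction j with
    | zero => exact fun _ => ⟨h0, by simp [natVar_setNat]⟩
    | succ j ih =>
      intro hj
      obtain ⟨h1, h2⟩ := ih (by omega)
      rw [Function.iterate_succ_apply']
      have h3 := hs j _ hj h2 h1
      rw [den_seq, den_set_nat, Ex.eval_add, Ex.eval_var, Ex.eval_const, natVar_den N _ hx, h2]
      exact ⟨h3, by simp [natVar_setNat]⟩
  exact (this N le_rfl).1

end Stmt

attribute [simp] Ex.eval_ite Ex.eval_bound Ex.eval_const Ex.eval_var Ex.eval_rvar Ex.eval_cast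
  Ex.eval_add Ex.eval_sub Ex.eval_read Ex.eval_rread Ex.eval_radd Ex.eval_rsub Ex.eval_rmul
  Ex.eval_rdiv Ex.holds_const Ex.holds_var Ex.holds_read Ex.holds_and Ex.holds_or Ex.holds_not
  Ex.holds_le Ex.holds_lt Ex.holds_eq Ex.holds_rle Ex.holds_rlt Ex.eval_sum Ex.eval_rsum
  Ex.holds_ex Ex.holds_all natVar_setNat realVar_setNat natArr_setNat realArr_setNat
  natVar_setReal realVar_setReal natArr_setReal realArr_setReal natVar_putArr realVar_putArr
  natArr_putArr realArr_putArr natArr_putArr_real realArr_putArr_nat Stmt.den_set_nat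
  Stmt.den_set_real Stmt.den_fill_nat Stmt.den_fill_real Stmt.den_seq Stmt.den_ite Stmt.den_skip

/-! ### The minimum cut program

Real array 1 holds the capacities, variables 2 and 3 the source and the sink. Real arrays 2 and 3
hold the residual capacities and the excesses, array 1 the labels. The source side of the cut is
written to array 2. -/

/-- Variables `10`, `11` and `12` are the bound variables of fills and folds. Vectors are kept in
arrays of which only column `0` is read. -/
def flowInit : Stmt :=
  .seq (.fill (t := .real) 2 10 11 (.rread 1 (.var 10) (.var 11))) <|
  .seq (.fill (t := .real) 3 10 11 (.ite (.eq (.var 10) (.var 2))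
    (.radd (.rsum 12 (.rread 1 (.var 2) (.var 12))) (.cast (.const 1))) (.cast (.const 0)))) <|
  .fill (t := .nat) 1 10 11 (.const 0)

def pushStmt : Stmt :=
  .seq (.set (t := .real) 2 (.ite (.rle (.rread 3 (.var 4) (.const 0)) (.rread 2 (.var 4) (.var 5)))
    (.rread 3 (.var 4) (.const 0)) (.rread 2 (.var 4) (.var 5)))) <|
  .seq (.fill (t := .real) 2 10 11 (.rsub (.radd (.rread 2 (.var 10) (.var 11))
    (.ite (.and (.eq (.var 10) (.var 5)) (.eq (.var 11) (.var 4))) (.rvar 2) (.cast (.const 0))))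
    (.ite (.and (.eq (.var 10) (.var 4)) (.eq (.var 11) (.var 5))) (.rvar 2) (.cast (.const 0))))) <|
  .fill (t := .real) 3 10 11 (.rsub (.radd (.rread 3 (.var 10) (.const 0))
    (.ite (.eq (.var 10) (.var 5)) (.rvar 2) (.cast (.const 0))))
    (.ite (.eq (.var 10) (.var 4)) (.rvar 2) (.cast (.const 0))))

def relabelStmt : Stmt :=
  .fill (t := .nat) 1 10 11 (.ite (.eq (.var 10) (.var 4))
    (.add (.read 1 (.var 10) (.const 0)) (.const 1)) (.read 1 (.var 10) (.const 0)))

def overflowEx : Ex .nat :=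
  .and (.rlt (.cast (.const 0)) (.rread 3 (.var 10) (.const 0))) <|
    .and (.not (.eq (.var 10) (.var 3))) (.lt (.read 1 (.var 10) (.const 0)) .bound)

def admissibleEx : Ex .nat :=
  .and (.rlt (.cast (.const 0)) (.rread 2 (.var 4) (.var 10)))
    (.eq (.read 1 (.var 4) (.const 0)) (.add (.read 1 (.var 10) (.const 0)) (.const 1)))

def flowStep : Stmt :=
  .seq (.set (t := .nat) 4 (.find 10 overflowEx)) <|
  .ite (.lt (.var 4) .bound)
    (.seq (.set (t := .nat) 5 (.find 10 admissibleEx)) <|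
      .ite (.lt (.var 5) .bound) pushStmt relabelStmt)
    .skip

def flowCut : Stmt :=
  .seq (.set (t := .nat) 6 (.find 10 (.all 11 (.not (.eq (.read 1 (.var 11) (.const 0))
    (.var 10)))))) <|
  .fill (t := .nat) 2 10 11 (.ite (.lt (.var 6) (.read 1 (.var 10) (.const 0)))
    (.const 1) (.const 0))

/-- The measure starts at no more than `(N² + 1)³`, and this is at most `N⁹` for `N ≥ 2`. -/
def minCut : Stmt := .seq flowInit (.seq (.reps 9 flowStep) flowCut)

section

variable (N : ℕ) (c : ℕ → ℕ → ℝ) (s t : ℕ)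

/-- The preflow invariant for the data in a state. -/
def FlowInv (σ : Store) : Prop :=
  Preflow N c s t (σ.realArr 2) (fun x => σ.realArr 3 x 0) (fun x => σ.natArr 1 x 0) ∧
    σ.natVar 3 = t

def FlowDone (σ : Store) : Prop :=
  ∀ v < N, ¬ Overflows N t (fun x => σ.realArr 3 x 0) (fun x => σ.natArr 1 x 0) v

variable {N c s t}

theorem flowInit_spec {σ : Store} (hN : 0 < N) (hc : ∀ u < N, ∀ v < N, 0 ≤ σ.realArr 1 u v)
    (hs : σ.natVar 2 < N) (ht : σ.natVar 3 < N) :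
    FlowInv N (σ.realArr 1) (σ.natVar 2) (σ.natVar 3) (flowInit.den N σ) := by
  refine ⟨Preflow.init hc ?_ ?_ ?_ hs ht, ?_⟩
  · intro u hu v hv
    simp [flowInit, hu, hv]
  · intro u hu
    simp [flowInit, hu, hN]
  · intro u hu
    simp [flowInit, hu, hN]
  · simp [flowInit]

theorem holds_overflowEx (σ : Store) (v : ℕ) (ht : σ.natVar 3 = t) :
    overflowEx.Holds N (σ.setNat 10 v) ↔
      Overflows N t (fun x => σ.realArr 3 x 0) (fun x => σ.natArr 1 x 0) v := by
  simp [overflowEx, Overflows, ht]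

theorem holds_admissibleEx (σ : Store) (v : ℕ) :
    admissibleEx.Holds N (σ.setNat 10 v) ↔ 0 < σ.realArr 2 (σ.natVar 4) v ∧
      σ.natArr 1 (σ.natVar 4) 0 = σ.natArr 1 v 0 + 1 := by
  simp [admissibleEx]

theorem flowStep_spec {σ : Store} (ht : t < N) (h : FlowInv N c s t σ) :
    FlowInv N c s t (flowStep.den N σ) ∧
    (FlowDone N t σ → FlowDone N t (flowStep.den N σ)) ∧
    (¬ FlowDone N t σ → flowMeasure N t ((flowStep.den N σ).realArr 2)
        (fun x => (flowStep.den N σ).realArr 3 x 0) (fun x => (flowStep.den N σ).natArr 1 x 0) <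
      flowMeasure N t (σ.realArr 2) (fun x => σ.realArr 3 x 0) (fun x => σ.natArr 1 x 0)) := by
  obtain ⟨hf, h3⟩ := h
  have hN : 0 < N := by omega
  rw [flowStep, Stmt.den_seq, Stmt.den_set_nat]
  rcases Ex.find_spec N σ 10 overflowEx with ⟨hv, hact⟩ | ⟨hv, hno⟩
  swap
  · have hdone : FlowDone N t σ := fun v hvN ho => hno v hvN ((holds_overflowEx σ v h3).2 ho)
    simp only [Stmt.den_ite, Ex.holds_lt, Ex.eval_var, natVar_setNat, if_true, hv, Ex.eval_bound,
      lt_irrefl, if_false, Stmt.den_skip]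
    refine ⟨⟨hf, by simpa using h3⟩, fun _ => hdone, fun hn => absurd hdone hn⟩
  rw [holds_overflowEx σ _ h3] at hact
  set v : ℕ := (Ex.find 10 overflowEx).eval N σ
  have hnd : ¬ FlowDone N t σ := fun hd => hd v hv hact
  set σ1 := σ.setNat 4 v with hσ1
  have e4 : σ1.natVar 4 = v := by simp [hσ1]
  simp only [Stmt.den_ite, Ex.holds_lt, Ex.eval_var, e4, Ex.eval_bound, hv, if_true,
    Stmt.den_seq, Stmt.den_set_nat]
  rcases Ex.find_spec N σ1 10 admissibleEx with ⟨hw, hadm⟩ | ⟨hw, hno⟩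
  · rw [holds_admissibleEx, e4] at hadm
    set w : ℕ := (Ex.find 10 admissibleEx).eval N σ1
    simp only [natVar_setNat, if_true, hw]
    obtain ⟨hpos, hvw⟩ := hadm
    set δ : ℝ := if σ.realArr 3 v 0 ≤ σ.realArr 2 v w then σ.realArr 3 v 0 else σ.realArr 2 v w
      with hδ
    have d0 : 0 ≤ δ := by
      rw [hδ]; split_ifs
      · exact hact.1.le
      · exact hpos.le
    have d1 : δ ≤ σ.realArr 3 v 0 := by
      rw [hδ]; split_ifs with hh
      · exact le_rfl
      · exact (not_le.1 hh).le
    have d2 : δ ≤ σ.realArr 2 v w := by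
      rw [hδ]; split_ifs with hh
      · exact hh
      · exact le_rfl
    have d3 : δ = σ.realArr 3 v 0 ∨ δ = σ.realArr 2 v w := by
      rw [hδ]; split_ifs <;> simp
    have hr : ∀ a < N, ∀ b < N, (pushStmt.den N (σ1.setNat 5 w)).realArr 2 a b = σ.realArr 2 a b +
        (if a = w ∧ b = v then δ else 0) - (if a = v ∧ b = w then δ else 0) := by
      intro a ha b hb
      simp [pushStmt, ha, hb, hδ, hσ1]
    have he : ∀ a < N, (pushStmt.den N (σ1.setNat 5 w)).realArr 3 a 0 = σ.realArr 3 a 0 +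
        (if a = w then δ else 0) - (if a = v then δ else 0) := by
      intro a ha
      simp [pushStmt, ha, hN, hδ, hσ1]
    have hh : (pushStmt.den N (σ1.setNat 5 w)).natArr 1 = σ.natArr 1 := by
      simp [pushStmt, hσ1]
    have ht' : (pushStmt.den N (σ1.setNat 5 w)).natVar 3 = t := by
      simp [pushStmt, hσ1, h3]
    refine ⟨⟨?_, ht'⟩, fun hd => absurd hd hnd, fun _ => ?_⟩
    · rw [hh]
      exact hf.push hv hw hvw d0 d1 d2 hr he
    · rw [hh]
      exact flowMeasure_push hact hv hw hpos hvw d0 d3 hr he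
  · simp only [natVar_setNat, if_true, hw, lt_irrefl, if_false]
    have hh : ∀ a < N, (relabelStmt.den N (σ1.setNat 5 N)).natArr 1 a 0 =
        if a = v then σ.natArr 1 a 0 + 1 else σ.natArr 1 a 0 := by
      intro a ha
      simp [relabelStmt, ha, hN, hσ1]
    have hr : (relabelStmt.den N (σ1.setNat 5 N)).realArr = σ.realArr := by
      simp [relabelStmt, hσ1]
    have ht' : (relabelStmt.den N (σ1.setNat 5 N)).natVar 3 = t := by
      simp [relabelStmt, hσ1, h3]
    refine ⟨⟨?_, ht'⟩, fun hd => absurd hd hnd, fun _ => ?_⟩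
    · rw [hr]
      refine hf.relabel hact ?_ hv hh ht
      intro w hwN hcon
      refine hno w hwN ?_
      rw [holds_admissibleEx, e4]
      exact hcon
    · rw [hr]
      exact flowMeasure_relabel hact hv hh

theorem flowCut_spec {σ : Store} (hs : s < N) (ht : t < N) (hst : s ≠ t) (h : FlowInv N c s t σ)
    (hd : FlowDone N t σ) : IsMinCut N c s t ((Finset.range N).filter
      (fun v => 1 ≤ (flowCut.den N σ).natArr 2 v 0)) := by
  have hN : 0 < N := by omega
  obtain ⟨l, hl, hgap⟩ : ∃ l < N, (∀ v < N, σ.natArr 1 v 0 ≠ l) ∧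
      (Ex.find 10 (.all 11 (.not (.eq (.read 1 (.var 11) (.const 0)) (.var 10))))).eval N σ = l := by
    rcases Ex.find_spec N σ 10 (.all 11 (.not (.eq (.read 1 (.var 11) (.const 0)) (.var 10)))) with
      ⟨h1, h2⟩ | ⟨-, h2⟩
    · exact ⟨_, h1, by simpa using h2, rfl⟩
    · obtain ⟨l, hl, hg⟩ := h.1.exists_gap hs hst hd
      exact absurd (by simpa using hg) (h2 l hl)
  have := h.1.isMinCut hs ht hst hd hl hgap.1
  convert this using 1
  refine Finset.filter_congr fun v hv => ?_
  rw [Finset.mem_range] at hv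
  simp only [flowCut, Stmt.den_seq, Stmt.den_set_nat, hgap.2]
  simp only [Stmt.den_fill_nat, natArr_putArr, if_true, hv, hN, and_self, Ex.eval_ite,
    Ex.holds_lt, Ex.eval_var, Ex.eval_read, Ex.eval_const, natVar_setNat, natArr_setNat]
  norm_num
  split_ifs <;> simp_all

theorem minCut_spec {σ : Store} (hc : ∀ u < N, ∀ v < N, 0 ≤ σ.realArr 1 u v)
    (hs : σ.natVar 2 < N) (ht : σ.natVar 3 < N) (hst : σ.natVar 2 ≠ σ.natVar 3) :
    IsMinCut N (σ.realArr 1) (σ.natVar 2) (σ.natVar 3) ((Finset.range N).filter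
      (fun v => 1 ≤ (minCut.den N σ).natArr 2 v 0)) := by
  have hN : 2 ≤ N := by omega
  have h1 := flowInit_spec (by omega) hc hs ht
  have hbound : (N * N + 1) ^ 3 ≤ N ^ 9 := by
    rw [show 9 = 3 * 3 by rfl, pow_mul]
    exact Nat.pow_le_pow_left (by nlinarith [Nat.mul_le_mul hN (Nat.mul_le_mul hN hN)]) 3
  obtain ⟨h2, h3⟩ := iterate_done (f := flowStep.den N)
    (I := FlowInv N (σ.realArr 1) (σ.natVar 2) (σ.natVar 3)) (D := FlowDone N (σ.natVar 3))
    (fun τ => flowMeasure N (σ.natVar 3) (τ.realArr 2) (fun x => τ.realArr 3 x 0)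
      (fun x => τ.natArr 1 x 0)) (fun x hx => (flowStep_spec ht hx).1)
    (fun x hx => (flowStep_spec ht hx).2.1) (fun x hx => (flowStep_spec ht hx).2.2) (N ^ 9)
    _ h1 (flowMeasure_le.trans hbound)
  rw [minCut, Stmt.den_seq, Stmt.den_seq, Stmt.den_reps]
  exact flowCut_spec hs ht hst h2 h3

end

/-! ### Vertex sets in a state -/

/-- The vertex set that is stored in an array. -/
def msk (n : ℕ) (A : ℕ → ℕ → ℕ) : Finset (Fin n) := Finset.univ.filter (fun v => 1 ≤ A v 0)

theorem mem_msk {n : ℕ} {A : ℕ → ℕ → ℕ} {v : Fin n} : v ∈ msk n A ↔ 1 ≤ A v 0 := by simp [msk]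

/-- The state holds the number of vertices and the weights of `G`. -/
structure Ctx {n : ℕ} (G : WeightedGraph (Fin n)) (σ : Store) : Prop where
  n_eq : σ.natVar 0 = n
  mat : ∀ u v : Fin n, σ.realArr 0 u v = G.mat u v

namespace Ex

/-- Folds range over all indices below `N`; this guard restricts them to the vertices, the indices
below `n`. -/
def isV (x : ℕ) : Ex .nat := .lt (.var x) (.var 0)
def exV (x : ℕ) (b : Ex .nat) : Ex .nat := .ex x (.and (.isV x) b)
def allV (x : ℕ) (b : Ex .nat) : Ex .nat := .not (.exV x (.not b))
def countV (x : ℕ) (b : Ex .nat) : Ex .nat :=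
  .sum x (.ite (.and (.isV x) b) (.const 1) (.const 0))
def sumV (x : ℕ) (b : Ex .nat) (e : Ex .real) : Ex .real :=
  .rsum x (.ite (.and (.isV x) b) e (.cast (.const 0)))
/-- The vertex in the variable `x` belongs to the set in the array `a`. -/
def mem (a x : ℕ) : Ex .nat := .read a (.var x) (.const 0)
def zero : Ex .real := .cast (.const 0)
def wt (x y : ℕ) : Ex .real := .rread 0 (.var x) (.var y)
def adj (x y : ℕ) : Ex .nat := .rlt .zero (.wt x y)
def card (a : ℕ) : Ex .nat := .countV 10 (.mem a 10)
-- The double sum meets every edge in both orders, hence the division by `2`.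
def weight (a : ℕ) : Ex .real :=
  .rdiv (.sumV 10 (.mem a 10) (.sumV 11 (.mem a 11) (.wt 10 11))) (.const 2)
def dens (a : ℕ) : Ex .real := .rdiv (.weight a) (.card a)
def clique (a : ℕ) : Ex .nat :=
  .allV 10 (.allV 11 (.or (.not (.and (.mem a 10) (.mem a 11))) (.or (.eq (.var 10) (.var 11))
    (.adj 10 11))))

variable {n N : ℕ} {σ : Store}

theorem sum_range_fin {M : Type*} [AddCommMonoid M] (hN : n ≤ N) (P : ℕ → Prop) [DecidablePred P]
    (f : ℕ → M) : ∑ i ∈ Finset.range N, (if i < n ∧ P i then f i else 0) =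
      ∑ v ∈ Finset.univ.filter (fun v : Fin n => P v), f v := by
  rw [Finset.sum_filter, Fin.sum_univ_eq_sum_range (fun i => if P i then f i else 0) n]
  refine (Finset.sum_subset (Finset.range_subset_range.2 hN) ?_).symm.trans ?_
  · intro i hi hin
    rw [Finset.mem_range] at hin
    rw [if_neg (fun h => hin h.1)]
  · refine Finset.sum_congr rfl fun i hi => ?_
    rw [Finset.mem_range] at hi
    simp [hi]

variable (hN : n ≤ N) (hn : σ.natVar 0 = n) {x : ℕ} (hx : x ≠ 0)

include hN hn hx

theorem holds_exV (b : Ex .nat) :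
    (exV x b).Holds N σ ↔ ∃ v : Fin n, b.Holds N (σ.setNat x v) := by
  simp only [exV, isV, holds_ex, holds_and, holds_lt, eval_var, natVar_setNat, if_true,
    if_neg hx.symm, hn]
  exact ⟨fun ⟨i, _, hi, h⟩ => ⟨⟨i, hi⟩, h⟩, fun ⟨v, h⟩ => ⟨v, v.2.trans_le hN, v.2, h⟩⟩

theorem holds_allV (b : Ex .nat) :
    (allV x b).Holds N σ ↔ ∀ v : Fin n, b.Holds N (σ.setNat x v) := by
  rw [allV, holds_not, holds_exV hN hn hx]
  simp

theorem eval_countV (b : Ex .nat) : (countV x b).eval N σ =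
    (Finset.univ.filter (fun v : Fin n => b.Holds N (σ.setNat x v))).card := by
  rw [Finset.card_eq_sum_ones]
  have := sum_range_fin hN (fun i => b.Holds N (σ.setNat x i)) (fun _ => (1 : ℕ))
  rw [← this, countV, eval_sum]
  refine Finset.sum_congr rfl fun i _ => ?_
  simp only [isV, eval_ite, holds_and, holds_lt, eval_var, natVar_setNat, if_true,
    if_neg hx.symm, hn, eval_const]

theorem eval_sumV (b : Ex .nat) (e : Ex .real) : (sumV x b e).eval N σ =
    ∑ v ∈ Finset.univ.filter (fun v : Fin n => b.Holds N (σ.setNat x v)),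
      (e.eval N (σ.setNat x v) : ℝ) := by
  have := sum_range_fin hN (fun i => b.Holds N (σ.setNat x i))
    (fun i => (e.eval N (σ.setNat x i) : ℝ))
  rw [← this, sumV, eval_rsum]
  refine Finset.sum_congr rfl fun i _ => ?_
  simp only [isV, eval_ite, holds_and, holds_lt, eval_var, natVar_setNat, if_true,
    if_neg hx.symm, hn, eval_const, eval_cast, Nat.cast_zero]

end Ex

theorem filter_msk {n : ℕ} (A : ℕ → ℕ → ℕ) (p : Fin n → Prop) [DecidablePred p]
    (h : ∀ v, p v ↔ 1 ≤ A v 0) : Finset.univ.filter p = msk n A := by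
  ext v; simp [h, msk]

section

variable {n N : ℕ} {G : WeightedGraph (Fin n)} {σ : Store}

theorem Ctx.setNat (h : Ctx G σ) {x v : ℕ} (hx : x ≠ 0) : Ctx G (σ.setNat x v) :=
  ⟨by simp [h.n_eq, hx.symm], h.mat⟩

theorem Ctx.den (h : Ctx G σ) {p : Stmt} (h1 : p.writesVar .nat 0 = false)
    (h2 : p.writesArr .real 0 = false) : Ctx G (p.den N σ) :=
  ⟨(Stmt.natVar_den N σ h1).trans h.n_eq, fun u v => by rw [Stmt.realArr_den N σ h2, h.mat]⟩

theorem Ctx.adj (h : Ctx G σ) {x y : ℕ} {u v : Fin n} (hu : σ.natVar x = u) (hv : σ.natVar y = v) :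
    (Ex.adj x y).Holds N σ ↔ G.graph.Adj u v := by
  simp [Ex.adj, Ex.zero, Ex.wt, hu, hv, h.mat, mat_pos_iff]

theorem Ex.holds_mem {a x : ℕ} {v : Fin n} (hv : σ.natVar x = v) :
    (Ex.mem a x).Holds N σ ↔ v ∈ msk n (σ.natArr a) := by
  rw [mem_msk, Ex.mem, Ex.holds_read, Ex.eval_var, hv]
  rfl

theorem Ctx.card (h : Ctx G σ) (hN : n ≤ N) (a : ℕ) :
    (Ex.card a).eval N σ = (msk n (σ.natArr a)).card := by
  rw [Ex.card, Ex.eval_countV hN h.n_eq (by decide)]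
  congr 1

theorem Ctx.weight (h : Ctx G σ) (hN : n ≤ N) (a : ℕ) :
    (Ex.weight a).eval N σ = G.weightIn (msk n (σ.natArr a)) := by
  have h2 := two_weightIn G (msk n (σ.natArr a))
  have : ((Ex.sumV 10 (.mem a 10) (.sumV 11 (.mem a 11) (.wt 10 11))).eval N σ : ℝ) =
      2 * G.weightIn (msk n (σ.natArr a)) := by
    rw [h2, Ex.eval_sumV hN h.n_eq (by decide)]
    rw [filter_msk (σ.natArr a) _ fun v => by rw [Ex.holds_mem (v := v) (by simp), mem_msk]; rfl]
    refine Finset.sum_congr rfl fun u _ => ?_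
    rw [Ex.eval_sumV (n := n) hN (by simp [h.n_eq]) (by decide)]
    rw [filter_msk (σ.natArr a) _ fun v => by rw [Ex.holds_mem (v := v) (by simp), mem_msk]; rfl]
    refine Finset.sum_congr rfl fun v _ => ?_
    simp [Ex.wt, h.mat]
  rw [Ex.weight, Ex.eval_rdiv, this, Ex.eval_const]
  norm_num

theorem Ctx.dens (h : Ctx G σ) (hN : n ≤ N) (a : ℕ) :
    (Ex.dens a).eval N σ = G.density (msk n (σ.natArr a)) := by
  rw [Ex.dens, Ex.eval_rdiv, h.weight hN, h.card hN]
  rfl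

theorem Ctx.clique (h : Ctx G σ) (hN : n ≤ N) (a : ℕ) :
    (Ex.clique a).Holds N σ ↔ G.graph.IsClique (msk n (σ.natArr a) : Set (Fin n)) := by
  rw [Ex.clique, Ex.holds_allV hN h.n_eq (by decide)]
  have key : ∀ u v : Fin n, ((Ex.or (.not (.and (.mem a 10) (.mem a 11))) (.or
      (.eq (.var 10) (.var 11)) (.adj 10 11))).Holds N ((σ.setNat 10 u).setNat 11 v)) ↔
      (u ∈ msk n (σ.natArr a) → v ∈ msk n (σ.natArr a) → u ≠ v → G.graph.Adj u v) := by
    intro u v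
    rw [Ex.holds_or, Ex.holds_or, Ex.holds_not, Ex.holds_and, Ex.holds_mem (v := u) (by simp),
      Ex.holds_mem (v := v) (by simp), Ex.holds_eq,
      ((h.setNat (by decide)).setNat (by decide)).adj (u := u) (v := v) (by simp) (by simp)]
    simp only [natArr_setNat, Ex.eval_var, natVar_setNat]
    norm_num [Fin.val_inj]
    tauto
  constructor
  · intro hall u hu v hv huv
    have := hall u
    rw [Ex.holds_allV (n := n) hN (by simp [h.n_eq]) (by decide)] at this
    exact (key u v).1 (this v) hu hv huv
  · intro hcl u
    rw [Ex.holds_allV (n := n) hN (by simp [h.n_eq]) (by decide)]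
    exact fun v => (key u v).2 fun hu hv huv => hcl hu hv huv

end

/-- Sets the set in the array `a` to the vertices `10` with the given property. -/
def Stmt.setM (a : ℕ) (e : Ex .nat) : Stmt := .fill (t := .nat) a 10 11 (.ite e (.const 1) (.const 0))

def Stmt.copyM (a b : ℕ) : Stmt := .setM a (.mem b 10)

section

variable {n N : ℕ} {σ : Store}

theorem mem_setM (hN : n ≤ N) (a : ℕ) (e : Ex .nat) (v : Fin n) :
    v ∈ msk n (((Stmt.setM a e).den N σ).natArr a) ↔ e.Holds N ((σ.setNat 10 v).setNat 11 0) := by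
  have h1 : (v : ℕ) < N := v.2.trans_le hN
  have h2 : 0 < N := by omega
  rw [mem_msk, Stmt.setM, Stmt.den_fill_nat, natArr_putArr, if_pos rfl, if_pos ⟨h1, h2⟩,
    Ex.eval_ite]
  split_ifs with h <;> simp [h]

theorem msk_copyM (hN : n ≤ N) (a b : ℕ) :
    msk n (((Stmt.copyM a b).den N σ).natArr a) = msk n (σ.natArr b) := by
  ext v
  rw [Stmt.copyM, mem_setM hN, Ex.holds_mem (v := v) (by simp)]
  simp

theorem natArr_setM (a : ℕ) (e : Ex .nat) {b : ℕ} (h : b ≠ a) :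
    ((Stmt.setM a e).den N σ).natArr b = σ.natArr b := by
  rw [Stmt.setM, Stmt.den_fill_nat, natArr_putArr, if_neg h]

end

/-! ### Components

The component of the vertex in variable 7 in the set in array 3 is written to array 4. -/

def reachStep : Stmt :=
  .setM 4 (.or (.mem 4 10) (.and (.mem 3 10) (.exV 12 (.and (.mem 4 12) (.adj 12 10)))))

def reach : Stmt := .seq (.setM 4 (.eq (.var 10) (.var 7))) (.rep reachStep)

/-- The least closed set around `v` is connected: a closed part that misses `v` would leave a
complement that is closed, contains `v` and is smaller. -/
theorem isComponent_of_closed {V : Type*} [DecidableEq V] {G : WeightedGraph V} {U A : Finset V}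
    {v : V} (hA : A ⊆ U) (hc : G.Closed U A) (hv : v ∈ A)
    (hmin : ∀ B ⊆ U, v ∈ B → G.Closed U B → A ⊆ B) : G.IsComponent U A := by
  have key : ∀ B ⊆ A, G.Closed A B → v ∈ B → A ⊆ B := fun B hB hcl hvB =>
    hmin B (hB.trans hA) hvB fun x hx y hy hxy => hcl x hx y (hc x (hB hx) y hy hxy) hxy
  refine (isComponent_iff G U A).2 ⟨hA, hc, ⟨v, hv⟩, fun B hB ⟨b, hb⟩ hcl => ?_⟩
  by_cases hvB : v ∈ B
  · exact key B hB hcl hvB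
  · have := key (A \ B) Finset.sdiff_subset (closed_compl G hcl) (by simp [hv, hvB]) (hB hb)
    exact absurd hb (Finset.mem_sdiff.1 this).2

section

variable {n N : ℕ} {G : WeightedGraph (Fin n)} {σ : Store}

theorem mem_reachStep (hσ : Ctx G σ) (hN : n ≤ N) (v : Fin n) :
    v ∈ msk n ((reachStep.den N σ).natArr 4) ↔ v ∈ msk n (σ.natArr 4) ∨
      v ∈ msk n (σ.natArr 3) ∧ ∃ u ∈ msk n (σ.natArr 4), G.graph.Adj u v := by
  rw [reachStep, mem_setM hN, Ex.holds_or, Ex.holds_and, Ex.holds_mem (v := v) (by simp),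
    Ex.holds_mem (v := v) (by simp), Ex.holds_exV (n := n) hN (by simp [hσ.n_eq]) (by decide)]
  refine or_congr Iff.rfl (and_congr Iff.rfl (exists_congr fun u => ?_))
  rw [Ex.holds_and, Ex.holds_mem (v := u) (by simp),
    (((hσ.setNat (by decide)).setNat (by decide)).setNat (by decide)).adj (u := u) (v := v)
      (by simp) (by simp)]
  rfl

/-- Each round that changes anything adds a vertex, so `N ≥ n` rounds reach a closed set. Minimality
persists since a closed set around `v` absorbs every vertex that is added. -/
theorem reach_spec (hσ : Ctx G σ) (hN : n ≤ N) {v : Fin n} (hv : σ.natVar 7 = v)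
    (hvU : v ∈ msk n (σ.natArr 3)) :
    G.IsComponent (msk n (σ.natArr 3)) (msk n ((reach.den N σ).natArr 4)) ∧
      v ∈ msk n ((reach.den N σ).natArr 4) := by
  set U := msk n (σ.natArr 3)
  rw [reach, Stmt.den_seq, Stmt.den_rep]
  set σ0 := (Stmt.setM 4 (.eq (.var 10) (.var 7))).den N σ
  have h0 : ∀ u : Fin n, u ∈ msk n (σ0.natArr 4) ↔ u = v := by
    intro u
    rw [mem_setM hN]
    simp [hv, Fin.val_inj]
  let I : Store → Prop := fun τ => Ctx G τ ∧ msk n (τ.natArr 3) = U ∧ msk n (τ.natArr 4) ⊆ U ∧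
    v ∈ msk n (τ.natArr 4) ∧ ∀ B ⊆ U, v ∈ B → G.Closed U B → msk n (τ.natArr 4) ⊆ B
  have hI0 : I σ0 := by
    refine ⟨hσ.den rfl rfl, ?_, ?_, (h0 v).2 rfl, ?_⟩
    · rw [natArr_setM _ _ (by decide)]
    · intro u hu; rwa [(h0 u).1 hu]
    · intro B _ hvB _ u hu; rwa [(h0 u).1 hu]
  have hfin := iterate_done (f := reachStep.den N) (I := I)
    (D := fun τ => G.Closed U (msk n (τ.natArr 4))) (fun τ => n - (msk n (τ.natArr 4)).card)
    ?_ ?_ ?_ N σ0 hI0 (by omega)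
  · obtain ⟨⟨-, -, h3, h4, h5⟩, h6⟩ := hfin
    exact ⟨isComponent_of_closed h3 h6 h4 h5, h4⟩
  · rintro τ ⟨h1, h2, h3, h4, h5⟩
    refine ⟨h1.den rfl rfl, ?_, ?_, ?_, ?_⟩
    · rw [reachStep, natArr_setM _ _ (by decide), h2]
    · intro u hu
      rcases (mem_reachStep h1 hN u).1 hu with h | h
      · exact h3 h
      · rw [← h2]; exact h.1
    · exact (mem_reachStep h1 hN v).2 (Or.inl h4)
    · intro B hB hvB hcl u hu
      rcases (mem_reachStep h1 hN u).1 hu with h | ⟨h, w, hw, hwu⟩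
      · exact h5 B hB hvB hcl h
      · exact hcl w (h5 B hB hvB hcl hw) u (h2 ▸ h) hwu
  · rintro τ ⟨h1, h2, h3, h4, h5⟩ hD
    have : msk n ((reachStep.den N τ).natArr 4) = msk n (τ.natArr 4) := by
      ext u
      rw [mem_reachStep h1 hN]
      refine ⟨?_, Or.inl⟩
      rintro (h | ⟨h, w, hw, hwu⟩)
      · exact h
      · exact hD w hw u (h2 ▸ h) hwu
    simp only [this]
    exact hD
  · rintro τ ⟨h1, h2, h3, h4, h5⟩ hD
    have hsub : msk n (τ.natArr 4) ⊂ msk n ((reachStep.den N τ).natArr 4) := by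
      simp only [WeightedGraph.Closed] at hD
      push Not at hD
      obtain ⟨a, ha, b, hb, hab, hbn⟩ := hD
      refine Finset.ssubset_iff_subset_ne.2 ⟨fun u hu => (mem_reachStep h1 hN u).2 (Or.inl hu), ?_⟩
      intro heq
      rw [heq] at hbn
      exact hbn ((mem_reachStep h1 hN b).2 (Or.inr ⟨h2 ▸ hb, a, ha, hab⟩))
    have h6 := Finset.card_lt_card hsub
    have h7 := Finset.card_le_univ (msk n ((reachStep.den N τ).natArr 4))
    rw [Fintype.card_fin] at h7
    omega

end

/-! ### Peeling

The set in array 5 is peeled with the threshold in real variable 1. -/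

/-- All vertices of degree at most the threshold are deleted at once. The result is the same core as
for one deletion at a time, because the core is unique. -/
def coreStep : Stmt :=
  .setM 5 (.and (.mem 5 10) (.rlt (.rvar 1) (.sumV 12 (.mem 5 12) (.wt 10 12))))

def corePeel : Stmt := .rep coreStep

section

variable {n N : ℕ} {G : WeightedGraph (Fin n)} {σ : Store}

theorem mem_coreStep (hσ : Ctx G σ) (hN : n ≤ N) (v : Fin n) :
    v ∈ msk n ((coreStep.den N σ).natArr 5) ↔ v ∈ msk n (σ.natArr 5) ∧
      σ.realVar 1 < G.degIn (msk n (σ.natArr 5)) v := by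
  rw [coreStep, mem_setM hN, Ex.holds_and, Ex.holds_mem (v := v) (by simp), Ex.holds_rlt,
    Ex.eval_sumV (n := n) hN (by simp [hσ.n_eq]) (by decide), degIn_eq_sum,
    filter_msk (σ.natArr 5) _ fun v => by rw [Ex.holds_mem (v := v) (by simp), mem_msk]; rfl]
  refine and_congr Iff.rfl ?_
  have : ∀ u : Fin n, ((Ex.wt 10 12).eval N (((σ.setNat 10 v).setNat 11 0).setNat 12 u) : ℝ) =
      G.mat v u := by
    intro u
    simp [Ex.wt, hσ.mat]
  simp only [this]
  rfl

theorem core_spec (hσ : Ctx G σ) (hN : n ≤ N) :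
    G.IsCore (σ.realVar 1) (msk n (σ.natArr 5)) (msk n ((corePeel.den N σ).natArr 5)) := by
  set P := msk n (σ.natArr 5)
  set d := σ.realVar 1 with hd
  rw [corePeel, Stmt.den_rep]
  let I : Store → Prop := fun τ => Ctx G τ ∧ τ.realVar 1 = d ∧ msk n (τ.natArr 5) ⊆ P ∧
    ∀ T ⊆ P, (∀ v ∈ T, d < G.degIn T v) → T ⊆ msk n (τ.natArr 5)
  have hcard : (msk n (σ.natArr 5)).card ≤ N := by
    refine (Finset.card_le_univ _).trans ?_
    rwa [Fintype.card_fin]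
  obtain ⟨⟨-, -, h3, h4⟩, h5⟩ := iterate_done (f := coreStep.den N) (I := I)
    (D := fun τ => ∀ v ∈ msk n (τ.natArr 5), d < G.degIn (msk n (τ.natArr 5)) v)
    (fun τ => (msk n (τ.natArr 5)).card) (by
      rintro τ ⟨h1, h2, h3, h4⟩
      refine ⟨h1.den rfl rfl, (Stmt.realVar_den N τ rfl).trans h2, ?_, ?_⟩
      · exact fun v hv => h3 ((mem_coreStep h1 hN v).1 hv).1
      · intro T hT hdeg v hv
        refine (mem_coreStep h1 hN v).2 ⟨h4 T hT hdeg hv, ?_⟩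
        rw [h2]
        exact (hdeg v hv).trans_le (degIn_mono G (h4 T hT hdeg) v)) (by
      rintro τ ⟨h1, h2, h3, h4⟩ hD
      have : msk n ((coreStep.den N τ).natArr 5) = msk n (τ.natArr 5) := by
        ext v
        rw [mem_coreStep h1 hN, h2]
        exact ⟨fun h => h.1, fun h => ⟨h, hD v h⟩⟩
      simp only [this]
      exact hD) (by
      rintro τ ⟨h1, h2, h3, h4⟩ hD
      push Not at hD
      obtain ⟨v, hv, hdv⟩ := hD
      refine Finset.card_lt_card (Finset.ssubset_iff_subset_ne.2
        ⟨fun u hu => ((mem_coreStep h1 hN u).1 hu).1, fun heq => ?_⟩)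
      rw [← heq, mem_coreStep h1 hN, h2] at hv
      exact absurd hv.2 (not_lt.2 hdv)) N σ ⟨hσ, rfl, subset_rfl, fun T hT _ => hT⟩ hcard
  exact ⟨h3, h5, h4⟩

end

/-! ### Vertex separators from minimum cuts -/

section

variable {n : ℕ} (G : WeightedGraph (Fin n))

/-- `C` separates `s` from `t` in `G[H]`. -/
def WeightedGraph.Separates (H : Finset (Fin n)) (s t : Fin n) (C : Finset (Fin n)) : Prop :=
  C ⊆ H ∧ t ∈ H \ C ∧ ∃ A ⊆ H \ C, s ∈ A ∧ t ∉ A ∧ G.Closed (H \ C) A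

/-- `c` is the capacity function of the network in which every vertex `x` of `H` is replaced by an
arc from `x` to `n + x`. -/
structure SplitNetwork (N : ℕ) (H : Finset (Fin n)) (c : ℕ → ℕ → ℝ) : Prop where
  nonneg : ∀ u < N, ∀ v < N, 0 ≤ c u v
  inner : ∀ x ∈ H, c x (n + x) = 1
  outer : ∀ x ∈ H, ∀ y ∈ H, G.graph.Adj x y → c (n + x) y = N
  support : ∀ u < N, ∀ v < N, c u v ≠ 0 → (∃ x ∈ H, u = x ∧ v = n + x) ∨
    ∃ x ∈ H, ∃ y ∈ H, G.graph.Adj x y ∧ u = n + x ∧ v = y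

variable {G} {N : ℕ} {H : Finset (Fin n)} {c : ℕ → ℕ → ℝ} {s t : Fin n}

theorem WeightedGraph.Separates.isSeparator {C : Finset (Fin n)} (h : G.Separates H s t C) :
    G.IsSeparator H C := by
  obtain ⟨h1, h2, A, hA, hs, ht, hcl⟩ := h
  exact (isSeparator_iff G H C).2 ⟨h1, A, hA, ⟨s, hs⟩, hcl, fun hsub => ht (hsub h2)⟩

theorem exists_separates {C : Finset (Fin n)} (h : G.IsSeparator H C) :
    ∃ s t, G.Separates H s t C := by
  obtain ⟨h1, A, hA, ⟨s, hs⟩, hcl, hn⟩ := (isSeparator_iff G H C).1 h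
  obtain ⟨t, ht, htA⟩ := Finset.not_subset.1 hn
  exact ⟨s, t, h1, ht, A, hA, hs, htA, hcl⟩

theorem WeightedGraph.Separates.not_adj {C : Finset (Fin n)} (h : G.Separates H s t C) :
    s ∈ H ∧ t ∈ H ∧ s ≠ t ∧ ¬ G.graph.Adj s t := by
  obtain ⟨h1, h2, A, hA, hs, ht, hcl⟩ := h
  refine ⟨(Finset.mem_sdiff.1 (hA hs)).1, (Finset.mem_sdiff.1 h2).1, ?_, fun hadj => ?_⟩
  · rintro rfl; exact ht hs
  · exact ht (hcl s hs t h2 hadj)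

theorem separates_of_not_adj (hs : s ∈ H) (ht : t ∈ H) (hst : s ≠ t) (h : ¬ G.graph.Adj s t) :
    G.Separates H s t (H \ {s, t}) := by
  have hS : H \ (H \ {s, t}) = {s, t} := by
    ext x
    simp only [Finset.mem_sdiff, Finset.mem_insert, Finset.mem_singleton]
    constructor
    · tauto
    · rintro (rfl | rfl) <;> tauto
  rw [WeightedGraph.Separates, hS]
  refine ⟨Finset.sdiff_subset, by simp, {s}, by simp, by simp, by simpa using hst.symm, ?_⟩
  intro a ha b hb hab
  simp only [Finset.mem_singleton, Finset.mem_insert] at *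
  rcases hb with rfl | rfl
  · rfl
  · subst ha; exact absurd hab h

/-- Every separating set gives a cut of at most its size. -/
theorem SplitNetwork.cut_le (hc : SplitNetwork G N H c) (hN : n + n ≤ N) {X : Finset ℕ}
    (hX : IsMinCut N c (n + s) t X) {C : Finset (Fin n)} (hC : G.Separates H s t C) :
    cutVal N c X ≤ C.card := by
  classical
  obtain ⟨h1, h2, A, hA, hs, ht, hcl⟩ := hC
  -- The source side consists of both copies of the vertices of `A` and the entrances of the
  -- vertices of `C`; the only arcs that leave it are the inner arcs of `C`.
  let Y : Finset ℕ := A.image (fun x : Fin n => n + (x : ℕ)) ∪ (A ∪ C).image (fun x : Fin n => (x : ℕ))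
  have hY1 : ∀ x : Fin n, n + (x : ℕ) ∈ Y ↔ x ∈ A := by
    intro x
    simp only [Y, Finset.mem_union, Finset.mem_image]
    constructor
    · rintro (⟨y, hy, hyx⟩ | ⟨y, hy, hyx⟩)
      · have : y = x := Fin.ext (by omega)
        rwa [← this]
      · omega
    · exact fun h => Or.inl ⟨x, h, rfl⟩
  have hY2 : ∀ x : Fin n, (x : ℕ) ∈ Y ↔ x ∈ A ∨ x ∈ C := by
    intro x
    simp only [Y, Finset.mem_union, Finset.mem_image]
    constructor
    · rintro (⟨y, hy, hyx⟩ | ⟨y, hy, hyx⟩)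
      · omega
      · have : y = x := Fin.ext (by omega)
        rwa [← this]
    · exact fun h => Or.inr ⟨x, h, rfl⟩
  have hYN : Y ⊆ Finset.range N := by
    intro u hu
    simp only [Y, Finset.mem_union, Finset.mem_image] at hu
    rw [Finset.mem_range]
    rcases hu with ⟨y, hy, rfl⟩ | ⟨y, hy, rfl⟩ <;> omega
  refine (hX.2.2.2 Y hYN ((hY1 s).2 hs) ?_).trans ?_
  · rw [hY2]
    rintro (h | h)
    · exact ht h
    · exact (Finset.mem_sdiff.1 h2).2 h
  have hrow : ∀ u ∈ Y, ∑ v ∈ Finset.range N \ Y, c u v ≤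
      if u ∈ C.image (fun x : Fin n => (x : ℕ)) then 1 else 0 := by
    intro u hu
    have huN := Finset.mem_range.1 (hYN hu)
    have hz : ∀ v ∈ Finset.range N \ Y, c u v ≠ 0 → ∃ x ∈ C, x ∈ H ∧ u = x ∧ v = n + x := by
      intro v hv hne
      obtain ⟨hvN, hvY⟩ := Finset.mem_sdiff.1 hv
      rcases hc.support u huN v (Finset.mem_range.1 hvN) hne with ⟨x, hx, rfl, rfl⟩ |
        ⟨x, hx, y, hy, hxy, rfl, rfl⟩
      · rw [hY1] at hvY
        exact ⟨x, ((hY2 x).1 hu).resolve_left hvY, hx, rfl, rfl⟩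
      · rw [hY2, not_or] at hvY
        exact absurd (hcl x ((hY1 x).1 hu) y (Finset.mem_sdiff.2 ⟨hy, hvY.2⟩) hxy) hvY.1
    split_ifs with hmem
    · obtain ⟨x, hx, rfl⟩ := Finset.mem_image.1 hmem
      rw [← hc.inner x (h1 hx)]
      by_cases hxY : n + (x : ℕ) ∈ Y
      · rw [Finset.sum_eq_zero]
        · rw [hc.inner x (h1 hx)]; exact zero_le_one
        · intro v hv
          by_contra hne
          obtain ⟨y, -, -, h3, rfl⟩ := hz v hv hne
          rw [← h3] at hv
          exact (Finset.mem_sdiff.1 hv).2 hxY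
      · refine (Finset.sum_eq_single_of_mem (n + (x : ℕ)) ?_ ?_).le
        · exact Finset.mem_sdiff.2 ⟨Finset.mem_range.2 (by omega), hxY⟩
        · intro v hv hne
          by_contra hne'
          obtain ⟨y, -, -, h3, rfl⟩ := hz v hv hne'
          omega
    · refine (Finset.sum_eq_zero fun v hv => ?_).le
      by_contra hne
      obtain ⟨x, hx, -, rfl, -⟩ := hz v hv hne
      exact hmem (Finset.mem_image_of_mem _ hx)
  refine (Finset.sum_le_sum hrow).trans ?_
  rw [← Finset.sum_filter, Finset.sum_const, nsmul_eq_mul, mul_one]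
  refine Nat.cast_le.2 ((Finset.card_le_card ?_).trans
    (Finset.card_image_le (s := C) (f := fun x : Fin n => (x : ℕ))))
  intro u hu
  exact (Finset.mem_filter.1 hu).2

/-- The vertices that are cut form a separating set that is as small as possible. -/
theorem SplitNetwork.separates (hc : SplitNetwork G N H c) (hN : n + n < N) {X : Finset ℕ}
    (hs : s ∈ H) (ht : t ∈ H) (hst : s ≠ t) (hadj : ¬ G.graph.Adj s t)
    (hX : IsMinCut N c (n + s) t X) {C : Finset (Fin n)}
    (hC : ∀ x : Fin n, x ∈ C ↔ x ∈ H ∧ (x : ℕ) ∈ X ∧ n + (x : ℕ) ∉ X) :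
    G.Separates H s t C ∧ ∀ C', G.Separates H s t C' → C.card ≤ C'.card := by
  classical
  obtain ⟨hXN, hsX, htX, hXmin⟩ := id hX
  have hterm : ∀ u ∈ X, ∀ v ∈ Finset.range N \ X, 0 ≤ c u v := fun u hu v hv =>
    hc.nonneg u (Finset.mem_range.1 (hXN hu)) v (Finset.mem_range.1 (Finset.mem_sdiff.1 hv).1)
  -- The trivial separating set `H \ {s, t}` keeps a minimum cut below `N`, so no outer arc, of
  -- capacity `N`, can cross it.
  have hval : cutVal N c X < N := by
    refine (hc.cut_le hN.le hX (separates_of_not_adj hs ht hst hadj)).trans_lt ?_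
    have := Finset.card_le_univ (H \ {s, t})
    rw [Fintype.card_fin] at this
    exact_mod_cast (show (H \ {s, t}).card < N by omega)
  have houter : ∀ x ∈ H, ∀ y ∈ H, G.graph.Adj x y → n + (x : ℕ) ∈ X → (y : ℕ) ∈ X := by
    intro x hx y hy hxy hxX
    by_contra hyX
    have hmem : (y : ℕ) ∈ Finset.range N \ X :=
      Finset.mem_sdiff.2 ⟨Finset.mem_range.2 (by omega), hyX⟩
    have h1 := Finset.single_le_sum (f := fun v => c (n + x) v) (hterm _ hxX) hmem
    have h2 := Finset.single_le_sum (f := fun u => ∑ v ∈ Finset.range N \ X, c u v)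
      (fun u hu => Finset.sum_nonneg (hterm u hu)) hxX
    simp only [hc.outer x hx y hy hxy] at h1
    exact absurd (h1.trans h2) (not_le.2 hval)
  -- The side of `s` consists of the vertices with both copies in `X`, and of `s` itself: the source
  -- is the exit of `s`, and the position of its entrance is not prescribed.
  refine ⟨⟨fun x hx => ((hC x).1 hx).1, Finset.mem_sdiff.2 ⟨ht, fun h => htX ((hC t).1 h).2.1⟩,
    (H \ C).filter (fun x => x = s ∨ (x : ℕ) ∈ X ∧ n + (x : ℕ) ∈ X), Finset.filter_subset _ _,
    ?_, ?_, ?_⟩, fun C' hC' => ?_⟩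
  · exact Finset.mem_filter.2 ⟨Finset.mem_sdiff.2 ⟨hs, fun h => ((hC s).1 h).2.2 hsX⟩, Or.inl rfl⟩
  · intro h
    rcases (Finset.mem_filter.1 h).2 with h | h
    · exact hst h.symm
    · exact htX h.1
  · intro x hx y hy hxy
    obtain ⟨hxH, hx'⟩ := Finset.mem_filter.1 hx
    have hxX : n + (x : ℕ) ∈ X := by
      rcases hx' with rfl | h
      · exact hsX
      · exact h.2
    obtain ⟨hyH, hyC⟩ := Finset.mem_sdiff.1 hy
    have hyX := houter x (Finset.mem_sdiff.1 hxH).1 y hyH hxy hxX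
    refine Finset.mem_filter.2 ⟨hy, Or.inr ⟨hyX, ?_⟩⟩
    by_contra hcon
    exact hyC ((hC y).2 ⟨hyH, hyX, hcon⟩)
  · have h1 : (C.card : ℝ) ≤ cutVal N c X := by
      have himg : C.image (fun x : Fin n => (x : ℕ)) ⊆ X := by
        intro u hu
        obtain ⟨x, hx, rfl⟩ := Finset.mem_image.1 hu
        exact ((hC x).1 hx).2.1
      refine le_trans ?_ (Finset.sum_le_sum_of_subset_of_nonneg himg
        fun u hu _ => Finset.sum_nonneg (hterm u hu))
      rw [Finset.sum_image (fun a _ b _ h => Fin.ext h), Finset.cast_card]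
      refine Finset.sum_le_sum fun x hx => ?_
      obtain ⟨hxH, hxX, hxX'⟩ := (hC x).1 hx
      rw [← hc.inner x hxH]
      exact Finset.single_le_sum (f := fun v => c x v) (hterm x hxX)
        (Finset.mem_sdiff.2 ⟨Finset.mem_range.2 (by omega), hxX'⟩)
    exact_mod_cast h1.trans (hc.cut_le hN.le hX hC')

end

/-! ### The minimum separator program

A minimum separator of the set in array 6 is written to array 7 and its size to variable 8; this
size is `N` if the set is a clique. -/

def Ex.memAt (a : ℕ) (i : Ex .nat) : Ex .nat := .and (.lt i (.var 0)) (.read a i (.const 0))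

def splitCap : Ex .real :=
  .ite (.and (.memAt 6 (.var 10)) (.eq (.var 11) (.add (.var 0) (.var 10)))) (.cast (.const 1)) <|
  .ite (.and (.le (.var 0) (.var 10)) <| .and (.memAt 6 (.sub (.var 10) (.var 0))) <|
    .and (.memAt 6 (.var 11)) (.rlt .zero (.rread 0 (.sub (.var 10) (.var 0)) (.var 11))))
    (.cast .bound) .zero

def sepNetwork : Stmt :=
  .seq (.fill (t := .real) 1 10 11 splitCap) <|
  .seq (.set (t := .nat) 2 (.add (.var 0) (.var 14))) (.set (t := .nat) 3 (.var 15))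

def sepUpdate : Stmt :=
  .ite (.lt (.card 12) (.var 8)) (.seq (.set (t := .nat) 8 (.card 12)) (.copyM 7 12)) .skip

def sepPair : Stmt :=
  .seq sepNetwork <| .seq minCut <|
  .seq (.setM 12 (.and (.mem 6 10) (.and (.mem 2 10) (.not (.read 2 (.add (.var 0) (.var 10))
    (.const 0)))))) sepUpdate

def sepBody : Stmt :=
  .ite (.and (.and (.isV 14) (.isV 15)) <| .and (.and (.mem 6 14) (.mem 6 15)) <|
    .and (.not (.eq (.var 14) (.var 15))) (.not (.adj 14 15))) sepPair .skip

/-- The initial value `N` exceeds the size of every vertex set and plays the role of infinity; it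
survives exactly if no non-adjacent pair is met. -/
def minSep : Stmt :=
  .seq (.set (t := .nat) 8 .bound) (.forAll 14 (.forAll 15 sepBody))

section

variable {n N : ℕ} {G : WeightedGraph (Fin n)} {σ : Store}

theorem holds_memAt (hn : σ.natVar 0 = n) (a : ℕ) (i : Ex .nat) :
    (Ex.memAt a i).Holds N σ ↔ ∃ x ∈ msk n (σ.natArr a), i.eval N σ = (x : ℕ) := by
  simp only [Ex.memAt, Ex.holds_and, Ex.holds_lt, Ex.eval_var, hn, Ex.holds_read, Ex.eval_const]
  constructor
  · rintro ⟨h1, h2⟩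
    exact ⟨⟨_, h1⟩, mem_msk.2 h2, rfl⟩
  · rintro ⟨x, hx, h⟩
    rw [h]
    exact ⟨x.2, mem_msk.1 hx⟩

theorem sepNetwork_spec (hσ : Ctx G σ) (hN : n + n < N) :
    SplitNetwork G N (msk n (σ.natArr 6)) ((sepNetwork.den N σ).realArr 1) := by
  set H := msk n (σ.natArr 6)
  have hval : ∀ u < N, ∀ v < N, (sepNetwork.den N σ).realArr 1 u v =
      splitCap.eval N ((σ.setNat 10 u).setNat 11 v) := by
    intro u hu v hv
    simp only [sepNetwork, Stmt.den_seq, Stmt.den_set_nat, realArr_setNat, Stmt.den_fill_real,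
      realArr_putArr, if_true]
    rw [if_pos ⟨hu, hv⟩]
  have hcap : ∀ u v, splitCap.eval N ((σ.setNat 10 u).setNat 11 v) =
      if (∃ x ∈ H, u = (x : ℕ)) ∧ v = n + u then (1 : ℝ) else
      if n ≤ u ∧ (∃ x ∈ H, u - n = (x : ℕ)) ∧ (∃ x ∈ H, v = (x : ℕ)) ∧
        0 < σ.realArr 0 (u - n) v then (N : ℝ) else 0 := by
    intro u v
    have hn : ((σ.setNat 10 u).setNat 11 v).natVar 0 = n := by simp [hσ.n_eq]
    simp only [splitCap, Ex.eval_ite, Ex.holds_and, holds_memAt hn, Ex.holds_eq, Ex.holds_le,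
      Ex.holds_rlt, Ex.eval_var, Ex.eval_add, Ex.eval_sub, Ex.eval_rread, Ex.zero, Ex.eval_cast,
      Ex.eval_const, Ex.eval_bound, natVar_setNat, natArr_setNat, realArr_setNat, hσ.n_eq]
    norm_num
    rfl
  refine ⟨?_, ?_, ?_, ?_⟩
  · intro u hu v hv
    rw [hval u hu v hv, hcap]
    split_ifs
    · exact zero_le_one
    · exact Nat.cast_nonneg _
    · exact le_rfl
  · intro x hx
    rw [hval _ (by omega) _ (by omega), hcap, if_pos ⟨⟨x, hx, rfl⟩, rfl⟩]
  · intro x hx y hy hxy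
    rw [hval _ (by omega) _ (by omega), hcap, if_neg, if_pos]
    · refine ⟨by omega, ⟨x, hx, by omega⟩, ⟨y, hy, rfl⟩, ?_⟩
      rw [Nat.add_sub_cancel_left, hσ.mat, mat_pos_iff]
      exact hxy
    · rintro ⟨-, h⟩; omega
  · intro u hu v hv
    rw [hval u hu v hv, hcap]
    split_ifs with h1 h2
    · obtain ⟨⟨x, hx, rfl⟩, rfl⟩ := h1
      exact fun _ => Or.inl ⟨x, hx, rfl, rfl⟩
    · obtain ⟨h0, ⟨x, hx, hxu⟩, ⟨y, hy, rfl⟩, hpos⟩ := h2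
      rw [hxu, hσ.mat, mat_pos_iff] at hpos
      exact fun _ => Or.inr ⟨x, hx, y, hy, hpos, by omega, rfl⟩
    · exact fun h => absurd rfl h

theorem sepPair_cut (hσ : Ctx G σ) (hN : n + n < N) {s t : Fin n} (hs : σ.natVar 14 = s)
    (ht : σ.natVar 15 = t) (hsH : s ∈ msk n (σ.natArr 6)) (htH : t ∈ msk n (σ.natArr 6))
    (hst : s ≠ t) (hadj : ¬ G.graph.Adj s t) {τ : Store}
    (hτ : τ = (Stmt.setM 12 (.and (.mem 6 10) (.and (.mem 2 10) (.not (.read 2 (.add (.var 0)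
      (.var 10)) (.const 0)))))).den N (minCut.den N (sepNetwork.den N σ))) :
    G.Separates (msk n (σ.natArr 6)) s t (msk n (τ.natArr 12)) ∧
      ∀ C', G.Separates (msk n (σ.natArr 6)) s t C' → (msk n (τ.natArr 12)).card ≤ C'.card := by
  have hnet := sepNetwork_spec hσ hN
  have h2 : (sepNetwork.den N σ).natVar 2 = n + s := by simp [sepNetwork, hσ.n_eq, hs]
  have h3 : (sepNetwork.den N σ).natVar 3 = t := by simp [sepNetwork, ht]
  have hcut := minCut_spec (N := N) (σ := sepNetwork.den N σ) hnet.nonneg (by omega) (by omega)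
    (by omega)
  rw [h2, h3] at hcut
  refine hnet.separates hN hsH htH hst hadj hcut fun x => ?_
  have hctx : Ctx G (minCut.den N (sepNetwork.den N σ)) := (hσ.den rfl rfl).den rfl rfl
  have h6 : (minCut.den N (sepNetwork.den N σ)).natArr 6 = σ.natArr 6 := by
    rw [Stmt.natArr_den N _ rfl, Stmt.natArr_den N _ rfl]
  rw [hτ, mem_setM (by omega), Ex.holds_and, Ex.holds_and, Ex.holds_not,
    Ex.holds_mem (v := x) (by simp), Ex.holds_mem (v := x) (by simp)]
  simp only [natArr_setNat, h6, mem_msk, Ex.holds_read, Ex.eval_add, Ex.eval_var, natVar_setNat,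
    hctx.n_eq, Ex.eval_const, Finset.mem_filter, Finset.mem_range]
  norm_num
  intro _
  simp [show (x : ℕ) < N by omega, show n + (x : ℕ) < N by omega]

/-- The invariant of the search for a minimum separator of `H`. -/
def SepInv (G : WeightedGraph (Fin n)) (N : ℕ) (H : Finset (Fin n)) (σ : Store) : Prop :=
  Ctx G σ ∧ msk n (σ.natArr 6) = H ∧ (σ.natVar 8 = N ∨
    G.IsSeparator H (msk n (σ.natArr 7)) ∧ σ.natVar 8 = (msk n (σ.natArr 7)).card)

theorem sepUpdate_spec {H : Finset (Fin n)} (hN : n + n < N) (h : SepInv G N H σ)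
    (hsep : G.IsSeparator H (msk n (σ.natArr 12))) :
    SepInv G N H (sepUpdate.den N σ) ∧ (sepUpdate.den N σ).natVar 8 ≤ σ.natVar 8 ∧
      (sepUpdate.den N σ).natVar 8 ≤ (msk n (σ.natArr 12)).card := by
  obtain ⟨h1, h2, h3⟩ := h
  have hctx : Ctx G (sepUpdate.den N σ) := h1.den rfl rfl
  have h6 : (sepUpdate.den N σ).natArr 6 = σ.natArr 6 := Stmt.natArr_den N _ rfl
  rw [← h6] at h2
  refine ⟨⟨hctx, h2, ?_⟩, ?_⟩
  all_goals
    rw [sepUpdate, Stmt.den_ite]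
    split_ifs with hlt <;> rw [Ex.holds_lt, h1.card (by omega), Ex.eval_var] at hlt
  · right
    have h7 : msk n (((Stmt.seq (.set (t := .nat) 8 (.card 12)) (.copyM 7 12)).den N σ).natArr 7) =
        msk n (σ.natArr 12) := by
      rw [Stmt.den_seq, msk_copyM (by omega)]
      rfl
    rw [h7]
    refine ⟨hsep, ?_⟩
    rw [Stmt.den_seq, Stmt.natVar_den N _ rfl, Stmt.den_set_nat, natVar_setNat, if_pos rfl,
      h1.card (by omega)]
  · exact h3
  · rw [Stmt.den_seq, Stmt.natVar_den N _ rfl, Stmt.den_set_nat, natVar_setNat, if_pos rfl,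
      h1.card (by omega)]
    exact ⟨hlt.le, le_rfl⟩
  · exact ⟨le_rfl, not_lt.1 hlt⟩

theorem sepBody_spec {H : Finset (Fin n)} (hN : n + n < N) (h : SepInv G N H σ) :
    SepInv G N H (sepBody.den N σ) ∧ (sepBody.den N σ).natVar 8 ≤ σ.natVar 8 ∧
      ∀ s t : Fin n, σ.natVar 14 = s → σ.natVar 15 = t → ∀ C, G.Separates H s t C →
        (sepBody.den N σ).natVar 8 ≤ C.card := by
  obtain ⟨h1, h2, h3⟩ := id h
  rw [sepBody, Stmt.den_ite]
  have hB : (Ex.and (.and (.isV 14) (.isV 15)) <| .and (.and (.mem 6 14) (.mem 6 15)) <|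
      .and (.not (.eq (.var 14) (.var 15))) (.not (.adj 14 15))).Holds N σ ↔
      (σ.natVar 14 < n ∧ σ.natVar 15 < n) ∧ ((Ex.mem 6 14).Holds N σ ∧ (Ex.mem 6 15).Holds N σ) ∧
      σ.natVar 14 ≠ σ.natVar 15 ∧ ¬ (Ex.adj 14 15).Holds N σ := by
    simp only [Ex.holds_and, Ex.isV, Ex.holds_lt, Ex.eval_var, h1.n_eq, Ex.holds_not, Ex.holds_eq,
      Ne]
  by_cases hV : σ.natVar 14 < n ∧ σ.natVar 15 < n
  swap
  · rw [if_neg (fun hh => hV (hB.1 hh).1)]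
    refine ⟨h, le_rfl, fun s t hs ht => ?_⟩
    rw [hs, ht] at hV
    exact absurd ⟨s.2, t.2⟩ hV
  obtain ⟨s, hs⟩ : ∃ s : Fin n, σ.natVar 14 = s := ⟨⟨_, hV.1⟩, rfl⟩
  obtain ⟨t, ht⟩ : ∃ t : Fin n, σ.natVar 15 = t := ⟨⟨_, hV.2⟩, rfl⟩
  rw [Ex.holds_mem hs, Ex.holds_mem ht, h1.adj hs ht, h2, hs, ht] at hB
  by_cases hst : (s ∈ H ∧ t ∈ H) ∧ s ≠ t ∧ ¬ G.graph.Adj s t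
  swap
  · rw [if_neg]
    · refine ⟨h, le_rfl, fun s' t' hs' ht' C hC => absurd ?_ hst⟩
      obtain rfl : s = s' := Fin.ext (hs.symm.trans hs')
      obtain rfl : t = t' := Fin.ext (ht.symm.trans ht')
      have := hC.not_adj
      exact ⟨⟨this.1, this.2.1⟩, this.2.2⟩
    · intro hh
      obtain ⟨-, h5, h6, h7⟩ := hB.1 hh
      exact hst ⟨h5, fun hh => h6 (congrArg Fin.val hh), h7⟩
  rw [if_pos (hB.2 ⟨⟨s.2, t.2⟩, hst.1, fun hh => hst.2.1 (Fin.ext hh), hst.2.2⟩)]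
  obtain ⟨⟨hsH, htH⟩, hne, hadj⟩ := hst
  rw [sepPair, Stmt.den_seq, Stmt.den_seq, Stmt.den_seq]
  set τ := (Stmt.setM 12 (.and (.mem 6 10) (.and (.mem 2 10) (.not (.read 2 (.add (.var 0)
      (.var 10)) (.const 0)))))).den N (minCut.den N (sepNetwork.den N σ)) with hτ
  obtain ⟨k1, k2⟩ := sepPair_cut h1 hN hs ht (h2.symm ▸ hsH) (h2.symm ▸ htH) hne hadj hτ
  rw [h2] at k1 k2
  have e8 : τ.natVar 8 = σ.natVar 8 := by
    rw [hτ, Stmt.natVar_den N _ rfl, Stmt.natVar_den N _ rfl, Stmt.natVar_den N _ rfl]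
  have ea : ∀ a, a ≠ 12 → a ≠ 1 → a ≠ 2 → a = 6 ∨ a = 7 → τ.natArr a = σ.natArr a := by
    rintro a - - - (rfl | rfl)
    · rw [hτ, Stmt.natArr_den N _ rfl, Stmt.natArr_den N _ rfl, Stmt.natArr_den N _ rfl]
    · rw [hτ, Stmt.natArr_den N _ rfl, Stmt.natArr_den N _ rfl, Stmt.natArr_den N _ rfl]
  have hinv : SepInv G N H τ := by
    refine ⟨((h1.den rfl rfl).den rfl rfl).den rfl rfl, ?_, ?_⟩
    · rw [ea 6 (by decide) (by decide) (by decide) (by decide), h2]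
    · rw [ea 7 (by decide) (by decide) (by decide) (by decide), e8]
      exact h3
  obtain ⟨m1, m2, m3⟩ := sepUpdate_spec hN hinv k1.isSeparator
  refine ⟨m1, m2.trans e8.le, fun s' t' hs' ht' C hC => m3.trans ?_⟩
  obtain rfl : s = s' := Fin.ext (hs.symm.trans hs')
  obtain rfl : t = t' := Fin.ext (ht.symm.trans ht')
  exact k2 C hC

theorem SepInv.setNat {H : Finset (Fin n)} (h : SepInv G N H σ) {x v : ℕ} (hx : x = 14 ∨ x = 15) :
    SepInv G N H (σ.setNat x v) := by
  obtain ⟨h1, h2, h3⟩ := h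
  refine ⟨h1.setNat (by omega), h2, ?_⟩
  rw [natVar_setNat, if_neg (by omega)]
  exact h3

/-- Every separator separates some pair, so the best result over all pairs is a minimum separator.
Off cliques a separator with `|H| - 2 < N` vertices rules out the initial value. -/
theorem minSep_spec (hσ : Ctx G σ) (hN : n + n < N) :
    ((minSep.den N σ).natVar 8 = N ∧ G.graph.IsClique (msk n (σ.natArr 6) : Set (Fin n))) ∨
    (G.IsMinSeparator (msk n (σ.natArr 6)) (msk n ((minSep.den N σ).natArr 7)) ∧
      (minSep.den N σ).natVar 8 = (msk n ((minSep.den N σ).natArr 7)).card) := by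
  set H := msk n (σ.natArr 6) with hH
  have key : SepInv G N H (minSep.den N σ) ∧ ∀ s t : Fin n, (s : ℕ) < N → ∀ C,
      G.Separates H s t C → (minSep.den N σ).natVar 8 ≤ C.card := by
    rw [minSep, Stmt.den_seq]
    refine Stmt.forAll_inv N _ (x := 14) (p := .forAll 15 sepBody) rfl
      (I := fun i τ => SepInv G N H τ ∧ ∀ s t : Fin n, (s : ℕ) < i → ∀ C,
        G.Separates H s t C → τ.natVar 8 ≤ C.card) ?_ ?_
    · refine ⟨SepInv.setNat ⟨hσ.setNat (by decide), rfl, Or.inl rfl⟩ (Or.inl rfl),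
        fun s t h => by omega⟩
    · rintro i τ hi hiτ ⟨hinv, hdone⟩
      have := Stmt.forAll_inv N τ (x := 15) (p := sepBody) rfl
        (I := fun j τ => SepInv G N H τ ∧ τ.natVar 14 = i ∧ ∀ s t : Fin n,
          (s : ℕ) < i ∨ (s : ℕ) = i ∧ (t : ℕ) < j → ∀ C, G.Separates H s t C →
          τ.natVar 8 ≤ C.card) ?_ ?_
      · obtain ⟨g1, g2, g3⟩ := this
        refine ⟨g1.setNat (Or.inl rfl), fun s t hs C hC => ?_⟩
        rw [natVar_setNat, if_neg (by decide)]
        exact g3 s t (by omega) C hC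
      · refine ⟨hinv.setNat (Or.inr rfl), by simpa [natVar_setNat] using hiτ, fun s t hs C hC => ?_⟩
        rw [natVar_setNat, if_neg (by decide)]
        exact hdone s t (by omega) C hC
      · rintro j τ' hj hjτ ⟨g1, g2, g3⟩
        obtain ⟨b1, b2, b3⟩ := sepBody_spec hN g1
        refine ⟨b1.setNat (Or.inr rfl), ?_, fun s t hs C hC => ?_⟩
        · rw [natVar_setNat, if_neg (by decide), Stmt.natVar_den N _ rfl, g2]
        · rw [natVar_setNat, if_neg (by decide)]
          by_cases hst : (s : ℕ) = i ∧ (t : ℕ) = j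
          · exact b3 s t (by omega) (by omega) C hC
          · exact b2.trans (g3 s t (by omega) C hC)
  obtain ⟨⟨h1, h2, h3⟩, h4⟩ := key
  have hmin : ∀ C, G.IsSeparator H C → (minSep.den N σ).natVar 8 ≤ C.card := by
    intro C hC
    obtain ⟨s, t, hst⟩ := exists_separates hC
    exact h4 s t (by omega) C hst
  by_cases hcl : G.graph.IsClique (H : Set (Fin n))
  · left
    refine ⟨h3.resolve_right fun h => not_isClique_of_isSeparator G h.1 hcl, hcl⟩
  · right
    obtain ⟨C, hC, hcard⟩ := exists_separator G hcl
    have h5 := hmin C hC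
    have h6 := Finset.card_le_univ H
    rw [Fintype.card_fin] at h6
    rcases h3 with h3 | ⟨h3, h3'⟩
    · omega
    · exact ⟨⟨h3, fun C' hC' => h3' ▸ hmin C' hC'⟩, h3'⟩

end

/-! ### Densest subgraphs from minimum cuts -/

section

variable {n : ℕ} (G : WeightedGraph (Fin n))

/-- `c` is the capacity function of the network with source `n` and sink `n + 1` whose cuts measure
the excess of the subsets of `S` over the density `g`. -/
structure DensityNetwork (N : ℕ) (S : Finset (Fin n)) (g : ℝ) (c : ℕ → ℕ → ℝ) : Prop where
  inner : ∀ x y : Fin n, c x y = if x ∈ S ∧ y ∈ S then G.mat x y else 0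
  source : ∀ y : Fin n, c n y = if y ∈ S then G.degIn S y else 0
  sink : ∀ x : Fin n, c x (n + 1) = if x ∈ S then 2 * g else 0
  zero : ∀ u < N, ∀ v < N, n < u ∨ v = n ∨ n + 1 < v ∨ (u = n ∧ v = n + 1) → c u v = 0

variable {G} {N : ℕ} {S : Finset (Fin n)} {g : ℝ} {c : ℕ → ℕ → ℝ}

theorem sum_range_network (hN : n + 2 ≤ N) (f : ℕ → ℝ) (hf : ∀ u < N, n + 1 < u → f u = 0) :
    ∑ u ∈ Finset.range N, f u = ∑ x : Fin n, f x + f n + f (n + 1) := by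
  rw [← Finset.sum_subset (Finset.range_subset_range.2 hN), Finset.sum_range_succ,
    Finset.sum_range_succ, Fin.sum_univ_eq_sum_range f n]
  intro u hu hu'
  rw [Finset.mem_range] at hu hu'
  exact hf u hu (by omega)

/-- The cut pays the degrees of `S \ T` at the source, the weight between `T` and `S \ T`, and `2g`
for each vertex of `T`. The degrees over `S` sum to `2 w(S)`, those over `T` to the crossing weight
plus `2 w(T)`; the crossing weight cancels. -/
theorem DensityNetwork.cutVal_eq (hc : DensityNetwork G N S g c) (hN : n + 2 ≤ N) {X : Finset ℕ}
    (hX : X ⊆ Finset.range N) (hs : n ∈ X) (ht : n + 1 ∉ X) {T : Finset (Fin n)}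
    (hT : ∀ x, x ∈ T ↔ x ∈ S ∧ (x : ℕ) ∈ X) :
    cutVal N c X = 2 * G.weightIn S - 2 * (G.weightIn T - g * T.card) := by
  have hrow : ∀ u < N, ∑ v ∈ Finset.range N \ X, c u v =
      ∑ y : Fin n, (if (y : ℕ) ∈ X then 0 else c u y) + c u (n + 1) := by
    intro u hu
    have : ∑ v ∈ Finset.range N \ X, c u v =
        ∑ v ∈ Finset.range N, if v ∈ X then 0 else c u v := by
      rw [Finset.sdiff_eq_filter, Finset.sum_filter]
      exact Finset.sum_congr rfl fun v _ => by split_ifs <;> rfl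
    rw [this, sum_range_network hN]
    · rw [if_pos hs, if_neg ht, add_zero]
    · intro v hv hnv
      rw [hc.zero u hu v hv (by omega), ite_self]
  have htot : cutVal N c X = ∑ u ∈ Finset.range N,
      if u ∈ X then ∑ v ∈ Finset.range N \ X, c u v else 0 := by
    rw [cutVal, ← Finset.sum_filter]
    congr 1
    ext u
    simp only [Finset.mem_filter]
    exact ⟨fun h => ⟨hX h, h⟩, fun h => h.2⟩
  have hST : ∀ f : Fin n → ℝ, ∑ y : Fin n, (if (y : ℕ) ∈ X then 0 else if y ∈ S then f y else 0) =
      ∑ y ∈ S \ T, f y := by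
    intro f
    rw [← Finset.sum_filter_add_sum_filter_not Finset.univ (fun y => y ∈ S \ T)]
    rw [Finset.sum_eq_zero (s := Finset.univ.filter (fun y => ¬ y ∈ S \ T)), add_zero]
    · refine Finset.sum_congr (by ext; simp) fun y hy => ?_
      rw [Finset.mem_sdiff, hT] at hy
      rw [if_neg (fun h => hy.2 ⟨hy.1, h⟩), if_pos hy.1]
    · intro y hy
      rw [Finset.mem_filter, Finset.mem_sdiff, hT] at hy
      split_ifs with h1 h2
      · rfl
      · exact absurd ⟨h2, fun h => h1 h.2⟩ hy.2
      · rfl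
  have hTS : T ⊆ S := fun x hx => ((hT x).1 hx).1
  rw [htot, sum_range_network hN]
  swap
  · intro u hu hnu
    split_ifs
    · exact Finset.sum_eq_zero fun v hv =>
        hc.zero u hu v (Finset.mem_range.1 (Finset.mem_sdiff.1 hv).1) (by omega)
    · rfl
  rw [if_pos hs, if_neg ht, add_zero, hrow n (by omega), hc.zero n (by omega) (n + 1) (by omega)
    (by omega), add_zero]
  simp_rw [hc.source]
  rw [hST]
  have hin : ∑ x : Fin n, (if (x : ℕ) ∈ X then ∑ v ∈ Finset.range N \ X, c x v else 0) =
      ∑ x ∈ T, (∑ y ∈ S \ T, G.mat x y + 2 * g) := by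
    rw [← Finset.sum_filter_add_sum_filter_not Finset.univ (fun y => y ∈ T)]
    rw [Finset.sum_eq_zero (s := Finset.univ.filter (fun y => ¬ y ∈ T)), add_zero]
    · refine Finset.sum_congr (by ext; simp) fun x hx => ?_
      have hx' := (hT x).1 hx
      rw [if_pos hx'.2, hrow x (by omega), hc.sink, if_pos hx'.1, ← hST]
      simp_rw [hc.inner, hx'.1, true_and]
    · intro x hx
      rw [Finset.mem_filter, hT] at hx
      split_ifs with h1
      · rw [hrow x (by omega), hc.sink, if_neg (fun h => hx.2 ⟨h, h1⟩), add_zero]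
        refine Finset.sum_eq_zero fun y _ => ?_
        rw [hc.inner, if_neg (c := x ∈ S ∧ y ∈ S) (fun h => hx.2 ⟨h.1, h1⟩), ite_self]
      · rfl
  rw [hin, Finset.sum_add_distrib, Finset.sum_const, nsmul_eq_mul]
  have h1 := two_weightIn G T
  have h2 := sum_degIn G S
  have h3 := Finset.sum_sdiff hTS (f := fun v => G.degIn S v)
  have h4 : ∑ x ∈ T, G.degIn S x = ∑ x ∈ T, ∑ y ∈ S \ T, G.mat x y + 2 * G.weightIn T := by
    rw [h1, ← Finset.sum_add_distrib]
    refine Finset.sum_congr rfl fun x _ => ?_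
    rw [degIn_eq_sum, Finset.sum_sdiff hTS]
  linarith

/-- A minimum cut maximizes the excess over the density `g`. -/
theorem DensityNetwork.le_of_isMinCut (hc : DensityNetwork G N S g c) (hN : n + 2 ≤ N)
    {X : Finset ℕ} (hX : IsMinCut N c n (n + 1) X) {T : Finset (Fin n)}
    (hT : ∀ x, x ∈ T ↔ x ∈ S ∧ (x : ℕ) ∈ X) (Y : Finset (Fin n)) (hY : Y ⊆ S) :
    G.weightIn Y - g * Y.card ≤ G.weightIn T - g * T.card := by
  obtain ⟨h1, h2, h3, h4⟩ := hX
  have e1 := hc.cutVal_eq hN h1 h2 h3 hT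
  let Z : Finset ℕ := insert n (Y.image (fun x : Fin n => (x : ℕ)))
  have hZ : ∀ x : Fin n, (x : ℕ) ∈ Z ↔ x ∈ Y := by
    intro x
    have := x.2
    simp only [Z, Finset.mem_insert, Finset.mem_image]
    constructor
    · rintro (h | ⟨y, hy, hyx⟩)
      · omega
      · rwa [← Fin.ext hyx]
    · exact fun h => Or.inr ⟨x, h, rfl⟩
  have z1 : Z ⊆ Finset.range N := by
    intro u hu
    simp only [Z, Finset.mem_insert, Finset.mem_image] at hu
    rw [Finset.mem_range]
    rcases hu with rfl | ⟨y, -, rfl⟩ <;> omega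
  have z3 : n + 1 ∉ Z := by
    simp only [Z, Finset.mem_insert, Finset.mem_image]
    rintro (h | ⟨y, -, h⟩) <;> omega
  have e2 := hc.cutVal_eq hN z1 (Finset.mem_insert_self _ _) z3 (T := Y) fun x =>
    ⟨fun h => ⟨hY h, (hZ x).2 h⟩, fun h => (hZ x).1 h.2⟩
  have := h4 Z z1 (Finset.mem_insert_self _ _) z3
  linarith

end

/-! A densest subgraph of the set in array 8 is written to array 9. -/

def densityNetwork : Stmt :=
  .seq (.set (t := .real) 3 (.dens 9)) <|
  .seq (.fill (t := .real) 1 10 11 (.ite (.isV 10)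
    (.ite (.mem 8 10)
      (.ite (.isV 11) (.ite (.mem 8 11) (.wt 10 11) .zero)
        (.ite (.eq (.var 11) (.add (.var 0) (.const 1))) (.radd (.rvar 3) (.rvar 3)) .zero))
      .zero)
    (.ite (.and (.eq (.var 10) (.var 0)) (.and (.isV 11) (.mem 8 11)))
      (.sumV 12 (.mem 8 12) (.wt 11 12)) .zero))) <|
  .seq (.set (t := .nat) 2 (.var 0)) (.set (t := .nat) 3 (.add (.var 0) (.const 1)))

/-- This is Dinkelbach's iteration: `g` is the density of the current set, and a set with `w(T) > g
|T|` is denser and replaces it. -/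
def densestStep : Stmt :=
  .seq densityNetwork <| .seq minCut <| .seq (.setM 13 (.and (.mem 8 10) (.mem 2 10))) <|
  .ite (.not (.rle (.weight 13) (.rmul (.rvar 3) (.card 13)))) (.copyM 9 13) .skip

def densest : Stmt := .seq (.copyM 9 8) (.rep densestStep)

section

variable {n N : ℕ} {G : WeightedGraph (Fin n)} {σ : Store}

theorem densityNetwork_spec (hσ : Ctx G σ) (hN : n + 2 ≤ N) :
    DensityNetwork G N (msk n (σ.natArr 8)) (G.density (msk n (σ.natArr 9)))
      ((densityNetwork.den N σ).realArr 1) := by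
  have hn : n ≤ N := by omega
  set S := msk n (σ.natArr 8) with hS
  set g := G.density (msk n (σ.natArr 9)) with hg
  have key : ∀ u < N, ∀ v < N, (densityNetwork.den N σ).realArr 1 u v =
      if u < n then (if 1 ≤ σ.natArr 8 u 0 then (if v < n then
        (if 1 ≤ σ.natArr 8 v 0 then σ.realArr 0 u v else 0) else
        if v = n + 1 then g + g else 0) else 0) else
      if u = n ∧ v < n ∧ 1 ≤ σ.natArr 8 v 0 then
        ((Ex.sumV 12 (.mem 8 12) (.wt 11 12)).eval N
          (((σ.setReal 3 g).setNat 10 u).setNat 11 v) : ℝ) else 0 := by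
    intro u hu v hv
    simp only [densityNetwork, Stmt.den_seq, Stmt.den_set_real, hσ.dens hn, Stmt.den_fill_real,
      Stmt.den_set_nat, realArr_setNat, realArr_putArr, if_true, if_pos (And.intro hu hv)]
    simp [Ex.isV, Ex.mem, Ex.wt, Ex.zero, hσ.n_eq, hg]
  have hm : ∀ x : Fin n, 1 ≤ σ.natArr 8 x 0 ↔ x ∈ S := fun x => mem_msk.symm
  refine ⟨fun x y => ?_, fun y => ?_, fun x => ?_, fun u hu v hv h => ?_⟩
  · rw [key x (by omega) y (by omega), if_pos x.2, if_pos y.2, hσ.mat]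
    simp only [hm]
    split_ifs <;> simp_all
  · rw [key n (by omega) y (by omega), if_neg (lt_irrefl n)]
    simp only [hm, y.2, true_and]
    split_ifs with h
    · rw [Ex.eval_sumV (n := n) hn (by simp [hσ.n_eq]) (by decide), degIn_eq_sum]
      rw [filter_msk (σ.natArr 8) _ fun v => by
        rw [Ex.holds_mem (v := v) (by simp), mem_msk]; rfl]
      refine Finset.sum_congr rfl fun v _ => ?_
      simp [Ex.wt, hσ.mat]
    · rfl
  · rw [key x (by omega) (n + 1) (by omega), if_pos x.2,
      if_neg (show ¬ n + 1 < n by omega), if_pos rfl]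
    simp only [hm]
    split_ifs <;> ring
  · rw [key u hu v hv]
    rcases lt_trichotomy u n with h' | h' | h'
    · rw [if_pos h', if_neg (show ¬ v < n by omega), if_neg (show ¬ v = n + 1 by omega), ite_self]
    · rw [if_neg (by omega), if_neg (by omega)]
    · rw [if_neg (by omega), if_neg (by omega)]

theorem DensityNetwork.nonneg {S : Finset (Fin n)} {g : ℝ} {c : ℕ → ℕ → ℝ}
    (hc : DensityNetwork G N S g c) (hg : 0 ≤ g) : ∀ u < N, ∀ v < N, 0 ≤ c u v := by
  intro u hu v hv
  by_cases h : n < u ∨ v = n ∨ n + 1 < v ∨ (u = n ∧ v = n + 1)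
  · rw [hc.zero u hu v hv h]
  · push Not at h
    obtain ⟨h1, h2, h3, h4⟩ := h
    rcases h1.lt_or_eq with h1 | rfl
    · rcases (show v < n ∨ v = n + 1 by omega) with h5 | rfl
      · rw [hc.inner ⟨u, h1⟩ ⟨v, h5⟩]
        split_ifs
        · exact mat_nonneg G _ _
        · exact le_rfl
      · rw [hc.sink ⟨u, h1⟩]
        split_ifs
        · linarith
        · exact le_rfl
    · have h5 : v < u := by have := h4 rfl; omega
      rw [hc.source ⟨v, h5⟩]
      split_ifs
      · rw [degIn_eq_sum]
        exact Finset.sum_nonneg fun _ _ => mat_nonneg G _ _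
      · exact le_rfl

theorem densestStep_spec (hσ : Ctx G σ) (hN : n + 2 ≤ N) :
    ∃ T ⊆ msk n (σ.natArr 8), (∀ Y ⊆ msk n (σ.natArr 8),
        G.weightIn Y - G.density (msk n (σ.natArr 9)) * Y.card ≤
          G.weightIn T - G.density (msk n (σ.natArr 9)) * T.card) ∧
      msk n ((densestStep.den N σ).natArr 9) =
        if G.weightIn T ≤ G.density (msk n (σ.natArr 9)) * T.card then msk n (σ.natArr 9) else T := by
  have hn : n ≤ N := by omega
  have hnet := densityNetwork_spec hσ hN
  set g := G.density (msk n (σ.natArr 9)) with hg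
  have hnn := hnet.nonneg (density_nonneg G _)
  rw [densestStep, Stmt.den_seq, Stmt.den_seq, Stmt.den_seq]
  set σ1 := densityNetwork.den N σ with h1
  have c1 : Ctx G σ1 := hσ.den rfl rfl
  have s1 : σ1.natVar 2 = n := by simp [h1, densityNetwork, hσ.n_eq]
  have t1 : σ1.natVar 3 = n + 1 := by simp [h1, densityNetwork, hσ.n_eq]
  have g1 : σ1.realVar 3 = g := by simp [h1, densityNetwork, hσ.dens hn, hg]
  have hcut := minCut_spec hnn (by omega) (by omega) (by omega)
  rw [s1, t1] at hcut
  set σ2 := minCut.den N σ1 with h2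
  have c2 : Ctx G σ2 := c1.den rfl rfl
  have a8 : σ2.natArr 8 = σ.natArr 8 := by
    rw [h2, Stmt.natArr_den N _ rfl, h1, Stmt.natArr_den N _ rfl]
  have a9 : σ2.natArr 9 = σ.natArr 9 := by
    rw [h2, Stmt.natArr_den N _ rfl, h1, Stmt.natArr_den N _ rfl]
  have g2 : σ2.realVar 3 = g := by rw [h2, Stmt.realVar_den N _ rfl, g1]
  set σ3 := (Stmt.setM 13 (.and (.mem 8 10) (.mem 2 10))).den N σ2 with h3
  have c3 : Ctx G σ3 := c2.den rfl rfl
  have hT : ∀ x, x ∈ msk n (σ3.natArr 13) ↔ x ∈ msk n (σ.natArr 8) ∧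
      (x : ℕ) ∈ (Finset.range N).filter (fun v => 1 ≤ σ2.natArr 2 v 0) := by
    intro x
    rw [h3, mem_setM hn, Ex.holds_and, Ex.holds_mem (v := x) (by simp),
      Ex.holds_mem (v := x) (by simp), mem_msk (A := ((σ2.setNat 10 x).setNat 11 0).natArr 2)]
    simp only [natArr_setNat, a8, Finset.mem_filter, Finset.mem_range, x.2.trans_le hn, true_and]
  refine ⟨msk n (σ3.natArr 13), fun x hx => ((hT x).1 hx).1, fun Y hY =>
    hnet.le_of_isMinCut hN hcut hT Y hY, ?_⟩
  have hB : (Ex.not (.rle (.weight 13) (.rmul (.rvar 3) (.card 13)))).Holds N σ3 ↔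
      ¬ G.weightIn (msk n (σ3.natArr 13)) ≤ g * (msk n (σ3.natArr 13)).card := by
    rw [Ex.holds_not, Ex.holds_rle, c3.weight hn, Ex.eval_rmul, Ex.eval_rvar, c3.card hn]
    rw [show σ3.realVar 3 = g from (Stmt.realVar_den N σ2 rfl).trans g2]
  rw [Stmt.den_ite]
  by_cases hw : G.weightIn (msk n (σ3.natArr 13)) ≤ g * (msk n (σ3.natArr 13)).card
  · rw [if_pos hw, if_neg (fun h => hB.1 h hw), Stmt.den_skip, h3, natArr_setM _ _ (by decide), a9]
  · rw [if_neg hw, if_pos (hB.2 hw), msk_copyM hn]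

/-- The current set `A` maximizes `w - g' |·|` for some `g'` below its density `g`. If `T` has
positive value for `g`, comparison with the value `0` of `A` yields `(g - g') |T| < (g - g') |A|`.
So each replacement is smaller, and `N` rounds are enough. -/
theorem densest_spec (hσ : Ctx G σ) (hN : n + 2 ≤ N) (hS : (msk n (σ.natArr 8)).Nonempty) :
    G.IsDensestIn (msk n (σ.natArr 8)) (msk n ((densest.den N σ).natArr 9)) := by
  have hn : n ≤ N := by omega
  set S := msk n (σ.natArr 8) with hSdef
  rw [densest, Stmt.den_seq, Stmt.den_rep]
  have hcard : ∀ τ : Store, (msk n (τ.natArr 9)).card ≤ N := by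
    intro τ
    refine (Finset.card_le_univ _).trans ?_
    rwa [Fintype.card_fin]
  refine (iterate_done (f := densestStep.den N) (I := fun τ => Ctx G τ ∧ msk n (τ.natArr 8) = S ∧
    msk n (τ.natArr 9) ⊆ S ∧ (msk n (τ.natArr 9)).Nonempty ∧
    ∃ g' < G.density (msk n (τ.natArr 9)), ∀ Y ⊆ S, G.weightIn Y - g' * Y.card ≤
      G.weightIn (msk n (τ.natArr 9)) - g' * (msk n (τ.natArr 9)).card)
    (D := fun τ => G.IsDensestIn S (msk n (τ.natArr 9)))
    (fun τ => (msk n (τ.natArr 9)).card) ?_ ?_ ?_ N ((Stmt.copyM 9 8).den N σ) ?_ (hcard _)).2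
  · rintro τ ⟨h1, h2, h3, h4, g', h5, h6⟩
    obtain ⟨T, hT, hmax, heq⟩ := densestStep_spec h1 hN
    rw [h2] at hT hmax
    refine ⟨h1.den rfl rfl, ?_, ?_⟩
    · rw [Stmt.natArr_den N _ rfl, h2]
    rw [heq]
    split_ifs with hw
    · exact ⟨h3, h4, g', h5, h6⟩
    · have hne : T.Nonempty := by
        rw [Finset.nonempty_iff_ne_empty]
        rintro rfl
        simp [weightIn_empty] at hw
      refine ⟨hT, hne, _, ?_, hmax⟩
      have hc : (0 : ℝ) < T.card := by exact_mod_cast hne.card_pos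
      rw [← density_mul_card G hne] at hw
      exact lt_of_mul_lt_mul_right (not_le.1 hw) hc.le
  · rintro τ ⟨h1, h2, h3, h4, g', h5, h6⟩ hD
    obtain ⟨T, hT, hmax, heq⟩ := densestStep_spec h1 hN
    rw [h2] at hT
    simp only [heq]
    rw [if_pos]
    · exact hD
    · rcases T.eq_empty_or_nonempty with rfl | hne
      · simp [weightIn_empty]
      · rw [← density_mul_card G hne]
        exact mul_le_mul_of_nonneg_right (hD.2.2 T hT hne) (Nat.cast_nonneg _)
  · rintro τ ⟨h1, h2, h3, h4, g', h5, h6⟩ hD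
    obtain ⟨T, hT, hmax, heq⟩ := densestStep_spec h1 hN
    rw [h2] at hT hmax
    rw [heq]
    have hwD := density_mul_card G h4
    split_ifs with hw
    · refine absurd ⟨h3, h4, fun Y hY hne => ?_⟩ hD
      have := hmax Y hY
      rw [← density_mul_card G hne] at this
      have hc : (0 : ℝ) < Y.card := by exact_mod_cast hne.card_pos
      exact le_of_mul_le_mul_right (by linarith) hc
    · have := h6 T hT
      rw [not_le] at hw
      have hlt : (G.density (msk n (τ.natArr 9)) - g') * T.card <
          (G.density (msk n (τ.natArr 9)) - g') * (msk n (τ.natArr 9)).card := by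
        nlinarith
      exact_mod_cast lt_of_mul_lt_mul_left hlt (by linarith)
  · have e9 : msk n (((Stmt.copyM 9 8).den N σ).natArr 9) = S := msk_copyM hn 9 8
    have e8 : msk n (((Stmt.copyM 9 8).den N σ).natArr 8) = S := by
      rw [Stmt.natArr_den N _ rfl]
    -- For `g' = -1` the objective `w(Y) + |Y|` is monotone, so `S` itself is a maximizer at the
    -- start.
    refine ⟨hσ.den rfl rfl, e8, e9.le, e9.symm ▸ hS, -1, ?_, fun Y hY => ?_⟩
    · exact lt_of_lt_of_le (by norm_num) (density_nonneg G _)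
    · rw [e9]
      have h1 := weightIn_mono G hY
      have h2 : (Y.card : ℝ) ≤ S.card := by exact_mod_cast Finset.card_le_card hY
      linarith

end

/-! ### Maximum weights and the connectivity bound -/

namespace Ex

def maxWeight (a : ℕ) : Ex .real :=
  .rmax 10 (.rmax 11 (.ite (.and (.and (.isV 10) (.mem a 10)) (.and (.isV 11) (.mem a 11)))
    (.wt 10 11) .zero))

/-- `connBound` of the real variables 1 and 4. -/
def connBound : Ex .nat :=
  .add (.sum 10 (.ite (.rle (.rvar 1) (.rmul (.rvar 4) (.add (.add (.var 10) (.var 10))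
    (.const 1)))) (.const 0) (.const 1))) (.const 1)

end Ex

section

variable {n N : ℕ} {G : WeightedGraph (Fin n)} {σ : Store}

/-- Pairs outside the set and non-adjacent pairs contribute `0`, as does the start value; with at
least one edge, of positive weight, this does not affect the maximum. -/
theorem Ctx.maxWeight (h : Ctx G σ) (hN : n ≤ N) (a : ℕ)
    (hne : (G.edgesIn (msk n (σ.natArr a))).Nonempty) :
    (Ex.maxWeight a).eval N σ = G.wmaxIn (msk n (σ.natArr a)) := by
  set S := msk n (σ.natArr a) with hS
  set e : Ex .real := .ite (.and (.and (.isV 10) (.mem a 10)) (.and (.isV 11) (.mem a 11)))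
    (.wt 10 11) .zero with he
  have hin : ∀ u v : Fin n, u ∈ S → v ∈ S →
      (e.eval N ((σ.setNat 10 u).setNat 11 v) : ℝ) = G.mat u v := by
    intro u v hu hv
    rw [hS, mem_msk] at hu hv
    simp [he, Ex.isV, Ex.mem, Ex.wt, h.n_eq, hu, hv, h.mat]
  have hle : ∀ i j, (e.eval N ((σ.setNat 10 i).setNat 11 j) : ℝ) ≤ G.wmaxIn S := by
    obtain ⟨f, hf⟩ := hne
    intro i j
    by_cases hij : (i < n ∧ 1 ≤ σ.natArr a i 0) ∧ j < n ∧ 1 ≤ σ.natArr a j 0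
    · have h1 : (⟨i, hij.1.1⟩ : Fin n) ∈ S := by rw [hS, mem_msk]; exact hij.1.2
      have h2 : (⟨j, hij.2.1⟩ : Fin n) ∈ S := by rw [hS, mem_msk]; exact hij.2.2
      exact (hin _ _ h1 h2).trans_le (mat_le_wmaxIn G h1 h2)
    · have : (e.eval N ((σ.setNat 10 i).setNat 11 j) : ℝ) = 0 := by
        rw [he, Ex.eval_ite, if_neg]
        · simp [Ex.zero]
        · simpa [Ex.isV, Ex.mem, h.n_eq] using hij
      rw [this]
      induction f with | _ u v
      obtain ⟨hu, hv, -⟩ := (mem_edgesIn G).1 hf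
      exact (mat_nonneg G u v).trans (mat_le_wmaxIn G hu hv)
  have h0 : 0 ≤ G.wmaxIn S := by
    obtain ⟨f, hf⟩ := hne
    induction f with | _ u v
    obtain ⟨hu, hv, -⟩ := (mem_edgesIn G).1 hf
    exact (mat_nonneg G u v).trans (mat_le_wmaxIn G hu hv)
  obtain ⟨a1, -, a3⟩ := Ex.rmax_spec N σ 10 (.rmax 11 e)
  refine le_antisymm ?_ ?_
  · rcases a1 with a1 | ⟨i, -, a1⟩
    · exact a1.trans_le h0
    · refine a1.trans_le ?_
      rcases (Ex.rmax_spec N (σ.setNat 10 i) 11 e).1 with b1 | ⟨j, -, b1⟩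
      · exact b1.trans_le h0
      · exact b1.trans_le (hle i j)
  · refine csSup_le (by simpa using hne) ?_
    rintro _ ⟨f, hf, rfl⟩
    induction f with | _ u v
    obtain ⟨hu, hv, huv⟩ := (mem_edgesIn G).1 hf
    have : G.weight s(u, v) = G.mat u v := by rw [WeightedGraph.mat, if_pos huv]
    rw [this, ← hin u v hu hv]
    exact ((Ex.rmax_spec N (σ.setNat 10 u) 11 e).2.2 v (v.2.trans_le hN)).trans
      (a3 u (u.2.trans_le hN))

/-- The machine cannot round, so `⌊⌈d / w⌉ / 2⌋` is obtained by counting the `q` with `(2q + 1) w <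
d`. The hypothesis `d ≤ w N` ensures that all of them are below `N`. -/
theorem Ex.eval_connBound {d w : ℝ} (hd : σ.realVar 1 = d) (hw : σ.realVar 4 = w) (hw0 : 0 < w)
    (hdw : d ≤ w * N) : Ex.connBound.eval N σ = DenseSub.connBound d w := by
  have hq : ∀ q : ℕ, d ≤ w * ((q + q + 1 : ℕ) : ℝ) ↔ ⌈d / w⌉₊ / 2 ≤ q := by
    intro q
    rw [mul_comm, ← div_le_iff₀ hw0, ← Nat.ceil_le]
    omega
  have hle : ⌈d / w⌉₊ / 2 ≤ N := by
    have : ⌈d / w⌉₊ ≤ N := Nat.ceil_le.2 ((div_le_iff₀ hw0).2 (by rwa [mul_comm]))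
    omega
  rw [Ex.connBound, DenseSub.connBound, Ex.eval_add, Ex.eval_const, Ex.eval_sum]
  congr 1
  have : ∀ q ∈ Finset.range N, ((Ex.ite (.rle (.rvar 1) (.rmul (.rvar 4) (.add (.add (.var 10)
      (.var 10)) (.const 1)))) (.const 0) (.const 1)).eval N (σ.setNat 10 q) : ℕ) =
      if q < ⌈d / w⌉₊ / 2 then 1 else 0 := by
    intro q _
    have := hq q
    simp only [Ex.eval_ite, Ex.holds_rle, Ex.eval_rvar, Ex.eval_rmul, Ex.eval_add, Ex.eval_var,
      Ex.eval_const, realVar_setNat, natVar_setNat, if_true, hd, hw]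
    by_cases hc : d ≤ w * ((q + q + 1 : ℕ) : ℝ)
    · rw [if_pos hc, if_neg (not_lt.2 (this.1 hc))]
    · rw [if_neg hc, if_pos (not_le.1 fun h => hc (this.2 h))]
  rw [Finset.sum_congr rfl this, ← Finset.sum_filter]
  rw [show (Finset.range N).filter (fun q => q < ⌈d / w⌉₊ / 2) = Finset.range (⌈d / w⌉₊ / 2) by
    ext q; simp only [Finset.mem_filter, Finset.mem_range]; omega]
  simp

theorem density_le_mul {V : Type*} [DecidableEq V] {G : WeightedGraph V} {S : Finset V} {w : ℝ}
    (hw : 0 ≤ w) (h : ∀ u ∈ S, ∀ v ∈ S, G.mat u v ≤ w) : G.density S ≤ w * S.card := by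
  rcases S.eq_empty_or_nonempty with rfl | hne
  · simp [WeightedGraph.density]
  have h1 := two_weightIn_le G h
  have hc : (1 : ℝ) ≤ S.card := by exact_mod_cast hne.card_pos
  rw [WeightedGraph.density, div_le_iff₀ (by linarith)]
  have : 0 ≤ w * S.card * S.card := by positivity
  have : 0 ≤ w * S.card := by positivity
  nlinarith

end

/-! ### Splitting along a separator

The family of the graphs that remain of the set in array 6 after splitting along the set in array 7
is scanned. If it has a clique, then variable 17 is set and the clique is written to array 10. A
member of non-negative excess is written to array 6. -/

/-- Running over vertices instead of components meets a component several times, always with the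
same core. The last test is `0 ≤ w(R) - d (|R| + 1 - τ)`, rearranged. -/
def splitBody : Stmt :=
  .seq (.set (t := .nat) 7 (.var 18)) <| .seq reach <|
  .seq (.setM 5 (.or (.mem 4 10) (.mem 7 10))) <| .seq corePeel <|
  .ite (.lt (.var 16) (.card 5))
    (.ite (.clique 5) (.seq (.copyM 10 5) (.set (t := .nat) 17 (.const 1)))
      (.ite (.rle (.rmul (.rvar 1) (.add (.card 5) (.const 1)))
        (.radd (.weight 5) (.rmul (.rvar 1) (.var 16)))) (.copyM 11 5) .skip))
    .skip

def split : Stmt :=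
  .seq (.setM 3 (.and (.mem 6 10) (.not (.mem 7 10)))) <|
  .seq (.forAll 18 (.ite (.and (.isV 18) (.mem 3 18)) splitBody .skip)) (.copyM 6 11)

/-- `R` belongs to the family of a split. -/
def WeightedGraph.InSplit {V : Type*} [DecidableEq V] (G : WeightedGraph V) (d : ℝ) (τ : ℕ)
    (U C R : Finset V) : Prop :=
  τ + 1 ≤ R.card ∧ ∃ S, G.IsComponent U S ∧ G.IsCore d (S ∪ C) R

section

variable {n N : ℕ} {G : WeightedGraph (Fin n)} {σ : Store}

/-- The state of a scan of the split of `U` along `C` with the vertices below `i` done. -/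
structure SplitInv (G : WeightedGraph (Fin n)) (d : ℝ) (τ : ℕ) (U C : Finset (Fin n)) (i : ℕ)
    (σ : Store) : Prop where
  ctx : Ctx G σ
  d_eq : σ.realVar 1 = d
  τ_eq : σ.natVar 16 = τ
  U_eq : msk n (σ.natArr 3) = U
  C_eq : msk n (σ.natArr 7) = C
  result : (σ.natVar 17 = 1 ∧ G.InSplit d τ U C (msk n (σ.natArr 10)) ∧
      G.graph.IsClique (msk n (σ.natArr 10) : Set (Fin n))) ∨
    (σ.natVar 17 = 0 ∧ ∀ v : Fin n, (v : ℕ) < i → ∀ S R, v ∈ S → G.IsComponent U S →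
      G.IsCore d (S ∪ C) R → τ + 1 ≤ R.card → ¬ G.graph.IsClique (R : Set (Fin n)) ∧
        (0 ≤ G.excess d τ R → G.InSplit d τ U C (msk n (σ.natArr 11)) ∧
          ¬ G.graph.IsClique (msk n (σ.natArr 11) : Set (Fin n)) ∧
          0 ≤ G.excess d τ (msk n (σ.natArr 11))))

theorem SplitInv.setNat {d : ℝ} {τ : ℕ} {U C : Finset (Fin n)} {i v : ℕ}
    (h : SplitInv G d τ U C i σ) : SplitInv G d τ U C i (σ.setNat 18 v) :=
  ⟨h.ctx.setNat (by decide), h.d_eq, by simp [h.τ_eq], h.U_eq, h.C_eq, by simpa using h.result⟩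

theorem splitBody_spec {d : ℝ} {τ : ℕ} {U C : Finset (Fin n)} {v : Fin n} (hN : n ≤ N)
    (h : SplitInv G d τ U C v σ) (hv : σ.natVar 18 = v) (hvU : v ∈ U) :
    SplitInv G d τ U C (v + 1) (splitBody.den N σ) := by
  obtain ⟨hctx, hd, hτ, hU, hC, hres⟩ := h
  rw [splitBody, Stmt.den_seq, Stmt.den_seq, Stmt.den_seq, Stmt.den_seq, Stmt.den_set_nat,
    Ex.eval_var, hv]
  set σ1 := σ.setNat 7 v with h1
  have c1 : Ctx G σ1 := hctx.setNat (by decide)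
  have hreach := reach_spec (v := v) c1 hN (by simp [h1]) (by rw [h1, natArr_setNat, hU]; exact hvU)
  rw [show σ1.natArr 3 = σ.natArr 3 from rfl, hU] at hreach
  set σ2 := reach.den N σ1 with h2
  have c2 : Ctx G σ2 := c1.den rfl rfl
  set S := msk n (σ2.natArr 4) with hS
  set σ3 := (Stmt.setM 5 (.or (.mem 4 10) (.mem 7 10))).den N σ2 with h3
  have c3 : Ctx G σ3 := c2.den rfl rfl
  have e3 : msk n (σ3.natArr 5) = S ∪ C := by
    ext x
    rw [h3, mem_setM hN, Ex.holds_or, Ex.holds_mem (v := x) (by simp),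
      Ex.holds_mem (v := x) (by simp), Finset.mem_union, natArr_setNat, natArr_setNat, ← hS, h2,
      Stmt.natArr_den N _ (a := 7) rfl, h1, natArr_setNat, hC]
  have hcore := core_spec c3 hN
  rw [e3] at hcore
  have frame_n : ∀ x, x = 16 ∨ x = 17 → (corePeel.den N σ3).natVar x = σ.natVar x := by
    rintro x (rfl | rfl)
    all_goals
      rw [Stmt.natVar_den N _ rfl, h3, Stmt.natVar_den N _ rfl, h2, Stmt.natVar_den N _ rfl, h1,
        natVar_setNat, if_neg (by decide)]
  have frame_a : ∀ a, a = 3 ∨ a = 7 ∨ a = 10 ∨ a = 11 →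
      (corePeel.den N σ3).natArr a = σ.natArr a := by
    rintro x (rfl | rfl | rfl | rfl)
    all_goals
      rw [Stmt.natArr_den N _ rfl, h3, Stmt.natArr_den N _ rfl, h2, Stmt.natArr_den N _ rfl, h1,
        natArr_setNat]
  have d3 : σ3.realVar 1 = d := by
    rw [h3, Stmt.realVar_den N _ rfl, h2, Stmt.realVar_den N _ rfl, h1, realVar_setNat, hd]
  rw [d3] at hcore
  set σ4 := corePeel.den N σ3 with h4
  have c4 : Ctx G σ4 := c3.den rfl rfl
  have d4 : σ4.realVar 1 = d := by rw [h4, Stmt.realVar_den N _ rfl, d3]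
  have t4 : σ4.natVar 16 = τ := by rw [frame_n 16 (by decide), hτ]
  have u4 : msk n (σ4.natArr 3) = U := by rw [frame_a 3 (by decide), hU]
  have k4 : msk n (σ4.natArr 7) = C := by rw [frame_a 7 (by decide), hC]
  rw [← frame_n 17 (by decide), ← frame_a 10 (by decide), ← frame_a 11 (by decide)] at hres
  set R := msk n (σ4.natArr 5) with hR
  -- A vertex determines its component and thereby the core of that component with `C`; the only new
  -- claim in this round concerns `R`.
  have huniq : ∀ w : Fin n, (w : ℕ) < v + 1 → ∀ S' R', w ∈ S' → G.IsComponent U S' →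
      G.IsCore d (S' ∪ C) R' → (w : ℕ) < v ∨ R' = R := by
    intro w hw S' R' hwS hS' hR'
    rcases Nat.lt_succ_iff_lt_or_eq.1 hw with hlt | heq
    · exact Or.inl hlt
    · right
      obtain rfl : w = v := Fin.ext heq
      obtain rfl : S' = S := isComponent_unique G hS' hreach.1 hwS hreach.2
      exact isCore_unique G hR' hcore
  have hB1 : (Ex.lt (.var 16) (.card 5)).Holds N σ4 ↔ τ + 1 ≤ R.card := by
    rw [Ex.holds_lt, Ex.eval_var, t4, c4.card hN]
    exact Iff.rfl
  rw [Stmt.den_ite]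
  by_cases hcard : τ + 1 ≤ R.card
  swap
  · rw [if_neg (fun hh => hcard (hB1.1 hh)), Stmt.den_skip]
    refine ⟨c4, d4, t4, u4, k4, hres.imp_right fun ⟨g1, g2⟩ => ⟨g1, fun w hw S' R' hwS hS' hR' hc' => ?_⟩⟩
    rcases huniq w hw S' R' hwS hS' hR' with hlt | rfl
    · exact g2 w hlt S' R' hwS hS' hR' hc'
    · exact absurd hc' hcard
  have hin : G.InSplit d τ U C R := ⟨hcard, S, hreach.1, hcore⟩
  rw [if_pos (hB1.2 hcard), Stmt.den_ite]
  have hB2 := c4.clique hN 5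
  by_cases hcl : G.graph.IsClique (R : Set (Fin n))
  · rw [if_pos (hB2.2 hcl), Stmt.den_seq, Stmt.den_set_nat]
    have e10 : msk n (((Stmt.copyM 10 5).den N σ4).natArr 10) = R := msk_copyM hN 10 5
    refine ⟨(c4.den rfl rfl).setNat (by decide), ?_, ?_, ?_, ?_, Or.inl ⟨by simp, ?_, ?_⟩⟩
    · rw [realVar_setNat, Stmt.realVar_den N _ rfl, d4]
    · rw [natVar_setNat, if_neg (by decide), Stmt.natVar_den N _ rfl, t4]
    · rw [natArr_setNat, Stmt.natArr_den N _ rfl, u4]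
    · rw [natArr_setNat, Stmt.natArr_den N _ rfl, k4]
    · rwa [natArr_setNat, e10]
    · rwa [natArr_setNat, e10]
  rw [if_neg (fun hh => hcl (hB2.1 hh)), Stmt.den_ite]
  have hB3 : (Ex.rle (.rmul (.rvar 1) (.add (.card 5) (.const 1)))
      (.radd (.weight 5) (.rmul (.rvar 1) (.var 16)))).Holds N σ4 ↔ 0 ≤ G.excess d τ R := by
    rw [Ex.holds_rle, Ex.eval_rmul, Ex.eval_radd, Ex.eval_rmul, Ex.eval_rvar, Ex.eval_add,
      c4.card hN, c4.weight hN, Ex.eval_const, Ex.eval_var, t4, d4, ← hR, WeightedGraph.excess]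
    push_cast
    constructor <;> intro h <;> linarith
  by_cases hex : 0 ≤ G.excess d τ R
  · rw [if_pos (hB3.2 hex)]
    have e11 : msk n (((Stmt.copyM 11 5).den N σ4).natArr 11) = R := msk_copyM hN 11 5
    refine ⟨c4.den rfl rfl, ?_, ?_, ?_, ?_, ?_⟩
    · rw [Stmt.realVar_den N _ rfl, d4]
    · rw [Stmt.natVar_den N _ rfl, t4]
    · rw [Stmt.natArr_den N _ rfl, u4]
    · rw [Stmt.natArr_den N _ rfl, k4]
    · rw [Stmt.natVar_den N _ rfl, Stmt.natArr_den N _ (a := 10) rfl, e11]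
      refine hres.imp_right fun ⟨g1, g2⟩ => ⟨g1, fun w hw S' R' hwS hS' hR' hc' => ?_⟩
      refine ⟨?_, fun _ => ⟨hin, hcl, hex⟩⟩
      rcases huniq w hw S' R' hwS hS' hR' with hlt | rfl
      · exact (g2 w hlt S' R' hwS hS' hR' hc').1
      · exact hcl
  · rw [if_neg (fun hh => hex (hB3.1 hh)), Stmt.den_skip]
    refine ⟨c4, d4, t4, u4, k4, hres.imp_right fun ⟨g1, g2⟩ => ⟨g1, fun w hw S' R' hwS hS' hR' hc' => ?_⟩⟩
    rcases huniq w hw S' R' hwS hS' hR' with hlt | rfl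
    · exact g2 w hlt S' R' hwS hS' hR' hc'
    · exact ⟨hcl, fun h => absurd h hex⟩

theorem split_spec (hσ : Ctx G σ) (hN : n ≤ N) {d : ℝ} {τ : ℕ} (hd : σ.realVar 1 = d)
    (hτ : σ.natVar 16 = τ) (h0 : σ.natVar 17 = 0) {H C : Finset (Fin n)}
    (hH : msk n (σ.natArr 6) = H) (hC : msk n (σ.natArr 7) = C) :
    ((split.den N σ).natVar 17 = 1 ∧ G.InSplit d τ (H \ C) C (msk n ((split.den N σ).natArr 10)) ∧
      G.graph.IsClique (msk n ((split.den N σ).natArr 10) : Set (Fin n))) ∨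
    ((split.den N σ).natVar 17 = 0 ∧ ∀ R, G.InSplit d τ (H \ C) C R →
      ¬ G.graph.IsClique (R : Set (Fin n)) ∧
      (0 ≤ G.excess d τ R → G.InSplit d τ (H \ C) C (msk n ((split.den N σ).natArr 6)) ∧
        ¬ G.graph.IsClique (msk n ((split.den N σ).natArr 6) : Set (Fin n)) ∧
        0 ≤ G.excess d τ (msk n ((split.den N σ).natArr 6)))) := by
  rw [split, Stmt.den_seq, Stmt.den_seq]
  set σ1 := (Stmt.setM 3 (.and (.mem 6 10) (.not (.mem 7 10)))).den N σ with h1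
  have c1 : Ctx G σ1 := hσ.den rfl rfl
  have u1 : msk n (σ1.natArr 3) = H \ C := by
    ext x
    rw [h1, mem_setM hN, Ex.holds_and, Ex.holds_not, Ex.holds_mem (v := x) (by simp),
      Ex.holds_mem (v := x) (by simp), Finset.mem_sdiff, natArr_setNat, natArr_setNat, hH, hC]
  have key : SplitInv G d τ (H \ C) C N
      ((Stmt.forAll 18 (.ite (.and (.isV 18) (.mem 3 18)) splitBody .skip)).den N σ1) := by
    refine Stmt.forAll_inv N σ1 (x := 18) rfl (I := SplitInv G d τ (H \ C) C) ?_ ?_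
    · refine SplitInv.setNat ⟨c1, ?_, ?_, u1, ?_, Or.inr ⟨?_, fun v hv => by omega⟩⟩
      · rw [h1, Stmt.realVar_den N _ rfl, hd]
      · rw [h1, Stmt.natVar_den N _ rfl, hτ]
      · rw [h1, Stmt.natArr_den N _ rfl, hC]
      · rw [h1, Stmt.natVar_den N _ rfl, h0]
    · intro i τ' hi hiτ hinv
      refine SplitInv.setNat ?_
      have hB : (Ex.and (.isV 18) (.mem 3 18)).Holds N τ' ↔ i < n ∧ 1 ≤ τ'.natArr 3 i 0 := by
        simp [Ex.isV, Ex.mem, hiτ, hinv.ctx.n_eq]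
      rw [Stmt.den_ite]
      by_cases hv : i < n ∧ 1 ≤ τ'.natArr 3 i 0
      · rw [if_pos (hB.2 hv)]
        obtain ⟨v, rfl⟩ : ∃ v : Fin n, i = v := ⟨⟨i, hv.1⟩, rfl⟩
        exact splitBody_spec hN hinv hiτ (hinv.U_eq ▸ mem_msk.2 hv.2)
      · rw [if_neg (fun hh => hv (hB.1 hh)), Stmt.den_skip]
        obtain ⟨g1, g2, g3, g4, g5, g6⟩ := hinv
        refine ⟨g1, g2, g3, g4, g5, g6.imp_right fun ⟨g7, g8⟩ => ⟨g7, fun v hlt S R hvS hS => ?_⟩⟩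
        refine g8 v ?_ S R hvS hS
        rcases Nat.lt_succ_iff_lt_or_eq.1 hlt with hlt | heq
        · exact hlt
        · refine absurd ⟨heq ▸ v.2, ?_⟩ hv
          rw [← heq]
          exact mem_msk.1 (g4.symm ▸ hS.1 hvS)
  set σ2 := (Stmt.forAll 18 (.ite (.and (.isV 18) (.mem 3 18)) splitBody .skip)).den N σ1
  rw [Stmt.natVar_den N _ rfl, Stmt.natArr_den N _ (a := 10) rfl, msk_copyM hN]
  refine key.result.imp_right fun ⟨g1, g2⟩ => ⟨g1, ?_⟩
  rintro R ⟨hcard, S, hS, hR⟩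
  obtain ⟨v, hv⟩ := ((isComponent_iff G _ _).1 hS).2.2.1
  exact g2 v (v.2.trans_le hN) S R hv hS hR hcard

end

/-! ### The program for `Mader_subgraph`

The input is the set in array 9, the output is written to array 10. -/

def maderInit : Stmt :=
  .seq (.set (t := .real) 1 (.dens 9)) <| .seq (.set (t := .real) 4 (.maxWeight 9)) <|
  .seq (.set (t := .nat) 16 .connBound) <| .seq (.copyM 5 9) <| .seq corePeel <|
  .seq (.copyM 6 5) <| .seq (.setM 7 (.const 0)) (.set (t := .nat) 17 (.const 0))

def maderStep : Stmt :=
  .ite (.var 17) .skip <| .seq minSep <|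
    .ite (.le (.var 16) (.var 8)) (.seq (.copyM 10 6) (.set (t := .nat) 17 (.const 1))) split

/-- The family is never stored. Its initial value is the split of the peeled input along the empty
set, and afterwards one member of non-negative excess stands for it. -/
def mader : Stmt := .seq maderInit (.seq split (.rep maderStep))

/-! ### Members of a split -/

section

variable {V : Type*} [DecidableEq V] (G : WeightedGraph V) {d : ℝ} {τ : ℕ}

theorem exists_isSplit [Fintype V] (H C : Finset V) :
    ∃ 𝓗', IsSplit G d τ H C 𝓗' ∧ ∀ R, R ∈ 𝓗' ↔ G.InSplit d τ (H \ C) C R := by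
  classical
  refine ⟨Finset.univ.filter (G.InSplit d τ (H \ C) C), fun R => ?_, fun R => by simp⟩
  simp only [Finset.mem_filter, Finset.mem_univ, true_and, WeightedGraph.InSplit, peel_iff_isCore]

variable {G}

/-- A member of a split along a separator is smaller. -/
theorem WeightedGraph.InSplit.card_lt {H C R : Finset V} (h : G.InSplit d τ (H \ C) C R)
    (hC : G.IsSeparator H C) : R.card < H.card := by
  obtain ⟨-, S, hS, hR⟩ := h
  refine Finset.card_lt_card (hR.1.trans_ssubset ?_)
  refine Finset.ssubset_iff_subset_ne.2
    ⟨Finset.union_subset (hS.1.trans Finset.sdiff_subset) hC.1, fun heq => hC.2 ?_⟩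
  have : H \ C = S := by
    refine subset_antisymm (fun x hx => ?_) hS.1
    rw [Finset.mem_sdiff, ← heq, Finset.mem_union] at hx
    exact hx.1.resolve_right hx.2
  rw [this]
  exact hS.2.1.preconnected

theorem WeightedGraph.InSplit.subset {H C R : Finset V} (h : G.InSplit d τ (H \ C) C R)
    (hC : C ⊆ H) : R ⊆ H := by
  obtain ⟨-, S, hS, hR⟩ := h
  exact hR.1.trans (Finset.union_subset (hS.1.trans Finset.sdiff_subset) hC)

theorem WeightedGraph.InSplit.degIn {H C R : Finset V} (h : G.InSplit d τ (H \ C) C R) :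
    ∀ v ∈ R, d < G.degIn R v := by
  obtain ⟨-, S, -, hR⟩ := h
  exact hR.2.1

/-- Splitting a core along the empty set gives its components. -/
theorem inSplit_empty_iff {H : Finset V} (hH : ∀ v ∈ H, d < G.degIn H v) (R : Finset V) :
    G.InSplit d τ (H \ ∅) ∅ R ↔ G.IsComponent H R ∧ τ + 1 ≤ R.card := by
  have key : ∀ S, G.IsComponent H S → G.IsCore d (S ∪ ∅) S := by
    intro S hS
    rw [Finset.union_empty]
    obtain ⟨h1, h2, -⟩ := (isComponent_iff G _ _).1 hS
    refine ⟨subset_rfl, fun v hv => ?_, fun T hT _ => hT⟩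
    have := degIn_closed G (C := ∅) (A := S) (H := H) (by simpa using h1) (by simp)
      (by simpa using h2) hv
    rw [Finset.union_empty] at this
    rw [this]
    exact hH v (h1 hv)
  rw [Finset.sdiff_empty, WeightedGraph.InSplit, and_comm]
  refine and_congr_left fun _ => ⟨?_, fun h => ⟨R, h, key R h⟩⟩
  rintro ⟨S, hS, hR⟩
  rwa [isCore_unique G hR (key S hS)]

/-- This is what keeps the loop going: a split never leaves the program without a member of
non-negative excess. -/
theorem exists_inSplit {w : ℝ} {H C : Finset V} (hd : 0 < d) (hw : 0 < w)
    (hH : ∀ u ∈ H, ∀ v ∈ H, G.mat u v ≤ w) (hdeg : ∀ v ∈ H, d < G.degIn H v)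
    (hf : 0 ≤ G.excess d (connBound d w) H) (hC : C ⊆ H) (hne : (H \ C).Nonempty)
    (hcard : C.card < connBound d w) :
    ∃ R, G.InSplit d (connBound d w) (H \ C) C R ∧ 0 ≤ G.excess d (connBound d w) R := by
  obtain ⟨S, hS, h⟩ := exists_split G hd hw hH hdeg hf hC hne hcard
  obtain ⟨R, hR⟩ := exists_peel G d (S ∪ C)
  have hcore := isCore_of_peel G hR
  exact ⟨R, ⟨(h R hcore).2, S, hS, hcore⟩, (h R hcore).1⟩

theorem separator_nonempty {H C : Finset V} (h : G.IsSeparator H C) : (H \ C).Nonempty := by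
  obtain ⟨-, A, hA, hne, -⟩ := (isSeparator_iff G H C).1 h
  exact hne.mono hA

end

section

variable {n N : ℕ} {G : WeightedGraph (Fin n)} {σ : Store}

/-- The states of the main loop for the input `D`. -/
structure MaderInv (G : WeightedGraph (Fin n)) (D : Finset (Fin n)) (σ : Store) : Prop where
  ctx : Ctx G σ
  d_eq : σ.realVar 1 = G.density D
  τ_eq : σ.natVar 16 = connBound (G.density D) (G.wmaxIn D)
  result : (σ.natVar 17 = 1 ∧ MaderSubgraph G D (msk n (σ.natArr 10))) ∨
    (σ.natVar 17 = 0 ∧ ¬ G.graph.IsClique (msk n (σ.natArr 6) : Set (Fin n)) ∧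
      msk n (σ.natArr 6) ⊆ D ∧
      (∀ v ∈ msk n (σ.natArr 6), G.density D < G.degIn (msk n (σ.natArr 6)) v) ∧
      0 ≤ G.excess (G.density D) (connBound (G.density D) (G.wmaxIn D)) (msk n (σ.natArr 6)) ∧
      ∃ 𝓗, msk n (σ.natArr 6) ∈ 𝓗 ∧ ∀ R, MaderLoop G (G.density D)
        (connBound (G.density D) (G.wmaxIn D)) 𝓗 R → MaderSubgraph G D R)

/-- The measure of the main loop. -/
def maderMeasure (n : ℕ) (σ : Store) : ℕ :=
  if σ.natVar 17 = 1 then 0 else (msk n (σ.natArr 6)).card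

theorem card_pos_of_not_isClique {H : Finset (Fin n)}
    (h : ¬ G.graph.IsClique (H : Set (Fin n))) : 0 < H.card := by
  obtain ⟨C, -, hC⟩ := exists_separator G h
  omega

/-- The family exists only in the invariant, together with the promise that every outcome of the
loop started from it is an outcome of the procedure. Each branch of the program corresponds to one
constructor of `MaderLoop`, always applied to the tracked member, which becomes smaller. -/
theorem maderStep_spec {D : Finset (Fin n)} (hN : n + n < N) (hd : 0 < G.density D)
    (h : MaderInv G D σ) : MaderInv G D (maderStep.den N σ) ∧
    (σ.natVar 17 = 1 → (maderStep.den N σ).natVar 17 = 1) ∧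
    (¬ σ.natVar 17 = 1 → maderMeasure n (maderStep.den N σ) < maderMeasure n σ) := by
  have hn : n ≤ N := by omega
  set τ := connBound (G.density D) (G.wmaxIn D) with hτ
  have hB : (Ex.var 17).Holds N σ ↔ 1 ≤ σ.natVar 17 := Ex.holds_var N σ 17
  rw [maderStep, Stmt.den_ite]
  rcases h.result with hfound | ⟨h17, hcl, hsub, hdeg, hex, 𝓗, hmem, h𝓗⟩
  · rw [if_pos (hB.2 hfound.1.ge), Stmt.den_skip]
    exact ⟨h, fun _ => hfound.1, fun hn => absurd hfound.1 hn⟩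
  rw [if_neg (fun hh => by have := hB.1 hh; omega), Stmt.den_seq]
  have hcur : 0 < (msk n (σ.natArr 6)).card := card_pos_of_not_isClique hcl
  have hm0 : maderMeasure n σ = (msk n (σ.natArr 6)).card := if_neg (by omega)
  rw [hm0]
  obtain ⟨hctx, hd1, hτ1, -⟩ := h
  set H := msk n (σ.natArr 6) with hH
  rcases minSep_spec hctx hN with ⟨-, hcl'⟩ | ⟨hC, hs⟩
  · exact absurd hcl' hcl
  set σ1 := minSep.den N σ with h1
  have c1 : Ctx G σ1 := hctx.den rfl rfl
  set C := msk n (σ1.natArr 7) with hCdef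
  rw [← hH] at hC
  have a6 : msk n (σ1.natArr 6) = H := by rw [h1, Stmt.natArr_den N _ rfl]
  have d1 : σ1.realVar 1 = G.density D := by rw [h1, Stmt.realVar_den N _ rfl, hd1]
  have t1 : σ1.natVar 16 = τ := by rw [h1, Stmt.natVar_den N _ rfl, hτ1]
  have f1 : σ1.natVar 17 = 0 := by rw [h1, Stmt.natVar_den N _ rfl, h17]
  have hB2 : (Ex.le (.var 16) (.var 8)).Holds N σ1 ↔ τ ≤ C.card := by
    rw [Ex.holds_le, Ex.eval_var, Ex.eval_var, t1, hs]
  rw [Stmt.den_ite]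
  by_cases hle : τ ≤ C.card
  · rw [if_pos (hB2.2 hle), Stmt.den_seq, Stmt.den_set_nat, Ex.eval_const]
    have e10 : msk n (((Stmt.copyM 10 6).den N σ1).natArr 10) = H := by rw [msk_copyM hn, a6]
    refine ⟨⟨(c1.den rfl rfl).setNat (by decide), ?_, ?_, Or.inl ⟨by simp, ?_⟩⟩,
      fun _ => by simp, fun _ => ?_⟩
    · rw [realVar_setNat, Stmt.realVar_den N _ rfl, d1]
    · rw [natVar_setNat, if_neg (by decide), Stmt.natVar_den N _ rfl, t1]
    · rw [natArr_setNat, e10]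
      exact h𝓗 H (.found 𝓗 H C hmem hC hle)
    · rw [maderMeasure, if_pos (by simp)]
      exact hcur
  rw [if_neg (fun hh => hle (hB2.1 hh))]
  obtain ⟨𝓗', hsplit, h𝓗'⟩ := exists_isSplit G (d := G.density D) (τ := τ) H C
  have c2 : Ctx G (split.den N σ1) := c1.den rfl rfl
  have d2 : (split.den N σ1).realVar 1 = G.density D := by rw [Stmt.realVar_den N _ rfl, d1]
  have t2 : (split.den N σ1).natVar 16 = τ := by rw [Stmt.natVar_den N _ rfl, t1]
  rcases split_spec c1 hn d1 t1 f1 a6 rfl with ⟨g1, g2, g3⟩ | ⟨g1, g2⟩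
  · refine ⟨⟨c2, d2, t2, Or.inl ⟨g1, ?_⟩⟩, fun _ => g1, fun _ => ?_⟩
    · exact h𝓗 _ (.clique 𝓗 𝓗' H C _ hmem hC (not_le.1 hle) hsplit ((h𝓗' _).2 g2) g3)
    · rw [maderMeasure, if_pos g1]
      exact hcur
  -- Some member has non-negative excess; hence the scan has stored one, not necessarily this one.
  · obtain ⟨R, hR, hexR⟩ := exists_inSplit hd (wmaxIn_pos G hd)
      (fun u hu v hv => mat_le_wmaxIn G (hsub hu) (hsub hv)) hdeg hex hC.1.1
      (separator_nonempty hC.1) (not_le.1 hle)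
    obtain ⟨k1, k2, k3⟩ := (g2 R hR).2 hexR
    refine ⟨⟨c2, d2, t2, Or.inr ⟨g1, k2, (k1.subset hC.1.1).trans hsub, k1.degIn, k3,
      𝓗.erase H ∪ 𝓗', Finset.mem_union_right _ ((h𝓗' _).2 k1), fun K hK => ?_⟩⟩,
      fun h => by omega, fun _ => ?_⟩
    · exact h𝓗 K (.next 𝓗 𝓗' H C K hmem hC (not_le.1 hle) hsplit
        (fun K hK => (g2 K ((h𝓗' K).1 hK)).1) hK)
    · rw [maderMeasure, if_neg (by omega)]
      exact k1.card_lt hC.1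

theorem maderInit_spec (hσ : Ctx G σ) (hN : n ≤ N) {D : Finset (Fin n)}
    (hD : msk n (σ.natArr 9) = D) (hd : 0 < G.density D) :
    Ctx G (maderInit.den N σ) ∧ (maderInit.den N σ).realVar 1 = G.density D ∧
    (maderInit.den N σ).natVar 16 = connBound (G.density D) (G.wmaxIn D) ∧
    (maderInit.den N σ).natVar 17 = 0 ∧
    G.IsCore (G.density D) D (msk n ((maderInit.den N σ).natArr 6)) ∧
    msk n ((maderInit.den N σ).natArr 7) = ∅ := by
  rw [maderInit, Stmt.den_seq, Stmt.den_seq, Stmt.den_seq, Stmt.den_seq, Stmt.den_seq,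
    Stmt.den_seq, Stmt.den_seq, Stmt.den_set_nat, Stmt.den_set_nat, Stmt.den_set_real,
    Stmt.den_set_real, hσ.dens hN, hD]
  have c1 : Ctx G (σ.setReal 1 (G.density D)) := ⟨hσ.n_eq, hσ.mat⟩
  have hE : (G.edgesIn (msk n ((σ.setReal 1 (G.density D)).natArr 9))).Nonempty := by
    rw [natArr_setReal, hD]; exact edgesIn_nonempty_of_density_pos G hd
  rw [c1.maxWeight hN 9 hE, natArr_setReal, hD]
  set σ2 := (σ.setReal 1 (G.density D)).setReal 4 (G.wmaxIn D) with h2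
  have hw := wmaxIn_pos G hd
  have hcb : Ex.connBound.eval N σ2 = connBound (G.density D) (G.wmaxIn D) := by
    refine Ex.eval_connBound (by simp [h2]) (by simp [h2]) hw ?_
    refine (density_le_mul hw.le fun u hu v hv => mat_le_wmaxIn G hu hv).trans ?_
    refine mul_le_mul_of_nonneg_left ?_ hw.le
    have := Finset.card_le_univ D
    rw [Fintype.card_fin] at this
    exact_mod_cast this.trans hN
  rw [hcb]
  set σ3 := σ2.setNat 16 (connBound (G.density D) (G.wmaxIn D)) with h3
  have c3 : Ctx G σ3 := ⟨by simp [h3, h2, hσ.n_eq], hσ.mat⟩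
  set σ4 := (Stmt.copyM 5 9).den N σ3 with h4
  have c4 : Ctx G σ4 := c3.den rfl rfl
  have e5 : msk n (σ4.natArr 5) = D := by
    rw [h4, msk_copyM hN]; exact hD
  have d4 : σ4.realVar 1 = G.density D := by
    rw [h4, Stmt.realVar_den N _ rfl]; simp [h3, h2]
  have hcore := core_spec c4 hN
  rw [e5, d4] at hcore
  set σ5 := corePeel.den N σ4 with h5
  have c5 : Ctx G σ5 := c4.den rfl rfl
  refine ⟨((c5.den rfl rfl).den rfl rfl).setNat (by decide), ?_, ?_, by simp, ?_, ?_⟩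
  · rw [realVar_setNat, Stmt.realVar_den N _ rfl, Stmt.realVar_den N _ rfl, h5,
      Stmt.realVar_den N _ rfl, d4]
  · rw [natVar_setNat, if_neg (by decide), Stmt.natVar_den N _ rfl, Stmt.natVar_den N _ rfl, h5,
      Stmt.natVar_den N _ rfl, h4, Stmt.natVar_den N _ rfl]
    simp [h3]
  · rw [natArr_setNat, Stmt.natArr_den N _ rfl, msk_copyM hN]
    exact hcore
  · rw [natArr_setNat]
    ext x
    rw [mem_setM hN]
    simp

theorem mader_spec (hσ : Ctx G σ) (hN : n + n < N) (hd : 0 < G.density (msk n (σ.natArr 9))) :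
    MaderSubgraph G (msk n (σ.natArr 9)) (msk n ((mader.den N σ).natArr 10)) := by
  have hn : n ≤ N := by omega
  set D := msk n (σ.natArr 9) with hD
  set τ := connBound (G.density D) (G.wmaxIn D) with hτ
  rw [mader, Stmt.den_seq, Stmt.den_seq, Stmt.den_rep]
  obtain ⟨c1, d1, t1, f1, hcore, hempty⟩ := maderInit_spec (N := N) hσ hn hD.symm hd
  set σ1 := maderInit.den N σ
  set H := msk n (σ1.natArr 6) with hH
  have hDne : D.Nonempty := by
    rw [Finset.nonempty_iff_ne_empty]
    intro h
    simp [h, WeightedGraph.density] at hd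
  obtain ⟨hHne, hex⟩ := core_density G (G.wmaxIn D) hDne hd hcore
  have hinv : MaderInv G D (split.den N σ1) := by
    have c2 : Ctx G (split.den N σ1) := c1.den rfl rfl
    have d2 : (split.den N σ1).realVar 1 = G.density D := by rw [Stmt.realVar_den N _ rfl, d1]
    have t2 : (split.den N σ1).natVar 16 = τ := by rw [Stmt.natVar_den N _ rfl, t1]
    -- In a core every component keeps its degrees, so splitting along `∅` gives the components with
    -- at least `τ + 1` vertices.
    obtain ⟨𝓗, -, h𝓗⟩ := exists_isSplit G (d := G.density D) (τ := τ) H ∅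
    have hfam : ∀ S, S ∈ 𝓗 ↔ G.IsComponent H S ∧ τ + 1 ≤ S.card :=
      fun S => (h𝓗 S).trans (inSplit_empty_iff hcore.2.1 S)
    have hpeel := (peel_iff_isCore G).2 hcore
    rcases split_spec c1 hn d1 t1 f1 rfl hempty with ⟨g1, g2, g3⟩ | ⟨g1, g2⟩
    · exact ⟨c2, d2, t2, Or.inl ⟨g1, H, 𝓗, hpeel, hfam, Or.inl ⟨(h𝓗 _).2 g2, g3⟩⟩⟩
    · obtain ⟨R, hR, hexR⟩ := exists_inSplit (C := ∅) hd (wmaxIn_pos G hd)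
        (fun u hu v hv => mat_le_wmaxIn G (hcore.1 hu) (hcore.1 hv)) hcore.2.1 hex (by simp)
        (by simpa using hHne) (by have := connBound_pos (G.density D) (G.wmaxIn D); simp; omega)
      obtain ⟨k1, k2, k3⟩ := (g2 R hR).2 hexR
      refine ⟨c2, d2, t2, Or.inr ⟨g1, k2, (k1.subset (by simp)).trans hcore.1, k1.degIn, k3,
        𝓗, (h𝓗 _).2 k1, fun K hK => ⟨H, 𝓗, hpeel, hfam, Or.inr ⟨fun K hK => ?_, hK⟩⟩⟩⟩
      exact (g2 K ((h𝓗 K).1 hK)).1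
  have hm : maderMeasure n (split.den N σ1) ≤ N := by
    unfold maderMeasure
    split_ifs
    · omega
    · refine (Finset.card_le_univ _).trans ?_
      rwa [Fintype.card_fin]
  obtain ⟨h1, h2⟩ := iterate_done (f := maderStep.den N) (I := MaderInv G D)
    (D := fun τ => τ.natVar 17 = 1) (maderMeasure n)
    (fun x hx => (maderStep_spec hN hd hx).1) (fun x hx => (maderStep_spec hN hd hx).2.1)
    (fun x hx => (maderStep_spec hN hd hx).2.2) N _ hinv hm
  rcases h1.result with h | h
  · exact h.2
  · exact absurd h2 (by omega)

end

/-! ### Enumeration of the maximal `k`-vertex-connected subgraphs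

The columns of array 14 are a stack with the pointer in variable 19, the columns of array 15 are the
results, and their number is in variable 20. -/

/-- The vertex set that is stored in a column of an array. -/
def col (n : ℕ) (A : ℕ → ℕ → ℕ) (i : ℕ) : Finset (Fin n) :=
  Finset.univ.filter (fun v => 1 ≤ A v i)

theorem mem_col {n : ℕ} {A : ℕ → ℕ → ℕ} {i : ℕ} {v : Fin n} : v ∈ col n A i ↔ 1 ≤ A v i := by
  simp [col]

/-- Sets the column of the array `a` with the given index to the vertices `10` with the given
property. -/
def Stmt.setCol (a : ℕ) (j e : Ex .nat) : Stmt :=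
  .fill (t := .nat) a 10 11 (.ite (.eq (.var 11) j) e (.read a (.var 10) (.var 11)))

/-- The column of the array `a` with the index `j` is copied to the array `b`. -/
def Stmt.getCol (b a : ℕ) (j : Ex .nat) : Stmt := .setM b (.read a (.var 10) j)

/-- A single component `A` of `H \ C` is separated: `H` is replaced by `A ∪ C` and `H \ A`, and each
`k`-vertex-connected subset of `H` lies in one of the two. -/
def enumSplit : Stmt :=
  .seq (.setM 3 (.and (.mem 6 10) (.not (.mem 7 10)))) <|
  .seq (.set (t := .nat) 7 (.find 10 (.and (.isV 10) (.mem 3 10)))) <| .seq reach <|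
  .seq (.setCol 14 (.var 19) (.or (.mem 4 10) (.mem 7 10))) <|
  .seq (.setCol 14 (.add (.var 19) (.const 1)) (.and (.mem 6 10) (.not (.mem 4 10)))) <|
  .set (t := .nat) 19 (.add (.var 19) (.const 2))

def enumStep : Stmt :=
  .ite (.var 19)
    (.seq (.set (t := .nat) 19 (.sub (.var 19) (.const 1))) <| .seq (.getCol 6 14 (.var 19)) <|
      .ite (.lt (.var 1) (.card 6))
        (.seq minSep <| .ite (.le (.var 1) (.var 8))
          (.seq (.setCol 15 (.var 20) (.mem 6 10)) (.set (t := .nat) 20 (.add (.var 20) (.const 1))))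
          enumSplit)
        .skip)
    .skip

def enum : Stmt :=
  .seq (.fill (t := .nat) 14 10 11 (.const 1)) <| .seq (.set (t := .nat) 19 (.const 1)) <|
  .seq (.set (t := .nat) 20 (.const 0)) (.rep enumStep)

section

variable {n N : ℕ} {G : WeightedGraph (Fin n)} {σ : Store}

theorem col_setCol (hN : n ≤ N) (a : ℕ) (j e : Ex .nat) {j' : ℕ} {S : Finset (Fin n)}
    (hj : ∀ u v, (j.eval N ((σ.setNat 10 u).setNat 11 v) : ℕ) = j')
    (he : ∀ (v : Fin n) i, e.Holds N ((σ.setNat 10 v).setNat 11 i) ↔ v ∈ S) {i : ℕ} (hi : i < N) :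
    col n (((Stmt.setCol a j e).den N σ).natArr a) i =
      if i = j' then S else col n (σ.natArr a) i := by
  ext v
  have hv : (v : ℕ) < N := v.2.trans_le hN
  rw [mem_col, Stmt.setCol, Stmt.den_fill_nat, natArr_putArr, if_pos rfl, if_pos ⟨hv, hi⟩,
    Ex.eval_ite]
  have hB : (Ex.eq (.var 11) j).Holds N ((σ.setNat 10 v).setNat 11 i) ↔ i = j' := by
    rw [Ex.holds_eq, hj]; simp
  by_cases h : i = j'
  · rw [if_pos (hB.2 h), if_pos h, ← he v i]
    exact Iff.rfl
  · rw [if_neg (fun hh => h (hB.1 hh)), if_neg h, mem_col]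
    simp

theorem msk_getCol (hN : n ≤ N) (b a : ℕ) (j : Ex .nat) {j' : ℕ}
    (hj : ∀ u v, (j.eval N ((σ.setNat 10 u).setNat 11 v) : ℕ) = j') :
    msk n (((Stmt.getCol b a j).den N σ).natArr b) = col n (σ.natArr a) j' := by
  ext v
  rw [Stmt.getCol, mem_setM hN, Ex.holds_read, hj, mem_col]
  simp

/-- The weight of a set on the stack. -/
def stackWeight (k : ℕ) (H : Finset (Fin n)) : ℕ := 2 * (H.card - k) + 1

def stackMeasure (n k : ℕ) (σ : Store) : ℕ :=
  ∑ i ∈ Finset.range (σ.natVar 19), stackWeight k (col n (σ.natArr 14) i)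

/-- Since every set on the stack has weight at least `1`, `bound` limits the height of the stack and
the number of results alike; both fit into `N` columns. -/
structure EnumInv (G : WeightedGraph (Fin n)) (k : ℕ) (σ : Store) : Prop where
  ctx : Ctx G σ
  k_eq : σ.natVar 1 = k
  bound : stackMeasure n k σ + σ.natVar 20 ≤ n + n + 1
  isConn : ∀ i < σ.natVar 20, G.IsConn k (col n (σ.natArr 15) i)
  cover : ∀ T, G.IsConn k T → (∃ i < σ.natVar 19, T ⊆ col n (σ.natArr 14) i) ∨
    ∃ i < σ.natVar 20, T ⊆ col n (σ.natArr 15) i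

theorem natVar_le_stackMeasure (k : ℕ) (σ : Store) : σ.natVar 19 ≤ stackMeasure n k σ := by
  have := Finset.card_nsmul_le_sum (Finset.range (σ.natVar 19))
    (fun i => stackWeight k (col n (σ.natArr 14) i)) 1 fun i _ => by unfold stackWeight; omega
  simpa [stackMeasure] using this

/-- The two parts of a split of a set. -/
theorem enumSplit_spec (hσ : Ctx G σ) (hN : n ≤ N)
    {H C : Finset (Fin n)} (hH : msk n (σ.natArr 6) = H) (hC : msk n (σ.natArr 7) = C)
    (hne : (H \ C).Nonempty) :
    ∃ A, G.IsComponent (H \ C) A ∧ (enumSplit.den N σ).natVar 19 = σ.natVar 19 + 2 ∧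
      ∀ i < N, col n ((enumSplit.den N σ).natArr 14) i = if i = σ.natVar 19 + 1 then H \ A else
        if i = σ.natVar 19 then A ∪ C else col n (σ.natArr 14) i := by
  rw [enumSplit, Stmt.den_seq, Stmt.den_seq, Stmt.den_seq, Stmt.den_seq, Stmt.den_seq,
    Stmt.den_set_nat, Stmt.den_set_nat]
  set σ1 := (Stmt.setM 3 (.and (.mem 6 10) (.not (.mem 7 10)))).den N σ with h1
  have c1 : Ctx G σ1 := hσ.den rfl rfl
  have u1 : msk n (σ1.natArr 3) = H \ C := by
    ext x
    rw [h1, mem_setM hN, Ex.holds_and, Ex.holds_not, Ex.holds_mem (v := x) (by simp),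
      Ex.holds_mem (v := x) (by simp), Finset.mem_sdiff, natArr_setNat, natArr_setNat, hH, hC]
  obtain ⟨v, hvU, hv⟩ : ∃ v : Fin n, v ∈ H \ C ∧
      (Ex.find 10 (.and (.isV 10) (.mem 3 10))).eval N σ1 = v := by
    have hB : ∀ i, (Ex.and (.isV 10) (.mem 3 10)).Holds N (σ1.setNat 10 i) ↔
        i < n ∧ 1 ≤ σ1.natArr 3 i 0 := by
      intro i
      simp [Ex.isV, Ex.mem, c1.n_eq]
    rcases Ex.find_spec N σ1 10 (.and (.isV 10) (.mem 3 10)) with ⟨-, h⟩ | ⟨-, h⟩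
    · obtain ⟨ha, hb⟩ := (hB _).1 h
      exact ⟨⟨_, ha⟩, u1 ▸ mem_msk.2 hb, rfl⟩
    · obtain ⟨x, hx⟩ := hne
      rw [← u1, mem_msk] at hx
      exact absurd ((hB x).2 ⟨x.2, hx⟩) (h x (x.2.trans_le hN))
  rw [hv]
  have c2 : Ctx G (σ1.setNat 7 v) := c1.setNat (by decide)
  have hreach := reach_spec (v := v) c2 hN (by simp) (by rw [natArr_setNat, u1]; exact hvU)
  rw [natArr_setNat, u1] at hreach
  set σ2 := reach.den N (σ1.setNat 7 v) with h2
  set A := msk n (σ2.natArr 4) with hA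
  have a6 : msk n (σ2.natArr 6) = H := by
    rw [h2, Stmt.natArr_den N _ rfl, natArr_setNat, h1, Stmt.natArr_den N _ rfl, hH]
  have a7 : msk n (σ2.natArr 7) = C := by
    rw [h2, Stmt.natArr_den N _ rfl, natArr_setNat, h1, Stmt.natArr_den N _ rfl, hC]
  have a14 : σ2.natArr 14 = σ.natArr 14 := by
    rw [h2, Stmt.natArr_den N _ rfl, natArr_setNat, h1, Stmt.natArr_den N _ rfl]
  have n19 : σ2.natVar 19 = σ.natVar 19 := by
    rw [h2, Stmt.natVar_den N _ rfl, natVar_setNat, if_neg (by decide), h1,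
      Stmt.natVar_den N _ rfl]
  set σ3 := (Stmt.setCol 14 (.var 19) (.or (.mem 4 10) (.mem 7 10))).den N σ2 with h3
  have k3 : ∀ i < N, col n (σ3.natArr 14) i =
      if i = σ.natVar 19 then A ∪ C else col n (σ.natArr 14) i := by
    intro i hi
    rw [h3, col_setCol hN 14 _ _ (j' := σ.natVar 19) (S := A ∪ C) (by simp [n19]) ?_ hi, a14]
    intro x i
    rw [Ex.holds_or, Ex.holds_mem (v := x) (by simp), Ex.holds_mem (v := x) (by simp),
      natArr_setNat, natArr_setNat, ← hA, a7, Finset.mem_union]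
  have b6 : msk n (σ3.natArr 6) = H := by rw [h3, Stmt.natArr_den N _ rfl, a6]
  have b4 : msk n (σ3.natArr 4) = A := by rw [h3, Stmt.natArr_den N _ rfl]
  have m19 : σ3.natVar 19 = σ.natVar 19 := by rw [h3, Stmt.natVar_den N _ rfl, n19]
  refine ⟨A, hreach.1, ?_, fun i hi => ?_⟩
  · rw [natVar_setNat, if_pos rfl, Ex.eval_add, Ex.eval_var, Ex.eval_const,
      Stmt.natVar_den N _ rfl, m19]
  · rw [natArr_setNat, col_setCol hN 14 _ _ (j' := σ.natVar 19 + 1) (S := H \ A)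
      (by simp [m19]) ?_ hi, k3 i hi]
    intro x i
    rw [Ex.holds_and, Ex.holds_not, Ex.holds_mem (v := x) (by simp),
      Ex.holds_mem (v := x) (by simp), natArr_setNat, natArr_setNat, b4, b6, Finset.mem_sdiff]

/-- If both parts have more than `k` vertices, the weights sum to `2 (|H| + |C| - 2k) + 2`, and `|C|
< k`. If one part is small, its weight is `1` and the other part is a proper subset of `H`, which
saves `2` compared with `H`. -/
theorem stackWeight_split {k : ℕ} {H C A : Finset (Fin n)} (hC : G.IsSeparator H C)
    (hA : G.IsComponent (H \ C) A) (hk : k < H.card) (hCk : C.card < k) :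
    stackWeight k (A ∪ C) + stackWeight k (H \ A) < stackWeight k H := by
  obtain ⟨h1, h2, h3, h4⟩ := (isComponent_iff G _ _).1 hA
  have hAH : A ⊆ H := h1.trans Finset.sdiff_subset
  have hdisj : Disjoint A C := Finset.disjoint_of_subset_left h1 Finset.sdiff_disjoint
  have e1 : (A ∪ C).card = A.card + C.card := Finset.card_union_of_disjoint hdisj
  have e2 : (H \ A).card = H.card - A.card := Finset.card_sdiff_of_subset hAH
  have e3 : 0 < A.card := h3.card_pos
  have e4 : A.card + C.card < H.card := by
    rw [← e1]
    refine Finset.card_lt_card (Finset.ssubset_iff_subset_ne.2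
      ⟨Finset.union_subset hAH hC.1, fun heq => hC.2 ?_⟩)
    have : H \ C = A := by
      refine subset_antisymm (fun x hx => ?_) h1
      rw [Finset.mem_sdiff, ← heq, Finset.mem_union] at hx
      exact hx.1.resolve_right hx.2
    rw [this]
    exact hA.2.1.preconnected
  unfold stackWeight
  rw [e1, e2]
  omega

theorem enumStep_spec {k : ℕ} (hk : 0 < k) (hN : n + n + 1 < N) (h : EnumInv G k σ) :
    EnumInv G k (enumStep.den N σ) ∧ (σ.natVar 19 = 0 → (enumStep.den N σ).natVar 19 = 0) ∧
    (¬ σ.natVar 19 = 0 → stackMeasure n k (enumStep.den N σ) < stackMeasure n k σ) := by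
  have hn : n ≤ N := by omega
  obtain ⟨hctx, hk1, hbound, hconn, hcover⟩ := h
  have hB : (Ex.var 19).Holds N σ ↔ 1 ≤ σ.natVar 19 := Ex.holds_var N σ 19
  rw [enumStep, Stmt.den_ite]
  rcases Nat.eq_zero_or_pos (σ.natVar 19) with h0 | hpos
  · rw [if_neg (fun hh => by have := hB.1 hh; omega), Stmt.den_skip]
    exact ⟨⟨hctx, hk1, hbound, hconn, hcover⟩, fun h => h, fun hh => absurd h0 hh⟩
  rw [if_pos (hB.2 hpos), Stmt.den_seq, Stmt.den_seq, Stmt.den_set_nat]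
  obtain ⟨m, hm⟩ : ∃ m, σ.natVar 19 = m + 1 := ⟨σ.natVar 19 - 1, by omega⟩
  have hmle := natVar_le_stackMeasure (n := n) k σ
  have hμ : stackMeasure n k σ = ∑ i ∈ Finset.range m, stackWeight k (col n (σ.natArr 14) i) +
      stackWeight k (col n (σ.natArr 14) m) := by
    rw [stackMeasure, hm, Finset.sum_range_succ]
  rw [show (Ex.sub (.var 19) (.const 1)).eval N σ = m by
    rw [Ex.eval_sub, Ex.eval_var, Ex.eval_const, hm]; rfl]
  set H := col n (σ.natArr 14) m with hH
  set σ1 := (Stmt.getCol 6 14 (.var 19)).den N (σ.setNat 19 m) with h1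
  have c1 : Ctx G σ1 := (hctx.setNat (by decide)).den rfl rfl
  have a6 : msk n (σ1.natArr 6) = H := by
    rw [h1, msk_getCol hn 6 14 _ (j' := m) (by simp)]; rfl
  have v1 : ∀ x, σ1.natVar x = if x = 19 then m else σ.natVar x := by
    intro x
    rw [h1, Stmt.natVar_den N _ rfl, natVar_setNat]
  have a1 : ∀ a, a = 14 ∨ a = 15 → σ1.natArr a = σ.natArr a := by
    rintro a (rfl | rfl) <;> rw [h1, Stmt.natArr_den N _ rfl, natArr_setNat]
  have hcover' : ∀ T, G.IsConn k T → (∃ i < m, T ⊆ col n (σ.natArr 14) i) ∨ T ⊆ H ∨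
      ∃ i < σ.natVar 20, T ⊆ col n (σ.natArr 15) i := by
    intro T hT
    rcases hcover T hT with ⟨i, hi, hTi⟩ | h
    · rw [hm] at hi
      rcases Nat.lt_succ_iff_lt_or_eq.1 hi with hlt | rfl
      · exact Or.inl ⟨i, hlt, hTi⟩
      · exact Or.inr (Or.inl hTi)
    · exact Or.inr (Or.inr h)
  have hwH : 0 < stackWeight k H := by unfold stackWeight; omega
  have hB1 : (Ex.lt (.var 1) (.card 6)).Holds N σ1 ↔ k < H.card := by
    rw [Ex.holds_lt, Ex.eval_var, v1, if_neg (by decide), hk1, c1.card hn, a6]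
  rw [Stmt.den_ite]
  by_cases hkH : k < H.card
  swap
  · rw [if_neg (fun hh => hkH (hB1.1 hh)), Stmt.den_skip]
    have hμ1 : stackMeasure n k σ1 =
        ∑ i ∈ Finset.range m, stackWeight k (col n (σ.natArr 14) i) := by
      rw [stackMeasure, v1, if_pos rfl, a1 14 (by decide)]
    refine ⟨⟨c1, ?_, ?_, ?_, fun T hT => ?_⟩, fun h => by omega, fun _ => by omega⟩
    · rw [v1, if_neg (by decide), hk1]
    · rw [hμ1, v1, if_neg (by decide)]; omega
    · rw [v1, if_neg (by decide), a1 15 (by decide)]; exact hconn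
    · rw [v1, v1, if_pos rfl, if_neg (by decide), a1 15 (by decide), a1 14 (by decide)]
      rcases hcover' T hT with h | h | h
      · exact Or.inl h
      · have h5 := card_of_isConn G hk hT
        have h6 := Finset.card_le_card h
        omega
      · exact Or.inr h
  rw [if_pos (hB1.2 hkH), Stmt.den_seq]
  have hHn : H.card ≤ n := by
    refine (Finset.card_le_univ _).trans ?_
    rw [Fintype.card_fin]
  have hsep := minSep_spec c1 (N := N) (by omega)
  rw [a6] at hsep
  set σ2 := minSep.den N σ1 with h2
  have c2 : Ctx G σ2 := c1.den rfl rfl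
  have b6 : msk n (σ2.natArr 6) = H := by rw [h2, Stmt.natArr_den N _ rfl, a6]
  have v2 : ∀ x, x = 1 ∨ x = 19 ∨ x = 20 → σ2.natVar x = if x = 19 then m else σ.natVar x := by
    rintro x (rfl | rfl | rfl) <;> rw [h2, Stmt.natVar_den N _ rfl, v1]
  have a2 : ∀ a, a = 14 ∨ a = 15 → σ2.natArr a = σ.natArr a := by
    rintro a (rfl | rfl) <;> rw [h2, Stmt.natArr_den N _ rfl, a1 _ (by decide)]
  have hB2 : (Ex.le (.var 1) (.var 8)).Holds N σ2 ↔ k ≤ σ2.natVar 8 := by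
    rw [Ex.holds_le, Ex.eval_var, Ex.eval_var, v2 1 (by decide), if_neg (by decide), hk1]
  rw [Stmt.den_ite]
  by_cases hle : k ≤ σ2.natVar 8
  · rw [if_pos (hB2.2 hle), Stmt.den_seq, Stmt.den_set_nat]
    have hHconn : G.IsConn k H := by
      rw [isConn_iff G hk]
      rcases hsep with ⟨-, hcl⟩ | ⟨hC, hs⟩
      · exact Or.inl ⟨hcl, hkH⟩
      · refine Or.inr ⟨not_isClique_of_isSeparator G hC.1, fun C' hC' => ?_⟩
        rw [hs] at hle
        exact hle.trans (hC.2 C' hC')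
    set σ3 := (Stmt.setCol 15 (.var 20) (.mem 6 10)).den N σ2 with h3
    have c3 : Ctx G σ3 := c2.den rfl rfl
    have v3 : ∀ x, x = 1 ∨ x = 19 ∨ x = 20 → σ3.natVar x = if x = 19 then m else σ.natVar x := by
      intro x hx
      rw [h3, Stmt.natVar_den N _ rfl, v2 x hx]
    have a3 : σ3.natArr 14 = σ.natArr 14 := by rw [h3, Stmt.natArr_den N _ rfl, a2 14 (by decide)]
    have k3 : ∀ i < N, col n (σ3.natArr 15) i =
        if i = σ.natVar 20 then H else col n (σ.natArr 15) i := by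
      intro i hi
      rw [h3, col_setCol hn 15 _ _ (j' := σ.natVar 20) (S := H) ?_ ?_ hi, a2 15 (by decide)]
      · intro u v
        rw [Ex.eval_var, natVar_setNat, natVar_setNat, if_neg (by decide), if_neg (by decide),
          v2 20 (by decide), if_neg (by decide)]
      · intro x i
        rw [Ex.holds_mem (v := x) (by simp), natArr_setNat, natArr_setNat, b6]
    have e20 : (Ex.add (.var 20) (.const 1)).eval N σ3 = σ.natVar 20 + 1 := by
      rw [Ex.eval_add, Ex.eval_var, Ex.eval_const, v3 20 (by decide), if_neg (by decide)]
    rw [e20]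
    set σ4 := σ3.setNat 20 (σ.natVar 20 + 1) with h4
    have w20 : σ4.natVar 20 = σ.natVar 20 + 1 := by simp [h4]
    have w19 : σ4.natVar 19 = m := by
      rw [h4, natVar_setNat, if_neg (by decide), v3 19 (by decide), if_pos rfl]
    have hμ4 : stackMeasure n k σ4 =
        ∑ i ∈ Finset.range m, stackWeight k (col n (σ.natArr 14) i) := by
      rw [stackMeasure, w19, h4, natArr_setNat, a3]
    refine ⟨⟨c3.setNat (by decide), ?_, ?_, fun i hi => ?_, fun T hT => ?_⟩, fun h => by omega,
      fun _ => by omega⟩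
    · rw [h4, natVar_setNat, if_neg (by decide), v3 1 (by decide), if_neg (by decide), hk1]
    · rw [hμ4, w20]; omega
    · rw [w20] at hi
      rw [h4, natArr_setNat, k3 i (by omega)]
      split_ifs with h
      · exact hHconn
      · exact hconn i (by omega)
    · rw [w19, w20, h4, natArr_setNat, a3]
      rcases hcover' T hT with h | h | ⟨i, hi, hTi⟩
      · exact Or.inl h
      · refine Or.inr ⟨σ.natVar 20, by omega, ?_⟩
        rw [k3 _ (by omega), if_pos rfl]
        exact h
      · refine Or.inr ⟨i, by omega, ?_⟩
        rw [k3 _ (by omega), if_neg (by omega)]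
        exact hTi
  · rw [if_neg (fun hh => hle (hB2.1 hh))]
    -- A clique would report the size `N`, which exceeds `k` because `k < |H| ≤ n`.
    rcases hsep with ⟨hs, -⟩ | ⟨hC, hs⟩
    · omega
    set C := msk n (σ2.natArr 7) with hCdef
    rw [hs] at hle
    have w19 : σ2.natVar 19 = m := by rw [v2 19 (by decide), if_pos rfl]
    obtain ⟨A, hA, q19, q14⟩ := enumSplit_spec c2 hn b6 rfl (separator_nonempty hC.1)
    rw [w19] at q19 q14
    have hlt := stackWeight_split hC.1 hA hkH (by omega)
    set σ3 := enumSplit.den N σ2 with h3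
    have c3 : Ctx G σ3 := c2.den rfl rfl
    have a15 : σ3.natArr 15 = σ.natArr 15 := by rw [h3, Stmt.natArr_den N _ rfl, a2 15 (by decide)]
    have w20 : σ3.natVar 20 = σ.natVar 20 := by
      rw [h3, Stmt.natVar_den N _ rfl, v2 20 (by decide), if_neg (by decide)]
    have q1 : col n (σ3.natArr 14) (m + 1) = H \ A := by rw [q14 _ (by omega), if_pos rfl]
    have q2 : col n (σ3.natArr 14) m = A ∪ C := by
      rw [q14 _ (by omega), if_neg (by omega), if_pos rfl]
    have q3 : ∀ i < m, col n (σ3.natArr 14) i = col n (σ.natArr 14) i := by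
      intro i hi
      rw [q14 _ (by omega), if_neg (by omega), if_neg (by omega), a2 14 (by decide)]
    have hμ3 : stackMeasure n k σ3 = ∑ i ∈ Finset.range m, stackWeight k (col n (σ.natArr 14) i) +
        stackWeight k (A ∪ C) + stackWeight k (H \ A) := by
      rw [stackMeasure, q19, Finset.sum_range_succ, Finset.sum_range_succ, q1, q2]
      congr 2
      exact Finset.sum_congr rfl fun i hi => by rw [q3 i (Finset.mem_range.1 hi)]
    refine ⟨⟨c3, ?_, ?_, ?_, fun T hT => ?_⟩, fun h => by omega, fun _ => by omega⟩
    · rw [h3, Stmt.natVar_den N _ rfl, v2 1 (by decide), if_neg (by decide), hk1]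
    · rw [hμ3, w20]; omega
    · rw [w20, a15]; exact hconn
    · rw [w20, a15, q19]
      rcases hcover' T hT with ⟨i, hi, hTi⟩ | h | h
      · exact Or.inl ⟨i, by omega, by rwa [q3 i hi]⟩
      · obtain ⟨g1, g2, -⟩ := (isComponent_iff G _ _).1 hA
        rcases subset_of_isConn G hk hT h (not_le.1 hle) g2 with h5 | h5
        · exact Or.inl ⟨m, by omega, by rwa [q2]⟩
        -- `A` and `C` are disjoint, so `H \ (A \ C)` is the set `H \ A` on the stack.
        · refine Or.inl ⟨m + 1, by omega, ?_⟩
          rwa [q1, ← Finset.sdiff_eq_self_of_disjoint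
            (Finset.disjoint_of_subset_left g1 Finset.sdiff_disjoint)]
      · exact Or.inr h

/-- All results are `k`-vertex-connected, and every `k`-vertex-connected set is a subset of a
result. -/
theorem enum_spec (hσ : Ctx G σ) {k : ℕ} (hk : 0 < k) (hk1 : σ.natVar 1 = k)
    (hN : n + n + 1 < N) : (enum.den N σ).natVar 20 < N ∧
    (∀ i < (enum.den N σ).natVar 20, G.IsConn k (col n ((enum.den N σ).natArr 15) i)) ∧
    ∀ T, G.IsConn k T → ∃ i < (enum.den N σ).natVar 20, T ⊆ col n ((enum.den N σ).natArr 15) i := by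
  rw [enum, Stmt.den_seq, Stmt.den_seq, Stmt.den_seq, Stmt.den_rep, Stmt.den_set_nat,
    Stmt.den_set_nat, Ex.eval_const, Ex.eval_const]
  set σ1 := (Stmt.fill (t := .nat) 14 10 11 (.const 1)).den N σ with h1
  have c1 : Ctx G σ1 := hσ.den rfl rfl
  have k1 : col n (σ1.natArr 14) 0 = Finset.univ := by
    ext v
    rw [mem_col, h1, Stmt.den_fill_nat, natArr_putArr, if_pos rfl, if_pos (by omega)]
    simp
  set σ2 := (σ1.setNat 19 1).setNat 20 0 with h2
  have hμ : stackMeasure n k σ2 ≤ n + n + 1 := by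
    have : σ2.natVar 19 = 1 := by simp [h2]
    rw [stackMeasure, this, Finset.sum_range_one, h2, natArr_setNat, natArr_setNat, k1,
      stackWeight, Finset.card_univ, Fintype.card_fin]
    omega
  have e20 : σ2.natVar 20 = 0 := by simp [h2]
  obtain ⟨⟨-, -, g3, g4, g5⟩, g6⟩ := iterate_done (f := enumStep.den N) (I := EnumInv G k)
    (D := fun τ => τ.natVar 19 = 0) (stackMeasure n k)
    (fun x hx => (enumStep_spec hk hN hx).1) (fun x hx => (enumStep_spec hk hN hx).2.1)
    (fun x hx => (enumStep_spec hk hN hx).2.2) N σ2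
    ⟨(c1.setNat (by decide)).setNat (by decide), by simp [h2, h1, hk1], by omega,
      fun i hi => by omega, fun T _ => Or.inl ⟨0, by simp [h2], by
        rw [h2, natArr_setNat, natArr_setNat, k1]; exact Finset.subset_univ T⟩⟩ (by omega)
  refine ⟨by omega, g4, fun T hT => ?_⟩
  rcases g5 T hT with ⟨i, hi, -⟩ | h
  · omega
  · exact h

end

/-! ### The bicriteria algorithm -/

/-- The column `x` of array 15 is a subset of the column `y`. -/
def Ex.colLe (x y : ℕ) : Ex .nat :=
  .allV 10 (.or (.not (.read 15 (.var 10) (.var x))) (.read 15 (.var 10) (.var y)))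

/-- No other result contains the result with the index in variable 21. -/
def Ex.isMax : Ex .nat :=
  .and (.lt (.var 21) (.var 20)) <|
    .all 12 (.or (.not (.lt (.var 12) (.var 20))) (.or (.not (.colLe 21 12)) (.colLe 12 21)))

/-- The pass for the set in array 8, whose result is written to array 10. -/
def pass : Stmt :=
  .seq densest <| .seq (.setM 13 (.const 1)) <| .seq (.set (t := .real) 1 (.dens 9)) <|
  .seq (.set (t := .real) 4 (.maxWeight 13)) <| .seq (.set (t := .nat) 23 .connBound) <|
  .ite (.rle (.cast (.var 1)) (.rmul (.rvar 0) (.var 23))) mader (.copyM 10 8)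

/-- The maximality test makes it unnecessary to know that the enumeration lists only maximal sets,
or each of them once; connectedness and covering suffice. -/
def mainBody : Stmt :=
  .ite .isMax
    (.seq (.getCol 8 15 (.var 21)) <| .seq pass <|
      .ite (.or (.not (.var 24)) (.rle (.dens 0) (.dens 10)))
        (.seq (.copyM 0 10) (.set (t := .nat) 24 (.const 1))) .skip)
    .skip

/-- Variable `0` holds `n` until the very end, when it receives the flag that `readOutput` inspects.
-/
def bicriteria : Stmt :=
  .seq enum <| .seq (.set (t := .nat) 24 (.const 0)) <| .seq (.forAll 21 mainBody) <|
  .set (t := .nat) 0 (.var 24)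

section

variable {n N : ℕ} {G : WeightedGraph (Fin n)} {σ : Store}

theorem holds_colLe (hσ : Ctx G σ) (hN : n ≤ N) {x y : ℕ} (hx : x ≠ 10) (hy : y ≠ 10) :
    (Ex.colLe x y).Holds N σ ↔
      col n (σ.natArr 15) (σ.natVar x) ⊆ col n (σ.natArr 15) (σ.natVar y) := by
  rw [Ex.colLe, Ex.holds_allV hN hσ.n_eq (by decide)]
  refine forall_congr' fun v => ?_
  rw [Ex.holds_or, Ex.holds_not, Ex.holds_read, Ex.holds_read, mem_col, mem_col]
  simp only [Ex.eval_var, natVar_setNat, natArr_setNat, if_true, if_neg hx, if_neg hy]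
  tauto

theorem holds_isMax (hσ : Ctx G σ) (hN : n ≤ N) (h20 : σ.natVar 20 < N) :
    Ex.isMax.Holds N σ ↔ σ.natVar 21 < σ.natVar 20 ∧ ∀ j < σ.natVar 20,
      col n (σ.natArr 15) (σ.natVar 21) ⊆ col n (σ.natArr 15) j →
      col n (σ.natArr 15) j ⊆ col n (σ.natArr 15) (σ.natVar 21) := by
  rw [Ex.isMax, Ex.holds_and, Ex.holds_lt, Ex.holds_all]
  refine and_congr Iff.rfl ?_
  have key : ∀ j, (Ex.or (.not (.lt (.var 12) (.var 20))) (.or (.not (.colLe 21 12))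
      (.colLe 12 21))).Holds N (σ.setNat 12 j) ↔ (j < σ.natVar 20 →
      col n (σ.natArr 15) (σ.natVar 21) ⊆ col n (σ.natArr 15) j →
      col n (σ.natArr 15) j ⊆ col n (σ.natArr 15) (σ.natVar 21)) := by
    intro j
    have c := hσ.setNat (x := 12) (v := j) (by decide)
    rw [Ex.holds_or, Ex.holds_or, Ex.holds_not, Ex.holds_not, Ex.holds_lt,
      holds_colLe c hN (by decide) (by decide), holds_colLe c hN (by decide) (by decide)]
    simp only [Ex.eval_var, natVar_setNat, natArr_setNat, if_true]
    norm_num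
    rw [← not_lt]
    tauto
  simp only [key]
  exact ⟨fun h j hj => h j (hj.trans h20) hj, fun h j _ hj => h j hj⟩

theorem wmaxIn_univ : G.wmaxIn Finset.univ = G.wmax := by
  rw [WeightedGraph.wmaxIn, WeightedGraph.wmax]
  congr 2
  ext e
  simp [WeightedGraph.edgesIn]

theorem pass_spec (hσ : Ctx G σ) (hN : n + n + 1 < N) (he : G.graph.edgeSet.Nonempty) {k : ℕ}
    {γ : ℝ} (hk : 0 < k) (hk1 : σ.natVar 1 = k) (hγ : σ.realVar 0 = γ)
    (hS : G.IsConn k (msk n (σ.natArr 8))) :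
    BicriteriaPass G γ k (msk n (σ.natArr 8)) (msk n ((pass.den N σ).natArr 10)) := by
  have hn : n ≤ N := by omega
  set S := msk n (σ.natArr 8) with hSdef
  have hSne : S.Nonempty := Finset.card_pos.1 (by have := card_of_isConn G hk hS; omega)
  have hden := densest_spec (N := N) hσ (by omega) hSne
  rw [← hSdef] at hden
  rw [pass, Stmt.den_seq, Stmt.den_seq, Stmt.den_seq, Stmt.den_seq, Stmt.den_seq]
  set σ1 := densest.den N σ with h1
  have c1 : Ctx G σ1 := hσ.den rfl rfl
  set D := msk n (σ1.natArr 9) with hD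
  have hDpos : 0 < G.density D :=
    (density_pos_of_isConn G hk hS).trans_le (hden.2.2 S subset_rfl hSne)
  set σ2 := (Stmt.setM 13 (.const 1)).den N σ1 with h2
  have c2 : Ctx G σ2 := c1.den rfl rfl
  have a9 : msk n (σ2.natArr 9) = D := by rw [h2, natArr_setM _ _ (by decide)]
  have a8 : msk n (σ2.natArr 8) = S := by
    rw [h2, natArr_setM _ _ (by decide), h1, Stmt.natArr_den N _ rfl]
  have a13 : msk n (σ2.natArr 13) = Finset.univ := by
    ext v
    rw [h2, mem_setM hn]
    simp
  have n1 : σ2.natVar 1 = k := by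
    rw [h2, Stmt.natVar_den N _ rfl, h1, Stmt.natVar_den N _ rfl, hk1]
  have r0 : σ2.realVar 0 = γ := by
    rw [h2, Stmt.realVar_den N _ rfl, h1, Stmt.realVar_den N _ rfl, hγ]
  rw [Stmt.den_set_real, Stmt.den_set_real, Stmt.den_set_nat, c2.dens hn, a9]
  have c3 : Ctx G (σ2.setReal 1 (G.density D)) := ⟨c2.n_eq, c2.mat⟩
  have hE : (G.edgesIn (msk n ((σ2.setReal 1 (G.density D)).natArr 13))).Nonempty := by
    rw [natArr_setReal, a13]
    obtain ⟨e, he⟩ := he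
    exact ⟨e, by simpa [WeightedGraph.edgesIn] using he⟩
  rw [c3.maxWeight hn 13 hE, natArr_setReal, a13, wmaxIn_univ]
  set σ4 := (σ2.setReal 1 (G.density D)).setReal 4 G.wmax with h4
  have hw0 : 0 < G.wmax := (wmin_pos G he).trans_le (wmin_le_wmax G he)
  have hcb : Ex.connBound.eval N σ4 = connBound (G.density D) G.wmax := by
    refine Ex.eval_connBound (by simp [h4]) (by simp [h4]) hw0 ?_
    refine (density_le_mul hw0.le fun u _ v _ => mat_le_wmax G u v he).trans ?_
    refine mul_le_mul_of_nonneg_left ?_ hw0.le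
    have := Finset.card_le_univ D
    rw [Fintype.card_fin] at this
    exact_mod_cast this.trans hn
  rw [hcb]
  set σ5 := σ4.setNat 23 (connBound (G.density D) G.wmax) with h5
  have c5 : Ctx G σ5 := ⟨by simp [h5, h4, c2.n_eq], c2.mat⟩
  have hB : (Ex.rle (.cast (.var 1)) (.rmul (.rvar 0) (.var 23))).Holds N σ5 ↔
      (k : ℝ) ≤ γ * (connBound (G.density D) G.wmax : ℝ) := by
    rw [Ex.holds_rle]
    simp [h5, h4, n1, r0]
  have b9 : msk n (σ5.natArr 9) = D := a9
  have b8 : msk n (σ5.natArr 8) = S := a8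
  refine ⟨D, hden, ?_⟩
  rw [Stmt.den_ite]
  by_cases hle : (k : ℝ) ≤ γ * (connBound (G.density D) G.wmax : ℝ)
  · rw [if_pos (hB.2 hle)]
    have := mader_spec (N := N) c5 (by omega) (b9.symm ▸ hDpos)
    rw [b9] at this
    exact Or.inl ⟨hle, this⟩
  · rw [if_neg (fun hh => hle (hB.1 hh))]
    exact Or.inr ⟨hle, by rw [msk_copyM hn, b8]⟩

/-- The states of the main loop with the results below `i` done. -/
structure MainInv (G : WeightedGraph (Fin n)) (γ : ℝ) (k : ℕ) (o : ℕ) (A : ℕ → ℕ → ℕ) (i : ℕ)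
    (σ : Store) : Prop where
  ctx : Ctx G σ
  k_eq : σ.natVar 1 = k
  γ_eq : σ.realVar 0 = γ
  o_eq : σ.natVar 20 = o
  A_eq : σ.natArr 15 = A
  result : (σ.natVar 24 = 0 ∧ ∀ j < i, j < o → ¬ G.IsMaxConn k (col n A j)) ∨
    (σ.natVar 24 = 1 ∧
      (∃ S, G.IsMaxConn k S ∧ BicriteriaPass G γ k S (msk n (σ.natArr 0))) ∧
      ∀ j < i, j < o → G.IsMaxConn k (col n A j) → ∃ R, BicriteriaPass G γ k (col n A j) R ∧
        G.density R ≤ G.density (msk n (σ.natArr 0)))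

theorem MainInv.setNat {γ : ℝ} {k o i v : ℕ} {A : ℕ → ℕ → ℕ} (h : MainInv G γ k o A i σ) :
    MainInv G γ k o A i (σ.setNat 21 v) :=
  ⟨h.ctx.setNat (by decide), by simp [h.k_eq], h.γ_eq, by simp [h.o_eq], h.A_eq,
    by simpa using h.result⟩

theorem mainBody_spec (hN : n + n + 1 < N) (he : G.graph.edgeSet.Nonempty) {γ : ℝ}
    {k o i : ℕ} {A : ℕ → ℕ → ℕ} (hk : 0 < k) (hoN : o < N)
    (hconn : ∀ j < o, G.IsConn k (col n A j))
    (hcover : ∀ T, G.IsConn k T → ∃ j < o, T ⊆ col n A j)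
    (h : MainInv G γ k o A i σ) (hi : σ.natVar 21 = i) :
    MainInv G γ k o A (i + 1) (mainBody.den N σ) := by
  have hn : n ≤ N := by omega
  obtain ⟨hctx, hk1, hγ, ho, hA, hres⟩ := h
  have hmax : Ex.isMax.Holds N σ ↔ i < o ∧ G.IsMaxConn k (col n A i) := by
    rw [holds_isMax hctx hn (by omega), hi, ho, hA]
    -- Every `k`-vertex-connected set is contained in a result, so maximality among the results is
    -- maximality in `G`.
    refine and_congr_right fun hio => ⟨fun h => ⟨hconn i hio, fun T hT hTc => ?_⟩, fun h j hj hij => ?_⟩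
    · obtain ⟨j, hj, hTj⟩ := hcover T hTc
      exact (hTj.trans (h j hj (hT.trans hTj))).antisymm hT
    · rw [h.2 _ hij (hconn j hj)]
  rw [mainBody, Stmt.den_ite]
  by_cases hm : i < o ∧ G.IsMaxConn k (col n A i)
  swap
  · rw [if_neg (fun hh => hm (hmax.1 hh)), Stmt.den_skip]
    refine ⟨hctx, hk1, hγ, ho, hA, ?_⟩
    have : ∀ j < i + 1, j < o → G.IsMaxConn k (col n A j) → j < i := by
      intro j hj hjo hjm
      rcases Nat.lt_succ_iff_lt_or_eq.1 hj with h | rfl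
      · exact h
      · exact absurd ⟨hjo, hjm⟩ hm
    refine hres.imp (fun ⟨g1, g2⟩ => ⟨g1, fun j hj hjo hjm => g2 j (this j hj hjo hjm) hjo hjm⟩)
      (fun ⟨g1, g2, g3⟩ => ⟨g1, g2, fun j hj hjo hjm => g3 j (this j hj hjo hjm) hjo hjm⟩)
  obtain ⟨hio, hm⟩ := hm
  rw [if_pos (hmax.2 ⟨hio, hm⟩), Stmt.den_seq, Stmt.den_seq]
  set σ1 := (Stmt.getCol 8 15 (.var 21)).den N σ with h1
  have c1 : Ctx G σ1 := hctx.den rfl rfl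
  have a8 : msk n (σ1.natArr 8) = col n A i := by
    rw [h1, msk_getCol hn 8 15 _ (j' := i) (by simp [hi]), hA]
  have hpass := pass_spec (σ := σ1) c1 hN he hk (by rw [h1, Stmt.natVar_den N _ rfl, hk1])
    (by rw [h1, Stmt.realVar_den N _ rfl, hγ]) (by rw [a8]; exact hm.1)
  rw [a8] at hpass
  set σ2 := pass.den N σ1 with h2
  have c2 : Ctx G σ2 := c1.den rfl rfl
  have v2 : ∀ x, x = 1 ∨ x = 20 ∨ x = 24 → σ2.natVar x = σ.natVar x := by
    rintro x (rfl | rfl | rfl) <;>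
      rw [h2, Stmt.natVar_den N _ rfl, h1, Stmt.natVar_den N _ rfl]
  have r2 : σ2.realVar 0 = γ := by
    rw [h2, Stmt.realVar_den N _ rfl, h1, Stmt.realVar_den N _ rfl, hγ]
  have a2 : ∀ a, a = 0 ∨ a = 15 → σ2.natArr a = σ.natArr a := by
    rintro x (rfl | rfl) <;>
      rw [h2, Stmt.natArr_den N _ rfl, h1, Stmt.natArr_den N _ rfl]
  set R := msk n (σ2.natArr 10) with hR
  have hB : (Ex.or (.not (.var 24)) (.rle (.dens 0) (.dens 10))).Holds N σ2 ↔
      ¬ 1 ≤ σ.natVar 24 ∨ G.density (msk n (σ.natArr 0)) ≤ G.density R := by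
    rw [Ex.holds_or, Ex.holds_not, Ex.holds_var, Ex.holds_rle, c2.dens hn, c2.dens hn,
      v2 24 (by decide), a2 0 (by decide)]
  rw [Stmt.den_ite]
  by_cases hup : ¬ 1 ≤ σ.natVar 24 ∨ G.density (msk n (σ.natArr 0)) ≤ G.density R
  · rw [if_pos (hB.2 hup), Stmt.den_seq, Stmt.den_set_nat, Ex.eval_const]
    have e0 : msk n (((Stmt.copyM 0 10).den N σ2).natArr 0) = R := msk_copyM hn 0 10
    refine ⟨(c2.den rfl rfl).setNat (by decide), ?_, ?_, ?_, ?_, Or.inr ⟨by simp, ?_, ?_⟩⟩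
    · rw [natVar_setNat, if_neg (by decide), Stmt.natVar_den N _ rfl, v2 1 (by decide), hk1]
    · rw [realVar_setNat, Stmt.realVar_den N _ rfl, r2]
    · rw [natVar_setNat, if_neg (by decide), Stmt.natVar_den N _ rfl, v2 20 (by decide), ho]
    · rw [natArr_setNat, Stmt.natArr_den N _ rfl, a2 15 (by decide), hA]
    · rw [natArr_setNat, e0]
      exact ⟨_, hm, hpass⟩
    · rw [natArr_setNat, e0]
      intro j hj hjo hjm
      rcases Nat.lt_succ_iff_lt_or_eq.1 hj with hlt | rfl
      · rcases hres with ⟨-, g2⟩ | ⟨g1, -, g3⟩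
        · exact absurd hjm (g2 j hlt hjo)
        · obtain ⟨R', h3, h4⟩ := g3 j hlt hjo hjm
          exact ⟨R', h3, h4.trans (hup.resolve_left (by omega))⟩
      · exact ⟨R, hpass, le_rfl⟩
  · rw [if_neg (fun hh => hup (hB.1 hh)), Stmt.den_skip]
    push Not at hup
    rcases hres with ⟨g1, -⟩ | ⟨g1, g2, g3⟩
    · omega
    refine ⟨c2, ?_, r2, ?_, ?_, Or.inr ⟨?_, ?_, ?_⟩⟩
    · rw [v2 1 (by decide), hk1]
    · rw [v2 20 (by decide), ho]
    · rw [a2 15 (by decide), hA]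
    · rw [v2 24 (by decide), g1]
    · rw [a2 0 (by decide)]; exact g2
    · rw [a2 0 (by decide)]
      intro j hj hjo hjm
      rcases Nat.lt_succ_iff_lt_or_eq.1 hj with hlt | rfl
      · exact g3 j hlt hjo hjm
      · exact ⟨R, hpass, hup.2.le⟩

theorem bicriteria_spec (hσ : Ctx G σ) (hN : n + n + 1 < N) (he : G.graph.edgeSet.Nonempty) {k : ℕ}
    {γ : ℝ} (hk : 0 < k) (hk1 : σ.natVar 1 = k) (hγ : σ.realVar 0 = γ) :
    BicriteriaAlgorithm G γ k (readOutput n (bicriteria.den N σ)) := by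
  rw [bicriteria, Stmt.den_seq, Stmt.den_seq, Stmt.den_seq, Stmt.den_set_nat, Stmt.den_set_nat,
    Ex.eval_var, Ex.eval_const]
  obtain ⟨hoN, hconn, hcover⟩ := enum_spec hσ hk hk1 hN
  set σ1 := enum.den N σ with h1
  set o := σ1.natVar 20 with ho
  set A := σ1.natArr 15 with hA
  have key : MainInv G γ k o A N ((Stmt.forAll 21 mainBody).den N (σ1.setNat 24 0)) := by
    refine Stmt.forAll_inv N _ (x := 21) rfl (I := MainInv G γ k o A) ?_ ?_
    · refine MainInv.setNat ⟨(hσ.den rfl rfl).setNat (by decide), ?_, ?_, by simp [ho], hA.symm,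
        Or.inl ⟨by simp, fun j hj => by omega⟩⟩
      · rw [natVar_setNat, if_neg (by decide), h1, Stmt.natVar_den N _ rfl, hk1]
      · rw [realVar_setNat, h1, Stmt.realVar_den N _ rfl, hγ]
    · intro i τ _ hiτ hinv
      exact (mainBody_spec hN he hk hoN hconn hcover hinv hiτ).setNat
  set σ2 := (Stmt.forAll 21 mainBody).den N (σ1.setNat 24 0)
  have hall : ∀ S, G.IsMaxConn k S → ∃ j < o, col n A j = S := by
    intro S hS
    obtain ⟨j, hj, hSj⟩ := hcover S hS.1
    exact ⟨j, hj, hS.2 _ hSj (hconn j hj)⟩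
  rcases key.result with ⟨g1, g2⟩ | ⟨g1, ⟨S, hS, hpass⟩, g3⟩
  · have : readOutput n (σ2.setNat 0 (σ2.natVar 24)) = none := by simp [readOutput, g1]
    rw [this]
    intro S hS
    obtain ⟨j, hj, rfl⟩ := hall S hS
    exact g2 j (hj.trans hoN) hj hS
  · have : readOutput n (σ2.setNat 0 (σ2.natVar 24)) = some (msk n (σ2.natArr 0)) := by
      rw [readOutput, natVar_setNat, if_pos rfl, g1, if_neg one_ne_zero, msk, natArr_setNat]
      simp only [Nat.one_le_iff_ne_zero]
    rw [this]
    set B := msk n (σ2.natArr 0)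
    have hex : ∀ S', ∃ R, G.IsMaxConn k S' →
        BicriteriaPass G γ k S' R ∧ G.density R ≤ G.density B := by
      intro S'
      by_cases hS' : G.IsMaxConn k S'
      · obtain ⟨j, hj, rfl⟩ := hall S' hS'
        obtain ⟨R, hR⟩ := g3 j (hj.trans hoN) hj hS'
        exact ⟨R, fun _ => hR⟩
      · exact ⟨∅, fun h => absurd h hS'⟩
    choose f hf using hex
    -- The selection takes the returned set at `S`, and at each other maximal set some pass result
    -- that is not denser.
    refine ⟨Function.update f S B, fun S' hS' => ?_, ⟨S, hS, by simp⟩, fun S' hS' => ?_⟩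
    · by_cases h : S' = S
      · subst h; simpa using hpass
      · rw [Function.update_of_ne h]; exact (hf S' hS').1
    · by_cases h : S' = S
      · subst h; simp
      · rw [Function.update_of_ne h]; exact (hf S' hS').2

end

/-! ### Polynomial-time implementation and the main theorem -/

theorem bicriteria_implements : ImplementsInPolyTime bicriteria.prog := by
  refine implements_of_stmt bicriteria fun n G γ k _ he _ _ hk => ?_
  refine bicriteria_spec (σ := startStore G γ k) ⟨by simp [startStore], fun u v => ?_⟩
    (by unfold loopBound; omega) he hk (by simp [startStore]) (by simp [startStore])
  simp [startStore, inputStore, WeightedGraph.mat]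

end DenseSub

open DenseSub

theorem theorem4 :
    (∃ P : Prog, ImplementsInPolyTime P) ∧
    ∀ {V : Type*} [Fintype V] [DecidableEq V] (G : WeightedGraph V) (k : ℕ),
      G.graph.Connected → G.graph.edgeSet.Nonempty → 0 < k →
        (∀ γ : ℝ, 1 ≤ γ → γ ≤ 2 → ∀ out : Option (Finset V), BicriteriaAlgorithm G γ k out →
          IsBicriteriaOutput G (γ / 4 * (G.wmin / G.wmax)) (1 / γ) k out) ∧
        (∀ out : Option (Finset V), BicriteriaAlgorithm G 1 k out →
          IsApproxOutput G (1 / 4 * (G.wmin / G.wmax)) k out) :=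
  ⟨⟨_, bicriteria_implements⟩, fun G _ _ he hk =>
    ⟨fun _ h1 h2 _ h => isBicriteriaOutput_of_algorithm G hk he h1 h2 h,
      fun _ h => isApproxOutput_of_algorithm G hk he h⟩⟩
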